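/- **Terms and algebras.** An $OL^+$ is an ortholattice $(L,\wedge,\vee,\neg,\top,\bot)$ (a bounded lattice with $\neg\neg x=x$, $x\vee\neg x=\top$, $x\wedge\neg x=\bot$, $\neg(x\vee y)=\neg x\wedge\neg y$, $\neg(x\wedge y)=\neg x\vee\neg y$) together with, for each letter $f$ of a countably infinite alphabet and all $i,j,k\in\mathbb N$, an operation $f^{i,j,k}$ of arity $i+j+k$ that is monotone in the arguments $i+1,\dots,i+j$ and antitone in the last $k$ arguments (nothing is required of the first $i$). $OL^+$ terms are built from a countably infinite set $X$ of variables with $\wedge,\vee,\neg,\top,\bot$ and the symbols $f^{i,j,k}$; the size of a term is the number of its nodes. For a finite list $A$ of pairs $(a_1,b_1),\dots,(a_m,b_m)$ of terms, read as inequalities $a_l\le b_l$, and terms $S,T$, write $S\le_{OL^+|A}T$ if for every $OL^+$ $L$ and every valuation $X\to L$ under which all the inequalities in $A$ hold, $S\le T$ holds under the same valuation. (The inequalities in $A$ are ground: their variables are not universally quantified.) **The proof system $CF^+$.** Annotated terms are $S^L$ and $S^R$ for terms $S$; a sequent is an unordered pair $\Gamma,\Delta$ of annotated terms. The rules of $CF^+$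 with axioms $A$ are, for arbitrary $\Gamma,\Delta,S,T$: without premises, $S^L,S^R$; $\ \bot^L,\Delta$; $\ \Gamma,\top^R$; from $\Gamma,\Gamma$ infer $\Gamma,\Delta$; from $\Gamma,S^L$ or from $\Gamma,T^L$ infer $\Gamma,(S\wedge T)^L$; from $\Gamma,S^R$ and $\Gamma,T^R$ infer $\Gamma,(S\wedge T)^R$; from $\Gamma,S^L$ and $\Gamma,T^L$ infer $\Gamma,(S\vee T)^L$; from $\Gamma,S^R$ or from $\Gamma,T^R$ infer $\Gamma,(S\vee T)^R$; from $\Gamma,S^R$ infer $\Gamma,(\neg S)^L$; from $\Gamma,S^L$ infer $\Gamma,(\neg S)^R$; for $F=f^{i,j,k}$, from $S_l^L,T_l^R$ for all $l\le i+j$ together with $T_l^L,S_l^R$ for all $l\le i$ and all $l>i+j$, infer $F(S_1,\dots,S_{i+j+k})^L,F(T_1,\dots,T_{i+j+k})^R$; and for $(S,T)\in A$, from $\Gamma,S^R$ and $T^L,\Delta$ infer $\Gamma,\Delta$. **Theorem.** There is an algorithm that, given a finite list $A$ of inequalities between $OL^+$ terms and a sequent $\Gamma,\Delta$, decides in time $O(n^2(1+|A|))$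 whether $\Gamma,\Delta$ has a proof in $CF^+$ with axioms $A$, where $n$ is the total size of the terms in $A$, $\Gamma$ and $\Delta$; and, on the sequent $S^L,T^R$, it decides whether $S\le_{OL^+|A}T$. Time is the number of steps of a fixed program on a word RAM. Its elementary instructions are constants, copying, addition, truncated subtraction, multiplication, and indirect loading and storing, and its tests compare two registers; each costs one step. The input gives $|A|$, the annotations of $\Gamma,\Delta$ and the terms in prefix notation, with a constant number of words per node and with variables and letters $f$ named by natural numbers. The constant in the $O$ is absolute, and the bound holds on every machine whose words can hold the numbers of the input and have at least $\kappa\log_2 n$ bits, for some absolute constant $\kappa$. -/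

import Mathlib

universe u

/-! ## Terms, ortholattices with monotonic functions, entailment -/

/-- Terms over the signature of ortholattices with function symbols `f^{i,j,k}`.  Variables and
the letters `f` range over the countably infinite set `ℕ`; a symbol is identified by its letter
together with the numbers `i`, `j`, `k` of its invariant, covariant and contravariant arguments. -/
inductive OLTerm : Type
  | var (x : ℕ) : OLTerm
  | bot : OLTerm
  | top : OLTerm
  | neg (s : OLTerm) : OLTerm
  | meet (s t : OLTerm) : OLTerm
  | join (s t : OLTerm) : OLTerm
  | func (f i j k : ℕ) (x : Fin i → OLTerm) (y : Fin j → OLTerm) (z : Fin k → OLTerm) : OLTerm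

/-- The size of a term: the number of nodes of the tree. -/
def OLTerm.size : OLTerm → ℕ
  | .var _ => 1
  | .bot => 1
  | .top => 1
  | .neg s => s.size + 1
  | .meet s t => s.size + t.size + 1
  | .join s t => s.size + t.size + 1
  | .func _ _ _ _ x y z =>
      (∑ a, (x a).size) + (∑ b, (y b).size) + (∑ c, (z c).size) + 1

/-- Ortholattices: bounded lattices with an involutive complement satisfying De Morgan's laws. -/
class Ortholattice (α : Type u) extends Lattice α, BoundedOrder α, Compl α where
  compl_compl' : ∀ x : α, xᶜᶜ = x
  sup_compl' : ∀ x : α, x ⊔ xᶜ = ⊤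
  inf_compl' : ∀ x : α, x ⊓ xᶜ = ⊥
  compl_sup' : ∀ x y : α, (x ⊔ y)ᶜ = xᶜ ⊓ yᶜ
  compl_inf' : ∀ x y : α, (x ⊓ y)ᶜ = xᶜ ⊔ yᶜ

/-- The algebras `OL⁺`: ortholattices with an operation for every symbol `f^{i,j,k}`, which is
monotone in the covariant and antitone in the contravariant arguments. -/
class OLPlus (α : Type u) extends Ortholattice α where
  op : (f i j k : ℕ) → (Fin i → α) → (Fin j → α) → (Fin k → α) → α
  op_le_op : ∀ (f i j k : ℕ) (x : Fin i → α) (y y' : Fin j → α) (z z' : Fin k → α),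
    (∀ b, y b ≤ y' b) → (∀ c, z' c ≤ z c) → op f i j k x y z ≤ op f i j k x y' z'

/-- The value of a term under a valuation of the variables. -/
def OLTerm.eval {α : Type u} [OLPlus α] (v : ℕ → α) : OLTerm → α
  | .var x => v x
  | .bot => ⊥
  | .top => ⊤
  | .neg s => (s.eval v)ᶜ
  | .meet s t => s.eval v ⊓ t.eval v
  | .join s t => s.eval v ⊔ t.eval v
  | .func f i j k x y z =>
      OLPlus.op f i j k (fun a => (x a).eval v) (fun b => (y b).eval v) (fun c => (z c).eval v)

/-- `S ≤ T` holds in every `OL⁺` satisfying the inequalities in `A`.  The inequalities in `A` are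
ground: the variables are generators, interpreted in the same way in `A`, `S` and `T`. -/
def Entails (A : List (OLTerm × OLTerm)) (S T : OLTerm) : Prop :=
  ∀ (α : Type u) [OLPlus α] (v : ℕ → α),
    (∀ p ∈ A, p.1.eval v ≤ p.2.eval v) → S.eval v ≤ T.eval v

/-! ## The proof system `CF⁺` -/

/-- Annotated terms `S^L` and `S^R`. -/
inductive AnnTerm : Type
  | L (s : OLTerm) : AnnTerm
  | R (s : OLTerm) : AnnTerm

/-- The term underlying an annotated term. -/
def AnnTerm.term : AnnTerm → OLTerm
  | .L s => s
  | .R s => s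

open AnnTerm in
/-- `CFPlus A Γ Δ`: the sequent `Γ, Δ` has a proof in `CF⁺` with axioms `A`.  Sequents are
unordered pairs of annotated terms, which is expressed by the rule `swap`. -/
inductive CFPlus (A : List (OLTerm × OLTerm)) : AnnTerm → AnnTerm → Prop
  | swap {Γ Δ : AnnTerm} : CFPlus A Γ Δ → CFPlus A Δ Γ
  | hyp (S : OLTerm) : CFPlus A (L S) (R S)
  | replace {Γ : AnnTerm} (Δ : AnnTerm) : CFPlus A Γ Γ → CFPlus A Γ Δ
  | leftBot (Δ : AnnTerm) : CFPlus A (L .bot) Δ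
  | rightTop (Γ : AnnTerm) : CFPlus A Γ (R .top)
  | leftAnd₁ {Γ : AnnTerm} {S T : OLTerm} : CFPlus A Γ (L S) → CFPlus A Γ (L (.meet S T))
  | leftAnd₂ {Γ : AnnTerm} {S T : OLTerm} : CFPlus A Γ (L T) → CFPlus A Γ (L (.meet S T))
  | rightAnd {Γ : AnnTerm} {S T : OLTerm} :
      CFPlus A Γ (R S) → CFPlus A Γ (R T) → CFPlus A Γ (R (.meet S T))
  | leftOr {Γ : AnnTerm} {S T : OLTerm} :
      CFPlus A Γ (L S) → CFPlus A Γ (L T) → CFPlus A Γ (L (.join S T))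
  | rightOr₁ {Γ : AnnTerm} {S T : OLTerm} : CFPlus A Γ (R S) → CFPlus A Γ (R (.join S T))
  | rightOr₂ {Γ : AnnTerm} {S T : OLTerm} : CFPlus A Γ (R T) → CFPlus A Γ (R (.join S T))
  | leftNot {Γ : AnnTerm} {S : OLTerm} : CFPlus A Γ (R S) → CFPlus A Γ (L (.neg S))
  | rightNot {Γ : AnnTerm} {S : OLTerm} : CFPlus A Γ (L S) → CFPlus A Γ (R (.neg S))
  | funcRule (f i j k : ℕ) {x x' : Fin i → OLTerm} {y y' : Fin j → OLTerm}
      {z z' : Fin k → OLTerm} :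
      (∀ a, CFPlus A (L (x a)) (R (x' a))) → (∀ a, CFPlus A (L (x' a)) (R (x a))) →
      (∀ b, CFPlus A (L (y b)) (R (y' b))) → (∀ c, CFPlus A (L (z' c)) (R (z c))) →
      CFPlus A (L (.func f i j k x y z)) (R (.func f i j k x' y' z'))
  | axiomCut {Γ Δ : AnnTerm} {S T : OLTerm} : (S, T) ∈ A →
      CFPlus A Γ (R S) → CFPlus A (L T) Δ → CFPlus A Γ Δ

/-! ## A word RAM with step count

Registers and memory cells hold natural numbers.  The memory consists of banks (arrays); an
instruction names its bank literally, so a program uses finitely many registers and banks. -/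

/-- The contents `reg r` of register `r`, and `mem b a` of the cell with address `a` in bank `b`. -/
structure RamState : Type where
  reg : ℕ → ℕ
  mem : ℕ → ℕ → ℕ

/-- Elementary instructions; `d` is the destination register, `r` and `s` are registers. -/
inductive RamInstr : Type
  | const (d c : ℕ) : RamInstr
  | copy (d r : ℕ) : RamInstr
  | add (d r s : ℕ) : RamInstr
  | sub (d r s : ℕ) : RamInstr
  | mul (d r s : ℕ) : RamInstr
  /-- `d := mem b (reg r)` -/
  | load (d b r : ℕ) : RamInstr
  /-- `mem b (reg r) := reg s` -/
  | store (b r s : ℕ) : RamInstr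

/-- The effect of an instruction; subtraction is truncated at `0`. -/
def RamInstr.apply (σ : RamState) : RamInstr → RamState
  | .const d c => { σ with reg := Function.update σ.reg d c }
  | .copy d r => { σ with reg := Function.update σ.reg d (σ.reg r) }
  | .add d r s => { σ with reg := Function.update σ.reg d (σ.reg r + σ.reg s) }
  | .sub d r s => { σ with reg := Function.update σ.reg d (σ.reg r - σ.reg s) }
  | .mul d r s => { σ with reg := Function.update σ.reg d (σ.reg r * σ.reg s) }
  | .load d b r => { σ with reg := Function.update σ.reg d (σ.mem b (σ.reg r)) }
  | .store b r s =>
      { σ with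
        mem := Function.update σ.mem b (Function.update (σ.mem b) (σ.reg r) (σ.reg s)) }

/-- No overflow: the number produced by the instruction fits into a word of `w` bits.  The
instructions without a condition here do not produce numbers larger than those already stored. -/
def RamInstr.NoOverflow (w : ℕ) (σ : RamState) : RamInstr → Prop
  | .const _ c => c < 2 ^ w
  | .add _ r s => σ.reg r + σ.reg s < 2 ^ w
  | .mul _ r s => σ.reg r * σ.reg s < 2 ^ w
  | _ => True

/-- Tests on two registers. -/
inductive RamTest : Type
  | eq (r s : ℕ) : RamTest
  | lt (r s : ℕ) : RamTest

/-- The truth of a test in a state. -/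
def RamTest.Holds (σ : RamState) : RamTest → Prop
  | .eq r s => σ.reg r = σ.reg s
  | .lt r s => σ.reg r < σ.reg s

/-- Programs; `loop b p` is the loop `while b do p`. -/
inductive RamProg : Type
  | skip : RamProg
  | instr (i : RamInstr) : RamProg
  | seq (p q : RamProg) : RamProg
  | ite (b : RamTest) (p q : RamProg) : RamProg
  | loop (b : RamTest) (p : RamProg) : RamProg

/-- `RamExec w p σ t τ`: on a machine with words of `w` bits, the program `p` started in the state
`σ` halts in the state `τ` after exactly `t` steps, without overflow.  Every elementary
instruction, every `skip` and every evaluation of a test is one step. -/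
inductive RamExec (w : ℕ) : RamProg → RamState → ℕ → RamState → Prop
  | skip (σ : RamState) : RamExec w .skip σ 1 σ
  | instr {i : RamInstr} {σ : RamState} : i.NoOverflow w σ → RamExec w (.instr i) σ 1 (i.apply σ)
  | seq {p q : RamProg} {σ τ υ : RamState} {t₁ t₂ : ℕ} :
      RamExec w p σ t₁ τ → RamExec w q τ t₂ υ → RamExec w (.seq p q) σ (t₁ + t₂) υ
  | iteTrue {b : RamTest} {p q : RamProg} {σ τ : RamState} {t : ℕ} :
      b.Holds σ → RamExec w p σ t τ → RamExec w (.ite b p q) σ (t + 1) τ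
  | iteFalse {b : RamTest} {p q : RamProg} {σ τ : RamState} {t : ℕ} :
      ¬ b.Holds σ → RamExec w q σ t τ → RamExec w (.ite b p q) σ (t + 1) τ
  | loopTrue {b : RamTest} {p : RamProg} {σ τ υ : RamState} {t₁ t₂ : ℕ} :
      b.Holds σ → RamExec w p σ t₁ τ → RamExec w (.loop b p) τ t₂ υ →
      RamExec w (.loop b p) σ (t₁ + t₂ + 1) υ
  | loopFalse {b : RamTest} {p : RamProg} {σ : RamState} :
      ¬ b.Holds σ → RamExec w (.loop b p) σ 1 σ

/-- The initial state on an input: the input in bank `0`, its length in register `0`, and `0`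
everywhere else. -/
def RamState.init (inp : List ℕ) : RamState where
  reg := Function.update (fun _ => 0) 0 inp.length
  mem := Function.update (fun _ _ => 0) 0 (fun a => inp.getD a 0)

/-! ## Instances as inputs of the machine -/

/-- A term in prefix (Polish) notation; every node is written as a record of five words. -/
def OLTerm.encode : OLTerm → List ℕ
  | .var x => [0, x, 0, 0, 0]
  | .bot => [1, 0, 0, 0, 0]
  | .top => [2, 0, 0, 0, 0]
  | .neg s => [3, 0, 0, 0, 0] ++ s.encode
  | .meet s t => [4, 0, 0, 0, 0] ++ s.encode ++ t.encode
  | .join s t => [5, 0, 0, 0, 0] ++ s.encode ++ t.encode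
  | .func f i j k x y z =>
      [6, f, i, j, k] ++ (List.ofFn fun a => (x a).encode).flatten ++
        (List.ofFn fun b => (y b).encode).flatten ++ (List.ofFn fun c => (z c).encode).flatten

/-- The annotation as a number. -/
def AnnTerm.side : AnnTerm → ℕ
  | .L _ => 0
  | .R _ => 1

/-- The input that presents the axioms `A` and the sequent `Γ, Δ`: the number of axioms, the two
annotations, the terms of the axioms, and the two terms of the sequent. -/
def instanceInput (A : List (OLTerm × OLTerm)) (Γ Δ : AnnTerm) : List ℕ :=
  [A.length, Γ.side, Δ.side] ++ A.flatMap (fun p => p.1.encode ++ p.2.encode) ++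
    Γ.term.encode ++ Δ.term.encode

/-- The total size of the terms in `A`, `Γ` and `Δ`. -/
def instanceSize (A : List (OLTerm × OLTerm)) (Γ Δ : AnnTerm) : ℕ :=
  (A.map fun p => p.1.size + p.2.size).sum + Γ.term.size + Δ.term.size

/-- On the instance given by `A`, `Γ`, `Δ`, of total size `n`, the program `p` decides the
proposition `Q` (answer `1` or `0` in register `0`) within `C * n ^ 2 * (1 + |A|)` steps.  It does
so on every machine whose words can hold the numbers of the input and have at least `k * log₂ n`
bits. -/
def DecidesInTime (p : RamProg) (C k : ℕ) (A : List (OLTerm × OLTerm)) (Γ Δ : AnnTerm)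
    (Q : Prop) : Prop :=
  ∀ w : ℕ, (∀ a ∈ instanceInput A Γ Δ, a < 2 ^ w) → instanceSize A Γ Δ ^ k ≤ 2 ^ w →
    ∃ (t : ℕ) (τ : RamState),
      RamExec w p (RamState.init (instanceInput A Γ Δ)) t τ ∧
      t ≤ C * instanceSize A Γ Δ ^ 2 * (1 + A.length) ∧
      (Q → τ.reg 0 = 1) ∧ (¬ Q → τ.reg 0 = 0)

/-! ## Soundness and completeness of `CF⁺` -/

section Ortho

variable {α : Type u} [Ortholattice α]

/-! The logical half is a semantic cut elimination. Provability of a sequent is a symmetric relation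
on annotated terms and so defines an orthogonality; the sets equal to their double orthogonal form
an ortholattice, where the rule `replace` makes the meet of `X` and its orthogonal the least
element. A variable is interpreted by the closure of its left annotation, and `f` by the closure of
those terms `f(x, y, z)` whose arguments are approximated by the given sets. Induction on `S` puts
`S^L` into the value of `S` and `S^R` into its orthocomplement (`ClosedSet.mem_eval`), and the axiom
rule makes the axioms true in this model. Hence, if `S ≤ T` is entailed, `S^L` lies in the value of
`T` and is orthogonal to `T^R`. Together with `CFPlus.sound` this is `entails_iff_cfPlus`.

For the algorithm, note that every premise of a rule is built from subterms of the conclusion or of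
an axiom. So it is enough to saturate a relation on the `2 * N` annotated nodes of the input
(`NodeTable.complete`), which has at most `4 * N ^ 2` facts. Equal subterms at different nodes are
not identified. Instead the connectives are also treated as monotone or antitone function symbols,
and the sequents `S^L, S^R` are derived bottom up by congruence (`NodeTable.rel_of_eq`).

Saturation is forward chaining with a worklist. Its invariant `RuleClosed` says that all rules with
premises among the processed facts have their conclusions among the found facts; `RuleClosed.insert`
preserves it, and at the end the two sets coincide. Conversely all found facts lie in a relation
closed under the steps of the algorithm (`StepClosed`), and provability is one.

Each fact is processed once, in both orientations. The logical rules cost constant time. Facts `(g,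
g)` cost `O(N)`, and there are at most `2 * N` of them. An axiom costs `O(N)` for each fact with a
member among at most `2 * |A|` annotated nodes, which gives the summand `N ^ 2 * |A|`. The rule for
function symbols is tried when two nodes at the same position below equally labelled parents become
related, and then costs the arity. If the first member is fixed, the position is fixed, so every
parent of a second member is met at most twice; as the arities add up to at most `N`, this is `O(N)`
for each first member and `O(N ^ 2)` altogether (`sum_congruenceRuleCost_le`). The tables are read
off the prefix notation backwards in quadratic time. -/

theorem Ortholattice.compl_le_compl {x y : α} (h : x ≤ y) : yᶜ ≤ xᶜ := by
  have h1 := Ortholattice.compl_sup' x y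
  rw [sup_eq_right.2 h] at h1
  rw [h1]
  exact inf_le_left

theorem Ortholattice.le_compl_comm {x y : α} (h : x ≤ yᶜ) : y ≤ xᶜ := by
  simpa [Ortholattice.compl_compl'] using Ortholattice.compl_le_compl h

/-- This is the semantic content of the rule `replace`. -/
theorem Ortholattice.eq_bot_of_le_compl {x : α} (h : x ≤ xᶜ) : x = ⊥ := by
  rw [← Ortholattice.inf_compl' x]
  exact (inf_eq_left.2 h).symm

end Ortho

/-- The value of an annotated term: right annotations are complemented. -/
def AnnTerm.eval {α : Type u} [OLPlus α] (v : ℕ → α) : AnnTerm → α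
  | .L s => s.eval v
  | .R s => (s.eval v)ᶜ

open Ortholattice in
-- With right annotations read as complements, exchanging the two sides is contraposition. Each rule
-- changes only one side, apart from the rule for function symbols and the axiom rule, so plain
-- lattice inequalities suffice and distributivity is never needed.
theorem CFPlus.sound {A : List (OLTerm × OLTerm)} {Γ Δ : AnnTerm} (h : CFPlus A Γ Δ)
    {α : Type u} [OLPlus α] (v : ℕ → α) (hA : ∀ p ∈ A, p.1.eval v ≤ p.2.eval v) :
    Γ.eval v ≤ (Δ.eval v)ᶜ := by
  induction h with
  | swap _ ih => exact le_compl_comm ih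
  | hyp S => simp [AnnTerm.eval, compl_compl']
  | replace Δ _ ih => rw [eq_bot_of_le_compl ih]; exact bot_le
  | leftBot Δ => simp [AnnTerm.eval, OLTerm.eval]
  | rightTop Γ => simp [AnnTerm.eval, OLTerm.eval, compl_compl']
  | leftAnd₁ _ ih =>
    refine ih.trans (compl_le_compl ?_)
    simp [AnnTerm.eval, OLTerm.eval]
  | leftAnd₂ _ ih =>
    refine ih.trans (compl_le_compl ?_)
    simp [AnnTerm.eval, OLTerm.eval]
  | rightAnd _ _ ih₁ ih₂ =>
    simp only [AnnTerm.eval, OLTerm.eval, compl_compl'] at *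
    exact le_inf ih₁ ih₂
  | leftOr _ _ ih₁ ih₂ =>
    simp only [AnnTerm.eval, OLTerm.eval, compl_sup'] at *
    exact le_inf ih₁ ih₂
  | rightOr₁ _ ih =>
    simp only [AnnTerm.eval, OLTerm.eval, compl_compl'] at *
    exact ih.trans le_sup_left
  | rightOr₂ _ ih =>
    simp only [AnnTerm.eval, OLTerm.eval, compl_compl'] at *
    exact ih.trans le_sup_right
  | leftNot _ ih => exact ih
  | rightNot _ ih => simpa only [AnnTerm.eval, OLTerm.eval, compl_compl'] using ih
  | funcRule f i j k _ _ _ _ ih₁ ih₂ ih₃ ih₄ =>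
    simp only [AnnTerm.eval, OLTerm.eval, compl_compl'] at *
    -- Nothing is known about the operation in its invariant arguments, so these must have equal
    -- values; the two families of premises give both inequalities.
    have : (fun a => OLTerm.eval v _) = fun a => OLTerm.eval v _ :=
      funext fun a => le_antisymm (ih₁ a) (ih₂ a)
    rw [this]
    exact OLPlus.op_le_op _ _ _ _ _ _ _ _ _ ih₃ ih₄
  | axiomCut hm _ _ ih₁ ih₂ =>
    simp only [AnnTerm.eval, compl_compl'] at *
    exact (ih₁.trans (hA _ hm)).trans ih₂

/-- The annotated terms that form a provable sequent with all members of `X`. -/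
def CFPlus.perp (A : List (OLTerm × OLTerm)) (X : Set AnnTerm) : Set AnnTerm :=
  {Δ | ∀ Γ ∈ X, CFPlus A Γ Δ}

namespace CFPlus

variable {A : List (OLTerm × OLTerm)}

theorem perp_anti {X Y : Set AnnTerm} (h : X ⊆ Y) : perp A Y ⊆ perp A X :=
  fun _ hΔ Γ hΓ => hΔ Γ (h hΓ)

theorem subset_perp_perp (X : Set AnnTerm) : X ⊆ perp A (perp A X) :=
  fun Γ hΓ _ hΔ => (hΔ Γ hΓ).swap

theorem perp_perp_perp (X : Set AnnTerm) : perp A (perp A (perp A X)) = perp A X :=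
  (perp_anti (subset_perp_perp X)).antisymm (subset_perp_perp _)

theorem perp_perp_inter {X Y : Set AnnTerm} (hX : perp A (perp A X) = X)
    (hY : perp A (perp A Y) = Y) : perp A (perp A (X ∩ Y)) = X ∩ Y := by
  refine Set.Subset.antisymm (Set.subset_inter ?_ ?_) (subset_perp_perp _)
  · exact (perp_anti (perp_anti Set.inter_subset_left)).trans hX.subset
  · exact (perp_anti (perp_anti Set.inter_subset_right)).trans hY.subset

end CFPlus

/-! ### The model of closed sets and completeness -/

open CFPlus

/-- The algebra of closed sets of annotated terms. -/
@[ext]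
structure ClosedSet (A : List (OLTerm × OLTerm)) : Type u where
  set : Set AnnTerm
  closed : perp A (perp A set) = set

namespace ClosedSet

variable {A : List (OLTerm × OLTerm)}

instance : LE (ClosedSet.{u} A) := ⟨fun X Y => X.set ⊆ Y.set⟩

instance : PartialOrder (ClosedSet.{u} A) where
  le_refl X := Set.Subset.refl X.set
  le_trans _ _ _ h h' := Set.Subset.trans h h'
  le_antisymm _ _ h h' := ClosedSet.ext (Set.Subset.antisymm h h')

/-- The orthocomplement. -/
instance : Compl (ClosedSet.{u} A) := ⟨fun X => ⟨perp A X.set, perp_perp_perp _⟩⟩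

theorem compl_set (X : ClosedSet.{u} A) : Xᶜ.set = perp A X.set := rfl

theorem compl_compl (X : ClosedSet.{u} A) : Xᶜᶜ = X := ClosedSet.ext X.closed

theorem compl_anti {X Y : ClosedSet.{u} A} (h : X ≤ Y) : Yᶜ ≤ Xᶜ := perp_anti h

/-- The intersection of two closed sets. -/
def inter (X Y : ClosedSet.{u} A) : ClosedSet.{u} A :=
  ⟨X.set ∩ Y.set, perp_perp_inter X.closed Y.closed⟩

instance : Lattice (ClosedSet.{u} A) where
  inf := inter
  sup X Y := (inter Xᶜ Yᶜ)ᶜ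
  inf_le_left _ _ := Set.inter_subset_left
  inf_le_right _ _ := Set.inter_subset_right
  le_inf _ _ _ h h' := Set.subset_inter h h'
  le_sup_left X Y := by
    have h : inter Xᶜ Yᶜ ≤ Xᶜ := Set.inter_subset_left
    simpa only [compl_compl] using compl_anti h
  le_sup_right X Y := by
    have h : inter Xᶜ Yᶜ ≤ Yᶜ := Set.inter_subset_right
    simpa only [compl_compl] using compl_anti h
  sup_le X Y Z h h' := by
    have : Zᶜ ≤ inter Xᶜ Yᶜ := Set.subset_inter (compl_anti h) (compl_anti h')
    simpa only [compl_compl] using compl_anti this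

theorem sup_eq (X Y : ClosedSet.{u} A) : X ⊔ Y = (Xᶜ ⊓ Yᶜ)ᶜ := rfl

instance : BoundedOrder (ClosedSet.{u} A) where
  top := ⟨Set.univ, Set.eq_univ_of_univ_subset (subset_perp_perp _)⟩
  bot := ⟨perp A Set.univ, perp_perp_perp _⟩
  le_top _ := Set.subset_univ _
  bot_le X := (perp_anti (Set.subset_univ (perp A X.set))).trans X.closed.subset

/-- A member of both sets is orthogonal to itself, hence by `replace` to everything. -/
theorem inf_compl (X : ClosedSet.{u} A) : X ⊓ Xᶜ = ⊥ := by
  refine le_antisymm (fun Γ hΓ Δ _ => ?_) bot_le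
  exact (CFPlus.replace Δ (hΓ.2 Γ hΓ.1)).swap

theorem compl_bot : (⊥ : ClosedSet.{u} A)ᶜ = ⊤ := compl_compl ⊤

instance : Ortholattice (ClosedSet.{u} A) where
  compl_compl' := compl_compl
  sup_compl' X := by
    rw [sup_eq, inf_compl, compl_bot]
  inf_compl' := inf_compl
  compl_sup' X Y := by rw [sup_eq, compl_compl]
  compl_inf' X Y := by rw [sup_eq, compl_compl, compl_compl]

/-- The left annotated terms `f(x, y, z)` whose arguments are approximated by the given sets. -/
def opGen (f i j k : ℕ) (X : Fin i → ClosedSet.{u} A) (Y : Fin j → ClosedSet.{u} A)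
    (Z : Fin k → ClosedSet.{u} A) : Set AnnTerm :=
  {Γ | ∃ x y z, Γ = AnnTerm.L (.func f i j k x y z) ∧
    (∀ a, AnnTerm.L (x a) ∈ (X a).set ∧ AnnTerm.R (x a) ∈ (X a)ᶜ.set) ∧
    (∀ b, AnnTerm.L (y b) ∈ (Y b).set) ∧ ∀ c, AnnTerm.R (z c) ∈ (Z c)ᶜ.set}

instance : OLPlus (ClosedSet.{u} A) where
  op f i j k X Y Z := ⟨perp A (perp A (opGen f i j k X Y Z)), perp_perp_perp _⟩
  op_le_op f i j k X Y Y' Z Z' hY hZ := by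
    refine perp_anti (perp_anti ?_)
    rintro _ ⟨x, y, z, rfl, hx, hy, hz⟩
    exact ⟨x, y, z, rfl, hx, fun b => hY b (hy b), fun c => compl_anti (hZ c) (hz c)⟩

/-- The valuation by the closures of the generators. -/
def val (A : List (OLTerm × OLTerm)) (n : ℕ) : ClosedSet.{u} A :=
  ⟨perp A (perp A {AnnTerm.L (.var n)}), perp_perp_perp _⟩

/-- The value of `S` lies between the closure of `S^L` and the orthogonal of `S^R`. Such a bound
from both sides replaces a computation of the value, and it can be proved without a general cut
rule. -/
theorem mem_eval (S : OLTerm) :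
    AnnTerm.L S ∈ (S.eval (val.{u} A)).set ∧ AnnTerm.R S ∈ (S.eval (val.{u} A))ᶜ.set := by
  induction S with
  | var n =>
    refine ⟨subset_perp_perp _ rfl, ?_⟩
    rw [OLTerm.eval, compl_set, val, perp_perp_perp]
    rintro _ rfl
    exact CFPlus.hyp _
  | bot =>
    refine ⟨fun Γ _ => (CFPlus.leftBot Γ).swap, ?_⟩
    rw [OLTerm.eval, compl_bot]
    exact Set.mem_univ _
  | top => exact ⟨Set.mem_univ _, fun Γ _ => CFPlus.rightTop Γ⟩
  | neg S ih =>
    refine ⟨fun Γ hΓ => ((ih.2 Γ hΓ)).leftNot, ?_⟩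
    rw [OLTerm.eval]
    intro Γ hΓ
    exact (hΓ _ ih.1).swap.rightNot
  | meet S T ihS ihT =>
    refine ⟨⟨?_, ?_⟩, fun Γ hΓ => (ihS.2 Γ hΓ.1).rightAnd (ihT.2 Γ hΓ.2)⟩
    -- Membership is tested in the double orthogonal: whatever is orthogonal to the value of `S` is
    -- orthogonal to `S^L`, and the left rule lifts this to the meet. The other cases that rewrite
    -- with `closed` follow the same pattern.
    · rw [← (S.eval (val A)).closed]
      exact fun Γ hΓ => (hΓ _ ihS.1).swap.leftAnd₁
    · rw [← (T.eval (val A)).closed]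
      exact fun Γ hΓ => (hΓ _ ihT.1).swap.leftAnd₂
  | join S T ihS ihT =>
    rw [OLTerm.eval, sup_eq, compl_compl]
    refine ⟨fun Γ hΓ => (hΓ.1 _ ihS.1).swap.leftOr (hΓ.2 _ ihT.1).swap, ?_, ?_⟩
    · rw [← (S.eval (val A))ᶜ.closed]
      exact fun Γ hΓ => (hΓ _ ihS.2).swap.rightOr₁
    · rw [← (T.eval (val A))ᶜ.closed]
      exact fun Γ hΓ => (hΓ _ ihT.2).swap.rightOr₂
  | func f i j k x y z ihx ihy ihz =>
    refine ⟨subset_perp_perp _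
      ⟨x, y, z, rfl, fun a => ihx a, fun b => (ihy b).1, fun c => (ihz c).2⟩, ?_⟩
    -- The triple orthogonal collapses, so only the generators of the value have to be tested, and
    -- for these the rule for `f` applies directly.
    rw [OLTerm.eval, compl_set, OLPlus.op, instOLPlus, perp_perp_perp]
    rintro _ ⟨x', y', z', rfl, hx, hy, hz⟩
    exact CFPlus.funcRule f i j k (fun a => (ihx a).2 _ (hx a).1) (fun a => (hx a).2 _ (ihx a).1)
      (fun b => (ihy b).2 _ (hy b)) (fun c => hz c _ (ihz c).1)

/-- A member of the first value is orthogonal to `p.1^R`, and anything orthogonal to the second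
value is orthogonal to `p.2^L`; the axiom rule joins the two sequents. -/
theorem eval_le_eval {p : OLTerm × OLTerm} (hp : p ∈ A) :
    p.1.eval (val.{u} A) ≤ p.2.eval (val.{u} A) := by
  intro Γ hΓ
  rw [← (p.2.eval (val A)).closed]
  intro Δ hΔ
  exact (CFPlus.axiomCut (S := p.1) (T := p.2) hp ((mem_eval p.1).2 Γ hΓ)
    (hΔ _ (mem_eval p.2).1)).swap

end ClosedSet

/-- The closed sets can be placed in any universe, so one countermodel serves every universe level
of `Entails`. -/
theorem entails_iff_cfPlus (A : List (OLTerm × OLTerm)) (S T : OLTerm) :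
    Entails.{u} A S T ↔ CFPlus A (AnnTerm.L S) (AnnTerm.R T) := by
  constructor
  · intro h
    have := h (ClosedSet.{u} A) (ClosedSet.val A) (fun p hp => ClosedSet.eval_le_eval hp)
    exact (ClosedSet.mem_eval T).2 _ (this (ClosedSet.mem_eval S).1)
  · intro h α _ v hA
    simpa only [AnnTerm.eval, Ortholattice.compl_compl'] using h.sound v hA

/-! ## Total correctness with step count for RAM programs -/

/-- The program `p` halts from `σ`, and `Q` holds of the number of steps and the final state. -/
def RamProg.Runs (w : ℕ) (p : RamProg) (σ : RamState) (Q : ℕ → RamState → Prop) : Prop :=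
  ∃ t τ, RamExec w p σ t τ ∧ Q t τ

namespace RamProg

variable {w : ℕ} {p q : RamProg} {σ : RamState} {Q Q' : ℕ → RamState → Prop}

theorem Runs.mono (h : p.Runs w σ Q) (hQ : ∀ t τ, Q t τ → Q' t τ) : p.Runs w σ Q' := by
  obtain ⟨t, τ, he, hq⟩ := h
  exact ⟨t, τ, he, hQ _ _ hq⟩

/-- This rule and those for instructions, sequences and tests are equivalences, so that
simplification can execute loop-free code symbolically. -/
theorem runs_skip : skip.Runs w σ Q ↔ Q 1 σ := by
  constructor
  · rintro ⟨t, τ, he, hq⟩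
    cases he
    exact hq
  · exact fun h => ⟨_, _, .skip σ, h⟩

theorem runs_instr {i : RamInstr} :
    (instr i).Runs w σ Q ↔ i.NoOverflow w σ ∧ Q 1 (i.apply σ) := by
  constructor
  · rintro ⟨t, τ, he, hq⟩
    cases he with
    | instr h => exact ⟨h, hq⟩
  · exact fun h => ⟨_, _, .instr h.1, h.2⟩

theorem runs_seq : (seq p q).Runs w σ Q ↔
    p.Runs w σ fun t τ => q.Runs w τ fun t' υ => Q (t + t') υ := by
  constructor
  · rintro ⟨t, υ, he, hq⟩
    cases he with
    | seq h h' => exact ⟨_, _, h, _, _, h', hq⟩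
  · rintro ⟨t, τ, h, t', υ, h', hq⟩
    exact ⟨_, _, .seq h h', hq⟩

theorem runs_ite {b : RamTest} : (ite b p q).Runs w σ Q ↔
    (b.Holds σ → p.Runs w σ fun t τ => Q (t + 1) τ) ∧
      (¬ b.Holds σ → q.Runs w σ fun t τ => Q (t + 1) τ) := by
  constructor
  · rintro ⟨t, τ, he, hq⟩
    cases he with
    | iteTrue hb h => exact ⟨fun _ => ⟨_, _, h, hq⟩, fun h' => absurd hb h'⟩
    | iteFalse hb h => exact ⟨fun h' => absurd h' hb, fun _ => ⟨_, _, h, hq⟩⟩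
  · rintro ⟨h, h'⟩
    by_cases hb : b.Holds σ
    · obtain ⟨t, τ, he, hq⟩ := h hb
      exact ⟨_, _, .iteTrue hb he, hq⟩
    · obtain ⟨t, τ, he, hq⟩ := h' hb
      exact ⟨_, _, .iteFalse hb he, hq⟩

/-- Loop rule with an invariant that depends on the remaining number of steps. -/
theorem runs_loop {b : RamTest} (I : ℕ → RamState → Prop)
    (hI : ∀ B σ, I B σ → b.Holds σ →
      p.Runs w σ fun t τ => ∃ B', I B' τ ∧ B' + t + 1 ≤ B) {B : ℕ} (h : I B σ) :
    (loop b p).Runs w σ fun t τ => t ≤ B + 1 ∧ ¬ b.Holds τ ∧ ∃ B', I B' τ := by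
  induction B using Nat.strong_induction_on generalizing σ with
  | _ B ih =>
    by_cases hb : b.Holds σ
    · obtain ⟨t, τ, he, B', hB', hle⟩ := hI B σ h hb
      obtain ⟨t', υ, he', hle', h2⟩ := ih B' (by omega) hB'
      exact ⟨_, _, .loopTrue hb he he', by omega, h2⟩
    · exact ⟨_, _, .loopFalse hb, by omega, hb, B, h⟩

/-- Rule for loops that run a known number of times, with a uniform bound for one round. -/
theorem runs_loop_count {b : RamTest} (n T : ℕ) (I : ℕ → RamState → Prop)
    (hb : ∀ i σ, i ≤ n → I i σ → (b.Holds σ ↔ i < n))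
    (hI : ∀ i σ, i < n → I i σ → p.Runs w σ fun t τ => t ≤ T ∧ I (i + 1) τ) (h : I 0 σ) :
    (loop b p).Runs w σ fun t τ => t ≤ n * (T + 1) + 1 ∧ I n τ := by
  -- The budget is the number of remaining rounds times the cost of a round, where one step is added
  -- for the test.
  have key := runs_loop (w := w) (p := p) (b := b)
    (fun B σ => ∃ i ≤ n, I i σ ∧ B = (n - i) * (T + 1)) (by
      rintro B σ ⟨i, hi, hIi, rfl⟩ hbσ
      have hlt := (hb i σ hi hIi).1 hbσ
      refine (hI i σ hlt hIi).mono ?_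
      rintro t τ ⟨ht, hτ⟩
      refine ⟨_, ⟨i + 1, hlt, hτ, rfl⟩, ?_⟩
      obtain ⟨k, rfl⟩ := Nat.exists_eq_add_of_lt hlt
      have h1 : i + k + 1 - (i + 1) = k := by omega
      have h2 : i + k + 1 - i = k + 1 := by omega
      rw [h1, h2, Nat.succ_mul]
      omega) (B := n * (T + 1)) (σ := σ) ⟨0, Nat.zero_le _, h, rfl⟩
  refine key.mono ?_
  rintro t τ ⟨ht, hnb, B', i, hi, hIi, -⟩
  have : i = n := by
    by_contra hne
    exact hnb ((hb i τ hi hIi).2 (by omega))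
  exact ⟨ht, this ▸ hIi⟩

/-- Sequential composition of instructions, followed by a program. -/
def block : List RamInstr → RamProg → RamProg
  | [], p => p
  | i :: is, p => seq (instr i) (block is p)

theorem runs_block_nil : (block [] p).Runs w σ Q ↔ p.Runs w σ Q := Iff.rfl

theorem runs_block_cons {i : RamInstr} {is : List RamInstr} :
    (block (i :: is) p).Runs w σ Q ↔ i.NoOverflow w σ ∧
      (block is p).Runs w (i.apply σ) fun t τ => Q (1 + t) τ := by
  rw [block, runs_seq, runs_instr]

/-- Run `p` if all tests hold. -/
def guarded : List RamTest → RamProg → RamProg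
  | [], p => p
  | b :: bs, p => ite b (guarded bs p) skip

/-- How many tests are evaluated depends on the first that fails, so the postcondition is required
for all step counts up to a bound. -/
theorem runs_guarded {bs : List RamTest} (h : (∀ b ∈ bs, b.Holds σ) →
      p.Runs w σ fun t τ => ∀ s ≤ bs.length + t, Q s τ)
    (h' : (∃ b ∈ bs, ¬ b.Holds σ) → ∀ s ≤ bs.length + 1, Q s σ) : (guarded bs p).Runs w σ Q := by
  induction bs generalizing Q with
  | nil =>
    refine (h (by simp)).mono fun t τ ht => ht _ (by simp)
  | cons b bs ih =>
    rw [guarded, runs_ite]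
    constructor
    · intro hb
      apply ih
      · intro hbs
        refine (h (by simpa [hb] using hbs)).mono fun t τ ht s hs => ht _ ?_
        simp only [List.length_cons]
        omega
      · rintro ⟨c, hc, hcn⟩ s hs
        refine h' ⟨c, List.mem_cons_of_mem _ hc, hcn⟩ _ ?_
        simp only [List.length_cons]
        omega
    · intro hb
      rw [runs_skip]
      exact h' ⟨b, List.mem_cons_self, hb⟩ _ (by simp)

end RamProg

/-! ## The closure computed by the algorithm

The algorithm works on tables with `N` nodes; the annotated nodes are the numbers below `2 * N`,
where `2 * p` and `2 * p + 1` stand for node `p` with annotation `L` and `R`.  In a table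
`m : ℕ → ℕ → ℕ`, the banks `1, …, 5` hold the label of a node (tag, letter, `i`, `j`, `k`), bank `6`
the number of its children, `7` the end of its subterm, `8` its parent, `9` its position among
the children of the parent (counted from `1`; `0` for a root), `10` and `11` the conclusion and the
second premise of the logical rule for an annotated node, `12` the node of an annotated node, and
`13` the partner (plus `1`) of an annotated node in an axiom. -/

/-- The child number `c` of the node `p`. -/
def childAt (m : ℕ → ℕ → ℕ) (p c : ℕ) : ℕ := (m 7)^[c] (p + 1)

/-- The nodes `p` and `q` carry the same symbol. -/
def SameLabel (m : ℕ → ℕ → ℕ) (p q : ℕ) : Prop :=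
  m 1 p = m 1 q ∧ m 2 p = m 2 q ∧ m 3 p = m 3 q ∧ m 4 p = m 4 q ∧ m 5 p = m 5 q

/-- The premises of the rule for function symbols that concern the arguments number `c`. -/
def ArgPremises (m : ℕ → ℕ → ℕ) (X : ℕ → ℕ → Prop) (p q c : ℕ) : Prop :=
  (c < m 3 p + m 4 p → X (2 * childAt m p c) (2 * childAt m q c + 1)) ∧
    (c < m 3 p ∨ m 3 p + m 4 p ≤ c → X (2 * childAt m p c + 1) (2 * childAt m q c))

/-- All rules with premises in `X` have their conclusions in `Y`. -/
structure RuleClosed (N : ℕ) (m : ℕ → ℕ → ℕ) (X Y : ℕ → ℕ → Prop) : Prop where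
  bot : ∀ p < N, m 1 p = 1 → Y (2 * p) (2 * p)
  top : ∀ p < N, m 1 p = 2 → Y (2 * p + 1) (2 * p + 1)
  replace : ∀ g < 2 * N, X g g → ∀ e < 2 * N, Y g e
  context : ∀ g < 2 * N, ∀ d < 2 * N, m 11 (m 11 d) = d → m 10 (m 11 d) = m 10 d →
    X g d → X g (m 11 d) → Y g (m 10 d)
  cut : ∀ g < 2 * N, ∀ d < 2 * N, ∀ c < 2 * N, ∀ e < 2 * N, m 13 d = c + 1 → m 13 c = d + 1 →
    X g d → X c e → Y g e
  cong : ∀ p < N, ∀ q < N, SameLabel m p q → (∀ c < m 6 p, ArgPremises m X p q c) →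
    Y (2 * p) (2 * q + 1)

/-- A symmetric relation that is closed under all steps of the algorithm. -/
structure StepClosed (N : ℕ) (m : ℕ → ℕ → ℕ) (R : ℕ → ℕ → Prop) : Prop where
  symm : ∀ g d, R g d → R d g
  bot : ∀ p < N, m 1 p = 1 → R (2 * p) (2 * p)
  top : ∀ p < N, m 1 p = 2 → R (2 * p + 1) (2 * p + 1)
  replace : ∀ g < 2 * N, R g g → ∀ e < 2 * N, R g e
  context : ∀ g < 2 * N, ∀ d < 2 * N, R g d → R g (m 11 d) → R g (m 10 d)
  cut : ∀ g < 2 * N, ∀ d < 2 * N, ∀ c < 2 * N, ∀ e < 2 * N, m 13 d = c + 1 →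
    R g d → R c e → R g e
  cong : ∀ p < N, ∀ q < N, SameLabel m p q → (∀ c < m 6 p, ArgPremises m R p q c) →
    R (2 * p) (2 * q + 1)

/-- Tables that describe a forest with `N` nodes. -/
structure ForestTable (N : ℕ) (m : ℕ → ℕ → ℕ) : Prop where
  arity : ∀ p < N, m 6 p = m 3 p + m 4 p + m 5 p
  arity_le : ∀ p < N, m 6 p ≤ N
  child_lt : ∀ p < N, ∀ c < m 6 p, childAt m p c < N
  parent_child : ∀ p < N, ∀ c < m 6 p, m 8 (childAt m p c) = p ∧ m 9 (childAt m p c) = c + 1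
  child_parent : ∀ x < N, m 9 x ≠ 0 →
    m 8 x < N ∧ m 9 x ≤ m 6 (m 8 x) ∧ childAt m (m 8 x) (m 9 x - 1) = x
  node : ∀ g < 2 * N, m 12 g = g / 2
  up_lt : ∀ g < 2 * N, m 10 g < 2 * N
  sib_lt : ∀ g < 2 * N, m 11 g < 2 * N
  partner_lt : ∀ g < 2 * N, m 13 g ≤ 2 * N

/-- The symmetric relation given by a list of pairs. -/
def ListRel (Q : List (ℕ × ℕ)) (g d : ℕ) : Prop := (g, d) ∈ Q ∨ (d, g) ∈ Q

theorem ListRel.symm {Q : List (ℕ × ℕ)} {g d : ℕ} (h : ListRel Q g d) : ListRel Q d g := Or.symm h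

theorem ListRel.mono {Q Q' : List (ℕ × ℕ)} (hQ : Q <+: Q') {g d : ℕ} (h : ListRel Q g d) :
    ListRel Q' g d :=
  h.imp (fun h => hQ.subset h) (fun h => hQ.subset h)

theorem ArgPremises.mono {m : ℕ → ℕ → ℕ} {X Y : ℕ → ℕ → Prop} (h : ∀ g d, X g d → Y g d)
    {p q c : ℕ} (hp : ArgPremises m X p q c) : ArgPremises m Y p q c :=
  ⟨fun hc => h _ _ (hp.1 hc), fun hc => h _ _ (hp.2 hc)⟩

theorem RuleClosed.mono_right {N : ℕ} {m : ℕ → ℕ → ℕ} {X Y Y' : ℕ → ℕ → Prop}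
    (hc : RuleClosed N m X Y) (h : ∀ g d, Y g d → Y' g d) : RuleClosed N m X Y' where
  bot p hp ht := h _ _ (hc.bot p hp ht)
  top p hp ht := h _ _ (hc.top p hp ht)
  replace g hg hx e he := h _ _ (hc.replace g hg hx e he)
  context g hg d hd h1 h2 h3 h4 := h _ _ (hc.context g hg d hd h1 h2 h3 h4)
  cut g hg d hd c hc' e he h1 h2 h3 h4 := h _ _ (hc.cut g hg d hd c hc' e he h1 h2 h3 h4)
  cong p hp q hq h1 h2 := h _ _ (hc.cong p hp q hq h1 h2)

/-- The conclusions that are drawn when the fact `(g, d)` is processed: those of the rules whose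
remaining premises are in `X` are in `Y`. -/
structure Processed (N : ℕ) (m : ℕ → ℕ → ℕ) (X Y : ℕ → ℕ → Prop) (g d : ℕ) : Prop where
  replace : g = d → ∀ e < 2 * N, Y g e
  context : X g (m 11 d) → Y g (m 10 d)
  cut : ∀ c, m 13 d = c + 1 → ∀ e < 2 * N, X c e → Y g e
  cong : m 9 (g / 2) ≠ 0 → m 9 (g / 2) = m 9 (d / 2) →
    SameLabel m (m 8 (g / 2)) (m 8 (d / 2)) →
    (∀ c < m 6 (m 8 (g / 2)), ArgPremises m X (m 8 (g / 2)) (m 8 (d / 2)) c) →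
    Y (2 * m 8 (g / 2)) (2 * m 8 (d / 2) + 1)

theorem Processed.mono {N : ℕ} {m : ℕ → ℕ → ℕ} {X X' Y Y' : ℕ → ℕ → Prop} {g d : ℕ}
    (h : Processed N m X Y g d) (hX : ∀ g d, X' g d → X g d) (hY : ∀ g d, Y g d → Y' g d) :
    Processed N m X' Y' g d where
  replace h1 e he := hY _ _ (h.replace h1 e he)
  context h1 := hY _ _ (h.context (hX _ _ h1))
  cut c hc e he h1 := hY _ _ (h.cut c hc e he (hX _ _ h1))
  cong h1 h2 h3 h4 := hY _ _ (h.cong h1 h2 h3 fun c hc => (h4 c hc).mono hX)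

theorem SameLabel.arity_eq {N : ℕ} {m : ℕ → ℕ → ℕ} (hm : ForestTable N m) {p q : ℕ} (hp : p < N)
    (hq : q < N) (h : SameLabel m p q) : m 6 p = m 6 q := by
  obtain ⟨-, -, h3, h4, h5⟩ := h
  rw [hm.arity p hp, hm.arity q hq, h3, h4, h5]

/-- Processing one more fact extends the set of facts whose consequences have been drawn. -/
theorem RuleClosed.insert {N : ℕ} {m : ℕ → ℕ → ℕ} (hm : ForestTable N m)
    {P Q Q' : List (ℕ × ℕ)} {g d : ℕ} (hPQ : ∀ x ∈ P ++ [(g, d)], x ∈ Q) (hQ : Q <+: Q')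
    (hc : RuleClosed N m (ListRel P) (ListRel Q))
    (h1 : Processed N m (ListRel Q) (ListRel Q') g d)
    (h2 : Processed N m (ListRel Q) (ListRel Q') d g) :
    RuleClosed N m (ListRel (P ++ [(g, d)])) (ListRel Q') := by
  have hPQ' : ∀ a b, ListRel (P ++ [(g, d)]) a b → ListRel Q a b :=
    fun a b h => h.imp (hPQ _) (hPQ _)
  -- A fact is either old or an orientation of the new one; since both orientations were processed,
  -- so was it and its reverse.
  have key : ∀ a b, ListRel (P ++ [(g, d)]) a b → ListRel P a b ∨
      Processed N m (ListRel Q) (ListRel Q') a b ∧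
        Processed N m (ListRel Q) (ListRel Q') b a := by
    rintro a b (h | h)
    · rcases List.mem_append.1 h with h | h
      · exact Or.inl (Or.inl h)
      · obtain ⟨rfl, rfl⟩ := Prod.mk.inj (List.mem_singleton.1 h)
        exact Or.inr ⟨h1, h2⟩
    · rcases List.mem_append.1 h with h | h
      · exact Or.inl (Or.inr h)
      · obtain ⟨rfl, rfl⟩ := Prod.mk.inj (List.mem_singleton.1 h)
        exact Or.inr ⟨h2, h1⟩
  have up : ∀ a b, ListRel Q a b → ListRel Q' a b := fun a b h => h.mono hQ
  have hc' := hc.mono_right up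
  refine ⟨hc'.bot, hc'.top, ?_, ?_, ?_, ?_⟩
  · intro a ha h e he
    rcases key _ _ h with h | ⟨h, -⟩
    · exact hc'.replace a ha h e he
    · exact h.replace rfl e he
  · intro a ha b hb h3 h4 h5 h6
    rcases key _ _ h5 with h5' | ⟨h5', -⟩
    · rcases key _ _ h6 with h6' | ⟨h6', -⟩
      · exact hc'.context a ha b hb h3 h4 h5' h6'
      -- Here only the second premise is new. The sibling relation is an involution that preserves
      -- the conclusion, so the rule is triggered from this premise too.
      · rw [← h4]
        exact h6'.context (by rw [h3]; exact hPQ' _ _ h5)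
    · exact h5'.context (hPQ' _ _ h6)
  · intro a ha b hb c hc1 e he h3 h4 h5 h6
    rcases key _ _ h5 with h5' | ⟨h5', -⟩
    · rcases key _ _ h6 with h6' | ⟨-, h6'⟩
      · exact hc'.cut a ha b hb c hc1 e he h3 h4 h5' h6'
      · exact (h6'.cut b h4 a ha (hPQ' _ _ h5.symm)).symm
    · exact h5'.cut c h3 e he (hPQ' _ _ h6)
  · intro p hp q hq hl h
    -- If not all premises are old, some argument uses the new fact. Its nodes are then children of
    -- `p` and `q` at the same position, so processing it has tried exactly this pair of parents.
    by_cases hall : ∀ c < m 6 p, ArgPremises m (ListRel P) p q c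
    · exact hc'.cong p hp q hq hl hall
    · push Not at hall
      obtain ⟨c, hcp, hn⟩ := hall
      have hcq : c < m 6 q := by rwa [← hl.arity_eq hm hp hq]
      have e1 := hm.parent_child p hp c hcp
      have e2 := hm.parent_child q hq c hcq
      have fin : ∀ a b, a / 2 = childAt m p c → b / 2 = childAt m q c →
          ListRel (P ++ [(g, d)]) a b → ¬ ListRel P a b → ListRel Q' (2 * p) (2 * q + 1) := by
        intro a b ha hb hab hab'
        rcases key _ _ hab with h' | ⟨h', -⟩
        · exact absurd h' hab'
        · have := h'.cong
          rw [ha, hb, e1.1, e2.1, e1.2, e2.2] at this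
          exact this (by omega) rfl hl fun c hc => (h c hc).mono hPQ'
      have hc2 := h c hcp
      by_contra hcon
      apply hn
      constructor
      · intro hlt
        by_contra hx
        exact hcon (fin _ _ (by omega) (by omega) (hc2.1 hlt) hx)
      · intro hlt
        by_contra hx
        exact hcon (fin _ _ (by omega) (by omega) (hc2.2 hlt) hx)

/-! ## The worklist -/

open Classical in
/-- The state `σ` holds the tables `m` and the list `Q` of the facts found so far, which satisfy
`R`: the matrix of these facts in bank `14` and the list itself in the banks `15` and `16`. -/
structure Worklist (N : ℕ) (m : ℕ → ℕ → ℕ) (R : ℕ → ℕ → Prop) (σ : RamState)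
    (Q : List (ℕ × ℕ)) : Prop where
  reg_one : σ.reg 1 = 1
  reg_zero : σ.reg 2 = 0
  reg_size : σ.reg 3 = 2 * N
  reg_length : σ.reg 4 = Q.length
  table : ∀ b < 14, σ.mem b = m b
  mark : ∀ g < 2 * N, ∀ d < 2 * N, σ.mem 14 (g * (2 * N) + d) = if ListRel Q g d then 1 else 0
  left : ∀ i (h : i < Q.length), σ.mem 15 i = (Q[i]).1
  right : ∀ i (h : i < Q.length), σ.mem 16 i = (Q[i]).2
  lt : ∀ x ∈ Q, x.1 < 2 * N ∧ x.2 < 2 * N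
  nodup : Q.Nodup
  sound : ∀ x ∈ Q, R x.1 x.2

/-- The state `τ` arises from `σ` by extending the list to one with property `P`, without changing
the registers below `B` apart from the one that holds the length. -/
def Extends (N : ℕ) (m : ℕ → ℕ → ℕ) (R : ℕ → ℕ → Prop) (B : ℕ) (σ : RamState) (Q : List (ℕ × ℕ))
    (P : List (ℕ × ℕ) → Prop) (τ : RamState) : Prop :=
  ∃ Q', Worklist N m R τ Q' ∧ Q <+: Q' ∧ (∀ r < B, r ≠ 4 → τ.reg r = σ.reg r) ∧ P Q'

/-- Since facts are not repeated, the positions in the worklist fit into a word. -/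
theorem Worklist.length_le {N : ℕ} {m : ℕ → ℕ → ℕ} {R : ℕ → ℕ → Prop} {σ : RamState}
    {Q : List (ℕ × ℕ)} (h : Worklist N m R σ Q) : Q.length ≤ 2 * N * (2 * N) := by
  have h1 : Q.toFinset ⊆ Finset.range (2 * N) ×ˢ Finset.range (2 * N) := by
    intro x hx
    have := h.lt x (List.mem_toFinset.1 hx)
    simpa using this
  have h2 := Finset.card_le_card h1
  rwa [List.toFinset_card_of_nodup h.nodup, Finset.card_product, Finset.card_range] at h2

theorem pair_lt {M g d : ℕ} (hg : g < M) (hd : d < M) : g * M + d < M * M := by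
  calc g * M + d < g * M + M := by omega
    _ = (g + 1) * M := by ring
    _ ≤ M * M := Nat.mul_le_mul_right _ hg

theorem pair_inj {M g d g' d' : ℕ} (hd : d < M) (hd' : d' < M) :
    g * M + d = g' * M + d' ↔ g = g' ∧ d = d' := by
  constructor
  · intro h
    have hM : 0 < M := by omega
    have h1 : (g * M + d) / M = g := by
      rw [add_comm, Nat.add_mul_div_right _ _ hM, Nat.div_eq_of_lt hd, zero_add]
    have h2 : (g' * M + d') / M = g' := by
      rw [add_comm, Nat.add_mul_div_right _ _ hM, Nat.div_eq_of_lt hd', zero_add]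
    have h3 : g = g' := by rw [← h1, ← h2, h]
    subst h3
    exact ⟨rfl, by omega⟩
  · rintro ⟨rfl, rfl⟩
    rfl

namespace RamProg

open RamInstr RamTest

/-- Record the fact given by the registers `60` and `61` unless it is known. -/
def push : RamProg :=
  block [mul 62 60 3, add 62 62 61, load 63 14 62]
    (ite (eq 63 2)
      (block [store 14 62 1, mul 62 61 3, add 62 62 60, store 14 62 1, store 15 4 60,
        store 16 4 61, add 4 4 1] skip)
      skip)

variable {w N : ℕ} {m : ℕ → ℕ → ℕ} {R : ℕ → ℕ → Prop} {σ : RamState} {Q : List (ℕ × ℕ)}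

/-- The list receives one orientation only, while both cells of the matrix are marked; later lookups
may use either order. -/
theorem runs_push {g d : ℕ} (hw : 64 * (2 * N * (2 * N)) ≤ 2 ^ w) (hσ : Worklist N m R σ Q)
    (hg : g < 2 * N) (hd : d < 2 * N) (hg0 : σ.reg 60 = g) (hd0 : σ.reg 61 = d) (hR : R g d) :
    push.Runs w σ fun t τ => t ≤ 12 ∧
      Extends N m R 60 σ Q (fun Q' => ListRel Q' g d) τ := by
  have hlen := hσ.length_le
  have hgd := pair_lt hg hd
  have hdg := pair_lt hd hg
  have hN : 0 < 2 * N * (2 * N) := Nat.mul_pos (by omega) (by omega)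
  have hmark := hσ.mark g hg d hd
  simp only [push, runs_block_cons, runs_block_nil, runs_ite, runs_skip, apply, NoOverflow, Holds,
    Function.update_apply, hg0, hd0, hσ.reg_one, hσ.reg_zero, hσ.reg_size, hσ.reg_length,
    Nat.reduceEqDiff, reduceIte, OfNat.one_ne_ofNat, hmark, true_and]
  by_cases hl : ListRel Q g d
  · rw [if_pos hl]
    refine ⟨by omega, by omega, fun h => absurd h one_ne_zero, fun _ => ⟨by norm_num, Q, ?_,
      List.prefix_refl _, ?_, hl⟩⟩
    · exact ⟨by simp [hσ.reg_one], by simp [hσ.reg_zero], by simp [hσ.reg_size],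
        by simp [hσ.reg_length], hσ.table, hσ.mark, hσ.left, hσ.right, hσ.lt, hσ.nodup, hσ.sound⟩
    · intro r hr _
      simp only [Function.update_apply]
      rw [if_neg (by omega), if_neg (by omega), if_neg (by omega)]
  rw [if_neg hl]
  refine ⟨by omega, by omega, fun _ => ⟨by omega, by omega, by omega, by norm_num,
    Q ++ [(g, d)], ?_, List.prefix_append _ _, ?_, Or.inl (by simp)⟩, fun h => absurd rfl h⟩
  · refine ⟨by simp [hσ.reg_one], by simp [hσ.reg_zero], by simp [hσ.reg_size], by simp, ?_, ?_,
      ?_, ?_, ?_, ?_, ?_⟩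
    · intro b hb
      simp only [Function.update_apply]
      rw [if_neg (by omega), if_neg (by omega), if_neg (by omega), if_neg (by omega)]
      exact hσ.table b hb
    · intro g' hg' d' hd'
      have e : ListRel (Q ++ [(g, d)]) g' d' ↔
          ListRel Q g' d' ∨ (g' = g ∧ d' = d) ∨ (g' = d ∧ d' = g) := by
        simp only [ListRel, List.mem_append, List.mem_singleton, Prod.mk.injEq]
        tauto
      simp only [Function.update_apply, Nat.reduceEqDiff, reduceIte, pair_inj hd' hg,
        pair_inj hd' hd, hσ.mark g' hg' d' hd', e]
      split_ifs <;> tauto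
    · intro i hi
      simp only [Function.update_apply, Nat.reduceEqDiff, reduceIte]
      rw [List.length_append, List.length_singleton] at hi
      split_ifs with h
      · subst h
        simp
      · rw [hσ.left i (by omega), List.getElem_append_left]
    · intro i hi
      simp only [Function.update_apply, Nat.reduceEqDiff, reduceIte]
      rw [List.length_append, List.length_singleton] at hi
      split_ifs with h
      · subst h
        simp
      · rw [hσ.right i (by omega), List.getElem_append_left]
    · intro x hx
      rcases List.mem_append.1 hx with hx | hx
      · exact hσ.lt x hx
      · rw [List.mem_singleton.1 hx]
        exact ⟨hg, hd⟩
    · refine List.nodup_append.2 ⟨hσ.nodup, List.nodup_singleton _, ?_⟩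
      rintro x hx y hy rfl
      rw [List.mem_singleton.1 hy] at hx
      exact hl (Or.inl hx)
    · intro x hx
      rcases List.mem_append.1 hx with hx | hx
      · exact hσ.sound x hx
      · rw [List.mem_singleton.1 hx]
        exact hR
  · intro r hr hr4
    simp only [Function.update_apply]
    rw [if_neg hr4]
    repeat rw [if_neg (by omega)]

end RamProg

theorem Worklist.of_eq {N : ℕ} {m : ℕ → ℕ → ℕ} {R : ℕ → ℕ → Prop} {σ τ : RamState}
    {Q : List (ℕ × ℕ)} (h : Worklist N m R σ Q) (hmem : τ.mem = σ.mem)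
    (hreg : ∀ r < 5, r ≠ 0 → τ.reg r = σ.reg r) : Worklist N m R τ Q where
  reg_one := (hreg 1 (by norm_num) (by norm_num)).trans h.reg_one
  reg_zero := (hreg 2 (by norm_num) (by norm_num)).trans h.reg_zero
  reg_size := (hreg 3 (by norm_num) (by norm_num)).trans h.reg_size
  reg_length := (hreg 4 (by norm_num) (by norm_num)).trans h.reg_length
  table b hb := by rw [hmem, h.table b hb]
  mark g hg d hd := by rw [hmem, h.mark g hg d hd]
  left i hi := by rw [hmem, h.left i hi]
  right i hi := by rw [hmem, h.right i hi]
  lt := h.lt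
  nodup := h.nodup
  sound := h.sound

theorem childAt_succ (m : ℕ → ℕ → ℕ) (p c : ℕ) :
    childAt m p (c + 1) = m 7 (childAt m p c) :=
  Function.iterate_succ_apply' _ _ _

/-! ### Trying the rule for function symbols on two nodes -/

namespace RamProg

open RamInstr RamTest

/-- Multiply register `34` by the entry of the matrix in the row `38` and the column `39`. -/
def multiplyMark : RamProg :=
  block [mul 40 38 3, add 40 40 39, load 40 14 40, mul 34 34 40] skip

/-- Check the premise with the annotations `L`, `R` for the current arguments. -/
def checkLeft : RamProg := block [add 38 35 35, add 39 36 36, add 39 39 1] multiplyMark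

/-- Check the premise with the annotations `R`, `L` for the current arguments. -/
def checkRight : RamProg := block [add 38 35 35, add 39 36 36, add 38 38 1] multiplyMark

/-- Check the premises for the current arguments and go on to the next ones. -/
def checkArg : RamProg :=
  seq (ite (lt 37 33) checkLeft skip)
    (seq (ite (lt 37 26) checkRight (ite (lt 37 33) skip checkRight))
      (block [load 35 7 35, load 36 7 36, add 37 37 1] skip))

/-- Load the labels of the nodes in the registers `20` and `21`. -/
def loadLabels : RamProg :=
  block [load 22 1 20, load 23 1 21, load 24 2 20, load 25 2 21, load 26 3 20, load 27 3 21,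
    load 28 4 20, load 29 4 21, load 30 5 20, load 31 5 21] skip

/-- Initialize the check of the premises for the nodes in the registers `20` and `21`. -/
def initCheck : RamProg :=
  block [load 32 6 20, add 33 26 28, copy 34 1, add 35 20 1, add 36 21 1, copy 37 2] skip

/-- Apply the rule for function symbols to the nodes in the registers `20` and `21`. -/
def congruence : RamProg :=
  seq loadLabels
    (guarded [eq 22 23, eq 24 25, eq 26 27, eq 28 29, eq 30 31]
      (seq initCheck
        (seq (loop (lt 37 32) checkArg)
          (guarded [eq 34 1]
            (block [add 60 20 20, add 61 21 21, add 61 61 1] push)))))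

variable {w N : ℕ} {m : ℕ → ℕ → ℕ} {R : ℕ → ℕ → Prop} {σ τ : RamState} {Q : List (ℕ × ℕ)}
  {p q c : ℕ}

open Classical in
/-- The state in the loop of `congruence` at the argument `c` of the nodes `p` and `q`, when the
premises checked so far amount to `P`. -/
structure CheckState (m : ℕ → ℕ → ℕ) (σ : RamState) (p q c : ℕ) (P : Prop)
    (τ : RamState) : Prop where
  mem : τ.mem = σ.mem
  ok : τ.reg 34 = if P then 1 else 0
  left : τ.reg 35 = childAt m p c
  right : τ.reg 36 = childAt m q c
  count : τ.reg 37 = c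
  frame : ∀ r, r < 34 ∨ 41 ≤ r → τ.reg r = σ.reg r

theorem CheckState.congr {P P' : Prop} (h : CheckState m σ p q c P τ) (hP : P ↔ P') :
    CheckState m σ p q c P' τ := propext hP ▸ h

/-- The flag and the marks are `0` or `1`, so a product is a conjunction. -/
theorem runs_multiplyMark {P : Prop} {g d : ℕ} (hw : 64 * (2 * N * (2 * N)) ≤ 2 ^ w)
    (hσ : Worklist N m R σ Q) (hg : g < 2 * N) (hd : d < 2 * N)
    (h38 : τ.reg 38 = g) (h39 : τ.reg 39 = d) (h : CheckState m σ p q c P τ) :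
    multiplyMark.Runs w τ fun t υ => t ≤ 5 ∧ CheckState m σ p q c (P ∧ ListRel Q g d) υ := by
  classical
  have l := pair_lt hg hd
  have h3 : τ.reg 3 = 2 * N := (h.frame 3 (by norm_num)).trans hσ.reg_size
  have e := hσ.mark g hg d hd
  simp only [multiplyMark, runs_block_cons, runs_block_nil, runs_skip, apply, NoOverflow,
    Function.update_apply, h38, h39, Nat.reduceEqDiff, reduceIte, h3, h.mem, h.ok, e, true_and]
  refine ⟨by omega, by omega, ?_, by norm_num, ⟨rfl, ?_, ?_, ?_, ?_, ?_⟩⟩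
  · split_ifs <;> omega
  · simp only [Function.update_apply, Nat.reduceEqDiff, reduceIte]
    split_ifs <;> tauto
  · simpa using h.left
  · simpa using h.right
  · simpa using h.count
  · intro r hr
    simp only [Function.update_apply]
    repeat rw [if_neg (by omega)]
    exact h.frame r hr

theorem runs_checkLeft {P : Prop} (hw : 64 * (2 * N * (2 * N)) ≤ 2 ^ w) (hm : ForestTable N m)
    (hσ : Worklist N m R σ Q) (hp : p < N) (hq : q < N) (hcp : c < m 6 p) (hcq : c < m 6 q)
    (h : CheckState m σ p q c P τ) :
    checkLeft.Runs w τ fun t υ => t ≤ 8 ∧ CheckState m σ p q c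
      (P ∧ ListRel Q (2 * childAt m p c) (2 * childAt m q c + 1)) υ := by
  have ha := hm.child_lt p hp c hcp
  have hb := hm.child_lt q hq c hcq
  have hN : 2 * N ≤ 2 * N * (2 * N) := Nat.le_mul_of_pos_right _ (by omega)
  simp only [checkLeft, runs_block_cons, runs_block_nil, apply, NoOverflow,
    Function.update_apply, Nat.reduceEqDiff, reduceIte, OfNat.one_ne_ofNat, h.left, h.right,
    h.frame 1 (by norm_num), hσ.reg_one]
  refine ⟨by omega, by omega, by omega, (runs_multiplyMark hw hσ (p := p) (q := q) (c := c) (P := P) (g := 2 * childAt m p c)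
    (d := 2 * childAt m q c + 1) (by omega) (by omega) ?_ ?_ ⟨?_, ?_, ?_, ?_, ?_, ?_⟩).mono ?_⟩
  · simp; omega
  · simp; omega
  · exact h.mem
  · simpa using h.ok
  · simpa using h.left
  · simpa using h.right
  · simpa using h.count
  · intro r hr
    simp only [Function.update_apply]
    repeat rw [if_neg (by omega)]
    exact h.frame r hr
  · rintro t υ ⟨ht, hυ⟩
    exact ⟨by omega, hυ⟩

theorem runs_checkRight {P : Prop} (hw : 64 * (2 * N * (2 * N)) ≤ 2 ^ w) (hm : ForestTable N m)
    (hσ : Worklist N m R σ Q) (hp : p < N) (hq : q < N) (hcp : c < m 6 p) (hcq : c < m 6 q)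
    (h : CheckState m σ p q c P τ) :
    checkRight.Runs w τ fun t υ => t ≤ 8 ∧ CheckState m σ p q c
      (P ∧ ListRel Q (2 * childAt m p c + 1) (2 * childAt m q c)) υ := by
  have ha := hm.child_lt p hp c hcp
  have hb := hm.child_lt q hq c hcq
  have hN : 2 * N ≤ 2 * N * (2 * N) := Nat.le_mul_of_pos_right _ (by omega)
  simp only [checkRight, runs_block_cons, runs_block_nil, apply, NoOverflow,
    Function.update_apply, Nat.reduceEqDiff, reduceIte, OfNat.one_ne_ofNat, h.left, h.right,
    h.frame 1 (by norm_num), hσ.reg_one]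
  refine ⟨by omega, by omega, by omega, (runs_multiplyMark hw hσ (p := p) (q := q) (c := c) (P := P) (g := 2 * childAt m p c + 1)
    (d := 2 * childAt m q c) (by omega) (by omega) ?_ ?_ ⟨?_, ?_, ?_, ?_, ?_, ?_⟩).mono ?_⟩
  · simp; omega
  · simp; omega
  · exact h.mem
  · simpa using h.ok
  · simpa using h.left
  · simpa using h.right
  · simpa using h.count
  · intro r hr
    simp only [Function.update_apply]
    repeat rw [if_neg (by omega)]
    exact h.frame r hr
  · rintro t υ ⟨ht, hυ⟩
    exact ⟨by omega, hυ⟩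

/-- An invariant argument needs both premises, a covariant one the first, a contravariant one the
second. The end of a child is its next sibling, so no search is needed to move on. -/
theorem runs_checkArg (hw : 64 * (2 * N * (2 * N)) ≤ 2 ^ w) (hm : ForestTable N m)
    (hσ : Worklist N m R σ Q) (hp : p < N) (hq : q < N) (hcp : c < m 6 p) (hcq : c < m 6 q)
    (h26 : σ.reg 26 = m 3 p) (h33 : σ.reg 33 = m 3 p + m 4 p)
    (h : CheckState m σ p q c (∀ c' < c, ArgPremises m (ListRel Q) p q c') τ) :
    checkArg.Runs w τ fun t υ => t ≤ 23 ∧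
      CheckState m σ p q (c + 1) (∀ c' < c + 1, ArgPremises m (ListRel Q) p q c') υ := by
  have hN : 2 * N ≤ 2 * N * (2 * N) := Nat.le_mul_of_pos_right _ (by omega)
  have ha := hm.arity_le p hp
  rw [checkArg, runs_seq]
  have first : (ite (lt 37 33) checkLeft skip).Runs w τ fun t υ => t ≤ 9 ∧
      CheckState m σ p q c ((∀ c' < c, ArgPremises m (ListRel Q) p q c') ∧ (c < m 3 p + m 4 p →
        ListRel Q (2 * childAt m p c) (2 * childAt m q c + 1))) υ := by
    rw [runs_ite, runs_skip]
    simp only [Holds, h.count, h.frame 33 (by norm_num), h33]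
    refine ⟨fun hc => (runs_checkLeft hw hm hσ hp hq hcp hcq h).mono ?_,
      fun hc => ⟨by norm_num, h.congr (by tauto)⟩⟩
    rintro t υ ⟨ht, hυ⟩
    exact ⟨by omega, hυ.congr (by simp [hc])⟩
  refine first.mono ?_
  rintro t₁ τ₁ ⟨ht₁, h₁⟩
  rw [runs_seq]
  have second : (ite (lt 37 26) checkRight (ite (lt 37 33) skip checkRight)).Runs w τ₁
      fun t υ => t ≤ 10 ∧
        CheckState m σ p q c (∀ c' < c + 1, ArgPremises m (ListRel Q) p q c') υ := by
    simp only [runs_ite, runs_skip, Holds, h₁.count, h₁.frame 33 (by norm_num),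
      h₁.frame 26 (by norm_num), h33, h26]
    have key := runs_checkRight hw hm hσ hp hq hcp hcq h₁
    refine ⟨fun hc => key.mono ?_, fun hc => ⟨fun hc' => ⟨by norm_num, h₁.congr ?_⟩,
      fun hc' => key.mono ?_⟩⟩
    · rintro t υ ⟨ht, hυ⟩
      refine ⟨by omega, hυ.congr ?_⟩
      rw [Nat.forall_lt_succ_right, ArgPremises]
      simp [hc, and_assoc]
    · rw [Nat.forall_lt_succ_right, ArgPremises]
      have : ¬ (c < m 3 p ∨ m 3 p + m 4 p ≤ c) := by omega
      tauto
    · rintro t υ ⟨ht, hυ⟩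
      refine ⟨by omega, hυ.congr ?_⟩
      rw [Nat.forall_lt_succ_right, ArgPremises]
      have : m 3 p + m 4 p ≤ c := by omega
      simp [this]
  refine second.mono ?_
  rintro t₂ τ₂ ⟨ht₂, h₂⟩
  simp only [runs_block_cons, runs_block_nil, runs_skip, apply, NoOverflow,
    Function.update_apply, Nat.reduceEqDiff, reduceIte, OfNat.one_ne_ofNat, h₂.left, h₂.right,
    h₂.count, h₂.mem, h₂.frame 1 (by norm_num), hσ.reg_one, true_and]
  refine ⟨by omega, by omega, rfl, ?_, ?_, ?_, ?_, ?_⟩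
  · simpa using h₂.ok
  · simp [hσ.table 7 (by norm_num), childAt_succ]
  · simp [hσ.table 7 (by norm_num), childAt_succ]
  · simp
  · intro r hr
    simp only [Function.update_apply]
    repeat rw [if_neg (by omega)]
    exact h₂.frame r hr

end RamProg

namespace RamProg

open RamInstr RamTest

variable {w N : ℕ} {m : ℕ → ℕ → ℕ} {R : ℕ → ℕ → Prop} {σ τ : RamState} {Q : List (ℕ × ℕ)}
  {p q : ℕ}

theorem runs_loadLabels (h20 : σ.reg 20 = p) (h21 : σ.reg 21 = q) :
    loadLabels.Runs w σ fun t τ => t = 11 ∧ τ.mem = σ.mem ∧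
      (∀ r, r < 22 ∨ 32 ≤ r → τ.reg r = σ.reg r) ∧
      (τ.reg 22 = σ.mem 1 p ∧ τ.reg 23 = σ.mem 1 q) ∧
      (τ.reg 24 = σ.mem 2 p ∧ τ.reg 25 = σ.mem 2 q) ∧
      (τ.reg 26 = σ.mem 3 p ∧ τ.reg 27 = σ.mem 3 q) ∧
      (τ.reg 28 = σ.mem 4 p ∧ τ.reg 29 = σ.mem 4 q) ∧
      (τ.reg 30 = σ.mem 5 p ∧ τ.reg 31 = σ.mem 5 q) := by
  simp only [loadLabels, runs_block_cons, runs_block_nil, runs_skip, apply, NoOverflow,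
    Function.update_apply, h20, h21, Nat.reduceEqDiff, reduceIte, true_and, and_true]
  intro r hr
  repeat rw [if_neg (by omega)]

theorem runs_initCheck (hw : 64 * (2 * N * (2 * N)) ≤ 2 ^ w)
    (hσ : Worklist N m R σ Q) (hp : p < N) (hq : q < N)
    (h20 : σ.reg 20 = p) (h21 : σ.reg 21 = q) (h26 : σ.reg 26 = m 3 p) (h28 : σ.reg 28 = m 4 p)
    (hle : m 3 p + m 4 p ≤ N) :
    initCheck.Runs w σ fun t τ => t = 7 ∧ τ.mem = σ.mem ∧
      (∀ r, r < 32 ∨ 41 ≤ r → τ.reg r = σ.reg r) ∧ τ.reg 32 = m 6 p ∧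
      τ.reg 33 = m 3 p + m 4 p ∧
      CheckState m τ p q 0 (∀ c' < 0, ArgPremises m (ListRel Q) p q c') τ := by
  have hN : 2 * N ≤ 2 * N * (2 * N) := Nat.le_mul_of_pos_right _ (by omega)
  simp only [initCheck, runs_block_cons, runs_block_nil, runs_skip, apply, NoOverflow,
    Function.update_apply, h20, h21, h26, h28, Nat.reduceEqDiff, reduceIte, true_and,
    OfNat.one_ne_ofNat, hσ.reg_one, hσ.reg_zero, hσ.table 6 (by norm_num)]
  refine ⟨by omega, by omega, by omega, fun r hr => ?_,
    ⟨rfl, ?_, ?_, ?_, ?_, fun r hr => rfl⟩⟩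
  · repeat rw [if_neg (by omega)]
  all_goals simp [childAt]

theorem _root_.Worklist.rel (hR : StepClosed N m R) (h : Worklist N m R σ Q) (g d : ℕ)
    (hl : ListRel Q g d) : R g d :=
  hl.elim (fun hl => h.sound _ hl) (fun hl => hR.symm _ _ (h.sound _ hl))

open Classical in
/-- The number of steps of `congruence` that depends on the nodes. -/
noncomputable def congruenceCost (m : ℕ → ℕ → ℕ) (p q : ℕ) : ℕ :=
  if SameLabel m p q then 24 * m 6 p + 40 else 0

/-- The arity is charged only when the labels agree; the amortization over all pairs depends on
this. -/
theorem runs_congruence (hw : 64 * (2 * N * (2 * N)) ≤ 2 ^ w) (hm : ForestTable N m)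
    (hR : StepClosed N m R) (hσ : Worklist N m R σ Q) (hp : p < N) (hq : q < N)
    (h20 : σ.reg 20 = p) (h21 : σ.reg 21 = q) :
    congruence.Runs w σ fun t τ => t ≤ 17 + congruenceCost m p q ∧
      Extends N m R 20 σ Q (fun Q' => SameLabel m p q →
        (∀ c < m 6 p, ArgPremises m (ListRel Q) p q c) →
          ListRel Q' (2 * p) (2 * q + 1)) τ := by
  have hN : 2 * N ≤ 2 * N * (2 * N) := Nat.le_mul_of_pos_right _ (by omega)
  have har := hm.arity_le p hp
  have har' := hm.arity p hp
  rw [congruence, runs_seq]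
  refine (runs_loadLabels h20 h21).mono ?_
  rintro t₁ τ₁ ⟨rfl, hmem₁, hf₁, h1⟩
  simp only [hσ.table 1 (by norm_num), hσ.table 2 (by norm_num), hσ.table 3 (by norm_num),
    hσ.table 4 (by norm_num), hσ.table 5 (by norm_num)] at h1
  have hτ₁ : Worklist N m R τ₁ Q := hσ.of_eq hmem₁ fun r hr _ => hf₁ r (by omega)
  have hiff : (∀ b ∈ [eq 22 23, eq 24 25, eq 26 27, eq 28 29, eq 30 31], b.Holds τ₁) ↔
      SameLabel m p q := by
    simp [Holds, h1, SameLabel]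
  refine runs_guarded (fun h => ?_) (fun h => ?_)
  · have hl := hiff.1 h
    have hcost : congruenceCost m p q = 24 * m 6 p + 40 := if_pos hl
    have harq := hl.arity_eq hm hp hq
    rw [runs_seq]
    refine (runs_initCheck hw hτ₁ hp hq ((hf₁ 20 (by norm_num)).trans h20)
      ((hf₁ 21 (by norm_num)).trans h21) (h1.2.2.1.1) (h1.2.2.2.1.1) (by omega)).mono ?_
    rintro t₂ τ₂ ⟨rfl, hmem₂, hf₂, h32, h33, hch⟩
    have hτ₂ : Worklist N m R τ₂ Q := hτ₁.of_eq hmem₂ fun r hr _ => hf₂ r (by omega)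
    have h26 := (hf₂ 26 (by norm_num)).trans h1.2.2.1.1
    rw [runs_seq]
    refine (runs_loop_count (m 6 p) 23 (fun c τ => CheckState m τ₂ p q c
      (∀ c' < c, ArgPremises m (ListRel Q) p q c') τ) ?_ ?_ hch).mono ?_
    · intro c τ _ h
      simp only [Holds, h.count, h.frame 32 (by norm_num), h32]
    · intro c τ hc h
      exact runs_checkArg hw hm hτ₂ hp hq hc (harq ▸ hc) h26 h33 h
    rintro t₃ τ₃ ⟨ht₃, h₃⟩
    have hτ₃ : Worklist N m R τ₃ Q := hτ₂.of_eq h₃.mem fun r hr _ => h₃.frame r (by omega)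
    have hfr : ∀ r < 22, τ₃.reg r = σ.reg r := fun r hr =>
      (h₃.frame r (by omega)).trans ((hf₂ r (by omega)).trans (hf₁ r (by omega)))
    refine runs_guarded (fun hb => ?_) (fun hb => ?_)
    · have hall : ∀ c < m 6 p, ArgPremises m (ListRel Q) p q c := by
        have := hb _ List.mem_cons_self
        simp only [Holds, h₃.ok, hτ₃.reg_one] at this
        by_contra hcon
        rw [if_neg hcon] at this
        exact zero_ne_one this
      simp only [runs_block_cons, runs_block_nil, apply, NoOverflow, Function.update_apply,
        Nat.reduceEqDiff, reduceIte, OfNat.one_ne_ofNat, hτ₃.reg_one, hfr 20 (by norm_num),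
        hfr 21 (by norm_num), h20, h21]
      refine ⟨by omega, by omega, by omega, ?_⟩
      refine (runs_push (g := 2 * p) (d := 2 * q + 1) (Q := Q) (m := m) (R := R) hw ?_ (by omega)
        (by omega) ?_ ?_ (hR.cong p hp q hq hl fun c hc => (hall c hc).mono (hτ₃.rel hR))).mono ?_
      · refine hτ₃.of_eq rfl fun r hr _ => ?_
        simp only [Function.update_apply]
        repeat rw [if_neg (by omega)]
      · simp; omega
      · simp; omega
      · rintro t τ ⟨ht, Q', hQ', hQQ', hf, hr⟩ s hs s' hs'
        simp only [List.length_cons, List.length_nil] at hs hs'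
        refine ⟨by omega, Q', hQ', hQQ', fun r hr hr4 => ?_, fun _ _ => hr⟩
        · rw [hf r (by omega) hr4, ← hfr r (by omega)]
          simp only [Function.update_apply]
          repeat rw [if_neg (by omega)]
    · intro s hs s' hs'
      simp only [List.length_cons, List.length_nil] at hs hs'
      refine ⟨by omega, Q, hτ₃, List.prefix_refl _, fun r hr _ => hfr r (by omega),
        fun _ hall => ?_⟩
      obtain ⟨b, hb, hb'⟩ := hb
      rw [List.mem_singleton.1 hb] at hb'
      simp [Holds, h₃.ok, hτ₃.reg_one] at hb'
      obtain ⟨c, hc, hn⟩ := hb'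
      exact absurd (hall c hc) hn
  · have hn : ¬ SameLabel m p q := fun hl => by
      obtain ⟨b, hb, hb'⟩ := h
      exact hb' (hiff.2 hl b hb)
    intro s hs
    simp only [List.length_cons, List.length_nil] at hs
    exact ⟨by omega, Q, hτ₁, List.prefix_refl _, fun r hr _ => hf₁ r (by omega), fun hl => absurd hl hn⟩

end RamProg

theorem Extends.trans {N : ℕ} {m : ℕ → ℕ → ℕ} {R : ℕ → ℕ → Prop} {B B' : ℕ} {σ σ' τ : RamState}
    {Q Q₁ : List (ℕ × ℕ)} {P P' : List (ℕ × ℕ) → Prop} (hB : B ≤ B') (hQ : Q <+: Q₁)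
    (hf : ∀ r < B, r ≠ 4 → σ'.reg r = σ.reg r) (h : Extends N m R B' σ' Q₁ P τ)
    (hP : ∀ Q', Q₁ <+: Q' → P Q' → P' Q') : Extends N m R B σ Q P' τ := by
  obtain ⟨Q', hQ', hQQ', hf', hPQ⟩ := h
  exact ⟨Q', hQ', hQ.trans hQQ', fun r hr hr4 => (hf' r (by omega) hr4).trans (hf r hr hr4),
    hP Q' hQQ' hPQ⟩

theorem Worklist.extends_self {N : ℕ} {m : ℕ → ℕ → ℕ} {R : ℕ → ℕ → Prop} {B : ℕ} {σ τ : RamState}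
    {Q : List (ℕ × ℕ)} {P : List (ℕ × ℕ) → Prop} (hB : 5 ≤ B) (h : Worklist N m R σ Q)
    (hmem : τ.mem = σ.mem) (hreg : ∀ r < B, τ.reg r = σ.reg r) (hP : P Q) :
    Extends N m R B σ Q P τ :=
  ⟨Q, h.of_eq hmem fun r hr _ => hreg r (by omega), List.prefix_refl _, fun r hr _ => hreg r hr, hP⟩

/-! ### The uses of a new fact as a premise -/

namespace RamProg

open RamInstr RamTest

/-- If the registers `7` and `8` agree, record all facts for register `7`. -/
def replaceRule : RamProg :=
  ite (eq 7 8)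
    (block [copy 10 2]
      (loop (lt 10 3) (block [copy 60 7, copy 61 10] (seq push (block [add 10 10 1] skip)))))
    skip

/-- Apply the logical rule whose first premise is given by the registers `7` and `8`. -/
def contextRule : RamProg :=
  block [load 10 11 8, mul 11 7 3, add 11 11 10, load 12 14 11]
    (guarded [eq 12 1] (block [load 61 10 8, copy 60 7] push))

/-- Apply the axiom whose first premise is given by the registers `7` and `8`. -/
def cutRule : RamProg :=
  block [load 10 13 8]
    (ite (eq 10 2)
      skip
      (block [sub 10 10 1, mul 10 10 3, copy 11 2]
        (loop (lt 11 3)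
          (block [add 12 10 11, load 12 14 12]
            (seq (guarded [eq 12 1] (block [copy 60 7, copy 61 11] push))
              (block [add 11 11 1] skip))))))

/-- Apply the rule for function symbols to the parents of the nodes in the registers `7`, `8`. -/
def congruenceRule : RamProg :=
  block [load 10 12 7, load 11 12 8, load 12 9 10, load 13 9 11]
    (guarded [eq 12 13, lt 2 12] (block [load 20 8 10, load 21 8 11] congruence))

variable {w N : ℕ} {m : ℕ → ℕ → ℕ} {R : ℕ → ℕ → Prop} {σ τ : RamState} {Q : List (ℕ × ℕ)}
  {g d : ℕ}

theorem runs_replaceRule (hw : 64 * (2 * N * (2 * N)) ≤ 2 ^ w)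
    (hR : StepClosed N m R) (hσ : Worklist N m R σ Q) (hg : g < 2 * N)
    (h7 : σ.reg 7 = g) (h8 : σ.reg 8 = d) (hgd : ListRel Q g d) :
    replaceRule.Runs w σ fun t τ => t ≤ 3 + (if g = d then 2 * N * 17 else 0) ∧
      Extends N m R 10 σ Q (fun Q' => g = d → ∀ e < 2 * N, ListRel Q' g e) τ := by
  have hN : 2 * N ≤ 2 * N * (2 * N) := Nat.le_mul_of_pos_right _ (by omega)
  rw [replaceRule, runs_ite]
  simp only [Holds, h7, h8]
  refine ⟨fun h => ?_, fun h => ?_⟩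
  · subst h
    rw [if_pos rfl, runs_block_cons, runs_block_nil]
    refine ⟨trivial, (runs_loop_count (2 * N) 16 (fun e τ => τ.reg 10 = e ∧
      Extends N m R 10 σ Q (fun Q' => ∀ e' < e, ListRel Q' g e') τ) ?_ ?_ ?_).mono ?_⟩
    · rintro e τ - ⟨he, Q', hQ', -⟩
      simp only [Holds, he, hQ'.reg_size]
    · rintro e τ he ⟨h10, Q₁, hQ₁, hQQ₁, hf, hP⟩
      simp only [runs_block_cons, runs_block_nil, runs_seq, runs_skip, apply, NoOverflow, true_and,
        Function.update_apply, Nat.reduceEqDiff, reduceIte, h10, hf 7 (by norm_num) (by norm_num),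
        h7]
      refine (runs_push (Q := Q₁) (m := m) (R := R) (g := g) (d := e) hw ?_ hg he ?_ ?_
        (hR.replace g hg (hσ.rel hR g g hgd) e he)).mono ?_
      · refine hQ₁.of_eq rfl fun r hr _ => ?_
        simp only [Function.update_apply]
        repeat rw [if_neg (by omega)]
      · simp
      · simp
      rintro t υ ⟨ht, Q₂, hQ₂, hQQ₂, hf₂, hP₂⟩
      have e10 : υ.reg 10 = e := by
        rw [hf₂ 10 (by norm_num) (by norm_num)]
        simpa using h10
      simp only [e10, hQ₂.reg_one]
      refine ⟨by omega, by omega, trivial, Q₂, ?_, hQQ₁.trans hQQ₂, ?_, ?_⟩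
      · refine hQ₂.of_eq rfl fun r hr _ => ?_
        simp only [Function.update_apply]
        repeat rw [if_neg (by omega)]
      · intro r hr hr4
        simp only [Function.update_apply]
        rw [if_neg (by omega), hf₂ r (by omega) hr4]
        simp only [Function.update_apply]
        rw [if_neg (by omega), if_neg (by omega), hf r hr hr4]
      · intro e' he'
        rcases Nat.lt_succ_iff_lt_or_eq.1 he' with h | rfl
        · exact (hP e' h).mono hQQ₂
        · exact hP₂
    · refine ⟨by simp [apply, hσ.reg_zero], hσ.extends_self (by norm_num) rfl (fun r hr => ?_)
        (fun _ h => absurd h (by omega))⟩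
      simp only [apply, Function.update_apply]
      rw [if_neg (by omega)]
    · rintro t υ ⟨ht, -, hυ⟩
      exact ⟨by omega, hυ.trans le_rfl (List.prefix_refl _) (fun _ _ _ => rfl) fun _ _ h _ => h⟩
  · rw [if_neg h, runs_skip]
    exact ⟨by omega, hσ.extends_self (by norm_num) rfl (fun _ _ => rfl) fun h' => absurd h' h⟩

/-- Constant time suffices because an annotated node has a single entry for a conclusion and a
second premise; rules with one premise are entered with that premise repeated. -/
theorem runs_contextRule (hw : 64 * (2 * N * (2 * N)) ≤ 2 ^ w) (hm : ForestTable N m)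
    (hR : StepClosed N m R) (hσ : Worklist N m R σ Q) (hg : g < 2 * N) (hd : d < 2 * N)
    (h7 : σ.reg 7 = g) (h8 : σ.reg 8 = d) (hgd : ListRel Q g d) :
    contextRule.Runs w σ fun t τ => t ≤ 20 ∧
      Extends N m R 10 σ Q (fun Q' => ListRel Q g (m 11 d) → ListRel Q' g (m 10 d)) τ := by
  have hs := hm.sib_lt d hd
  have hp := pair_lt hg hs
  have hmark := hσ.mark g hg _ hs
  simp only [contextRule, runs_block_cons, runs_block_nil, apply, NoOverflow, true_and,
    Function.update_apply, Nat.reduceEqDiff, reduceIte, h7, h8, hσ.reg_size,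
    hσ.table 11 (by norm_num), hmark]
  refine ⟨by omega, by omega, runs_guarded (fun h => ?_) fun h => ?_⟩
  · have h1 : ListRel Q g (m 11 d) := by
      have := h _ List.mem_cons_self
      simpa [Holds, hσ.reg_one] using this
    simp only [runs_block_cons, runs_block_nil, apply, NoOverflow, true_and,
      Function.update_apply, Nat.reduceEqDiff, reduceIte, h7, h8, hσ.table 10 (by norm_num)]
    refine (runs_push (Q := Q) (m := m) (R := R) (g := g) (d := m 10 d) hw ?_ hg
      (hm.up_lt d hd) ?_ ?_ (hR.context g hg d hd (hσ.rel hR _ _ hgd) (hσ.rel hR _ _ h1))).mono ?_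
    · refine hσ.of_eq rfl fun r hr _ => ?_
      simp only [Function.update_apply]
      repeat rw [if_neg (by omega)]
    · simp
    · simp
    rintro t υ ⟨ht, hυ⟩ s hs
    simp only [List.length_cons, List.length_nil] at hs
    refine ⟨by omega, hυ.trans (by norm_num) (List.prefix_refl _) (fun r hr _ => ?_)
      fun _ _ h _ => h⟩
    simp only [Function.update_apply]
    repeat rw [if_neg (by omega)]
  · intro s hs
    simp only [List.length_cons, List.length_nil] at hs
    refine ⟨by omega, hσ.extends_self (by norm_num) rfl (fun r hr => ?_) fun h' => ?_⟩
    · simp only [Function.update_apply]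
      repeat rw [if_neg (by omega)]
    · simp [Holds, hσ.reg_one, h'] at h

open Classical in
theorem runs_cutPush {P : Prop} {e : ℕ} (hw : 64 * (2 * N * (2 * N)) ≤ 2 ^ w)
    (hσ : Worklist N m R σ Q) (hg : g < 2 * N) (he : e < 2 * N)
    (h7 : σ.reg 7 = g) (h11 : σ.reg 11 = e) (h12 : σ.reg 12 = if P then 1 else 0)
    (hR : P → R g e) :
    (guarded [eq 12 1] (block [copy 60 7, copy 61 11] push)).Runs w σ fun t τ => t ≤ 15 ∧
      Extends N m R 12 σ Q (fun Q' => P → ListRel Q' g e) τ := by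
  refine runs_guarded (fun h => ?_) fun h => ?_
  · have h1 : P := by
      have := h _ List.mem_cons_self
      simpa [Holds, hσ.reg_one, h12] using this
    simp only [runs_block_cons, runs_block_nil, apply, NoOverflow, true_and,
      Function.update_apply, Nat.reduceEqDiff, reduceIte, h7, h11]
    refine (runs_push (Q := Q) (m := m) (R := R) (g := g) (d := e) hw ?_ hg he ?_ ?_
      (hR h1)).mono ?_
    · refine hσ.of_eq rfl fun r hr _ => ?_
      simp only [Function.update_apply]
      repeat rw [if_neg (by omega)]
    · simp
    · simp
    rintro t υ ⟨ht, hυ⟩ s hs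
    simp only [List.length_cons, List.length_nil] at hs
    refine ⟨by omega, hυ.trans (by norm_num) (List.prefix_refl _) (fun r hr _ => ?_)
      fun _ _ h _ => h⟩
    simp only [Function.update_apply]
    repeat rw [if_neg (by omega)]
  · intro s hs
    simp only [List.length_cons, List.length_nil] at hs
    refine ⟨by omega, hσ.extends_self (by norm_num) rfl (fun r hr => ?_) fun h' => ?_⟩
    · rfl
    · simp [Holds, hσ.reg_one, h', h12] at h

/-- The row of the partner is scanned in full, but only if `d` belongs to an axiom. The conclusion
speaks of the facts known before the scan, although the matrix may grow meanwhile; facts found later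
are processed themselves. -/
theorem runs_cutRule (hw : 64 * (2 * N * (2 * N)) ≤ 2 ^ w) (hm : ForestTable N m)
    (hR : StepClosed N m R) (hσ : Worklist N m R σ Q) (hg : g < 2 * N) (hd : d < 2 * N)
    (h7 : σ.reg 7 = g) (h8 : σ.reg 8 = d) (hgd : ListRel Q g d) :
    cutRule.Runs w σ fun t τ => t ≤ 6 + (if m 13 d ≠ 0 then 2 * N * 21 else 0) ∧
      Extends N m R 10 σ Q (fun Q' => ∀ c, m 13 d = c + 1 → ∀ e < 2 * N, ListRel Q c e →
        ListRel Q' g e) τ := by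
  have hN : 2 * N ≤ 2 * N * (2 * N) := Nat.le_mul_of_pos_right _ (by omega)
  have hs := hm.partner_lt d hd
  simp only [cutRule, runs_block_cons, runs_block_nil, runs_ite, runs_skip, apply, NoOverflow,
    true_and, Function.update_apply, Nat.reduceEqDiff, reduceIte, h8, hσ.table 13 (by norm_num),
    Holds, hσ.reg_zero, OfNat.one_ne_ofNat, hσ.reg_one, hσ.reg_size]
  refine ⟨fun h => ?_, fun h => ?_⟩
  · refine ⟨by omega, hσ.extends_self (by norm_num) rfl (fun r hr => ?_) fun c hc => ?_⟩
    · simp only [Function.update_apply]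
      rw [if_neg (by omega)]
    · omega
  · obtain ⟨c, hc⟩ := Nat.exists_eq_succ_of_ne_zero h
    rw [Nat.succ_eq_add_one] at hc
    have hcN : c < 2 * N := by omega
    have hrow := pair_lt (M := 2 * N) hcN (by omega : 0 < 2 * N)
    rw [if_pos h, hc, Nat.add_sub_cancel]
    refine ⟨by omega, (runs_loop_count (2 * N) 20 (fun e τ => τ.reg 10 = c * (2 * N) ∧
      τ.reg 11 = e ∧ Extends N m R 10 σ Q (fun Q' => ∀ e' < e, ListRel Q c e' →
        ListRel Q' g e') τ) ?_ ?_ ?_).mono ?_⟩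
    · rintro e τ - ⟨-, he, Q', hQ', -⟩
      simp only [Holds, he, hQ'.reg_size]
    · rintro e τ he ⟨h10, h11, Q₁, hQ₁, hQQ₁, hf, hP⟩
      have hce := pair_lt hcN he
      have hmark := hQ₁.mark c hcN e he
      simp only [runs_block_cons, runs_block_nil, apply, NoOverflow, true_and,
        Function.update_apply, reduceIte, h10, h11, runs_seq, hmark]
      refine ⟨by omega, ?_⟩
      refine (runs_cutPush (Q := Q₁) (m := m) (R := R) (g := g) (e := e) (P := ListRel Q₁ c e) hw
        ?_ hg he ?_ ?_ ?_ fun h1 =>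
          hR.cut g hg d hd c hcN e he hc (hσ.rel hR _ _ hgd) (hQ₁.rel hR _ _ h1)).mono ?_
      · refine hQ₁.of_eq rfl fun r hr _ => ?_
        simp only [Function.update_apply]
        repeat rw [if_neg (by omega)]
      · simp [hf 7 (by norm_num) (by norm_num), h7]
      · simp [h11]
      · simp
      rintro t υ ⟨ht, Q₂, hQ₂, hQQ₂, hf₂, hP₂⟩
      have e10 : υ.reg 10 = c * (2 * N) := (hf₂ 10 (by norm_num) (by norm_num)).trans (by simpa)
      have e11 : υ.reg 11 = e := (hf₂ 11 (by norm_num) (by norm_num)).trans (by simpa)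
      simp only [e11, hQ₂.reg_one, runs_skip]
      refine ⟨by omega, by omega, by simpa using e10, by simp, Q₂, ?_, hQQ₁.trans hQQ₂, ?_, ?_⟩
      · refine hQ₂.of_eq rfl fun r hr _ => ?_
        simp only [Function.update_apply]
        repeat rw [if_neg (by omega)]
      · intro r hr hr4
        simp only [Function.update_apply]
        rw [if_neg (by omega), hf₂ r (by omega) hr4, ← hf r hr hr4]
        simp only [Function.update_apply]
        repeat rw [if_neg (by omega)]
      · intro e' he' hl
        rcases Nat.lt_succ_iff_lt_or_eq.1 he' with h | rfl
        · exact (hP e' h hl).mono hQQ₂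
        · exact hP₂ (hl.mono hQQ₁)
    · refine ⟨by simp, by simp, hσ.extends_self (by norm_num) rfl (fun r hr => ?_)
        (fun _ h => absurd h (by omega))⟩
      simp only [Function.update_apply]
      repeat rw [if_neg (by omega)]
    · rintro t υ ⟨ht, -, -, hυ⟩
      refine ⟨by omega, hυ.trans le_rfl (List.prefix_refl _) (fun _ _ _ => rfl) ?_⟩
      intro Q' _ hQ' c' hc' e he hl
      obtain rfl : c' = c := by omega
      exact hQ' e he hl

open Classical in
/-- The number of steps of `congruenceRule` that depends on the annotated nodes. -/
noncomputable def congruenceRuleCost (m : ℕ → ℕ → ℕ) (g d : ℕ) : ℕ :=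
  if m 9 (g / 2) ≠ 0 ∧ m 9 (g / 2) = m 9 (d / 2) then
    congruenceCost m (m 8 (g / 2)) (m 8 (d / 2)) else 0

/-- A fact can be a premise of the rule only for the parents of its two nodes, and only if these
nodes have the same position; roots have position `0` and are excluded. -/
theorem runs_congruenceRule (hw : 64 * (2 * N * (2 * N)) ≤ 2 ^ w) (hm : ForestTable N m)
    (hR : StepClosed N m R) (hσ : Worklist N m R σ Q) (hg : g < 2 * N) (hd : d < 2 * N)
    (h7 : σ.reg 7 = g) (h8 : σ.reg 8 = d) :
    congruenceRule.Runs w σ fun t τ => t ≤ 25 + congruenceRuleCost m g d ∧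
      Extends N m R 10 σ Q (fun Q' => m 9 (g / 2) ≠ 0 → m 9 (g / 2) = m 9 (d / 2) →
        SameLabel m (m 8 (g / 2)) (m 8 (d / 2)) →
        (∀ c < m 6 (m 8 (g / 2)), ArgPremises m (ListRel Q) (m 8 (g / 2)) (m 8 (d / 2)) c) →
        ListRel Q' (2 * m 8 (g / 2)) (2 * m 8 (d / 2) + 1)) τ := by
  have hN : 2 * N ≤ 2 * N * (2 * N) := Nat.le_mul_of_pos_right _ (by omega)
  simp only [congruenceRule, runs_block_cons, runs_block_nil, apply, NoOverflow,
    true_and, Function.update_apply, Nat.reduceEqDiff, reduceIte, h7, h8,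
    hσ.table 12 (by norm_num), hσ.table 9 (by norm_num), hm.node g hg, hm.node d hd]
  refine runs_guarded (fun h => ?_) fun h => ?_
  · have h1 : m 9 (g / 2) = m 9 (d / 2) := by
      have := h (eq 12 13) (by simp)
      simpa [Holds] using this
    have h2 : m 9 (g / 2) ≠ 0 := by
      have := h (lt 2 12) (by simp)
      simp [Holds, hσ.reg_zero] at this
      omega
    simp only [runs_block_cons, runs_block_nil, apply, NoOverflow, true_and,
      Function.update_apply, Nat.reduceEqDiff, reduceIte, hσ.table 8 (by norm_num)]
    have hp := (hm.child_parent (g / 2) (by omega) h2).1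
    have hq := (hm.child_parent (d / 2) (by omega) (h1 ▸ h2)).1
    have hcost : congruenceRuleCost m g d = congruenceCost m (m 8 (g / 2)) (m 8 (d / 2)) :=
      if_pos ⟨h2, h1⟩
    refine (runs_congruence (Q := Q) hw hm hR ?_ hp hq ?_ ?_).mono ?_
    · refine hσ.of_eq rfl fun r hr _ => ?_
      simp only [Function.update_apply]
      repeat rw [if_neg (by omega)]
    · simp
    · simp
    rintro t υ ⟨ht, hυ⟩ s hs
    simp only [List.length_cons, List.length_nil] at hs
    refine ⟨by omega, hυ.trans (by norm_num) (List.prefix_refl _) (fun r hr _ => ?_)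
      fun _ _ h _ _ => h⟩
    simp only [Function.update_apply]
    repeat rw [if_neg (by omega)]
  · intro s hs
    simp only [List.length_cons, List.length_nil] at hs
    refine ⟨by omega, hσ.extends_self (by norm_num) rfl (fun r hr => ?_) fun h1 h2 => ?_⟩
    · simp only [Function.update_apply]
      repeat rw [if_neg (by omega)]
    · simp [Holds, hσ.reg_zero] at h
      omega

end RamProg

/-! ### Saturation of the worklist -/

namespace RamProg

open RamInstr RamTest

/-- Draw the conclusions from the fact given by the registers `7` and `8`. -/
def process : RamProg :=
  seq replaceRule (seq contextRule (seq cutRule congruenceRule))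

/-- Process all facts of the worklist; register `5` is the position in the list. -/
def saturate : RamProg :=
  loop (lt 5 4)
    (block [load 7 15 5, load 8 16 5, add 5 5 1]
      (seq process (block [copy 9 7, copy 7 8, copy 8 9] process)))

variable {w N : ℕ} {m : ℕ → ℕ → ℕ} {R : ℕ → ℕ → Prop} {σ τ : RamState} {Q : List (ℕ × ℕ)}
  {g d : ℕ}

/-- A bound for the number of steps of `process`. -/
noncomputable def processCost (N : ℕ) (m : ℕ → ℕ → ℕ) (g d : ℕ) : ℕ :=
  54 + (if g = d then 2 * N * 17 else 0) + (if m 13 d ≠ 0 then 2 * N * 21 else 0) +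
    congruenceRuleCost m g d

theorem runs_process (hw : 64 * (2 * N * (2 * N)) ≤ 2 ^ w) (hm : ForestTable N m)
    (hR : StepClosed N m R) (hσ : Worklist N m R σ Q) (hg : g < 2 * N) (hd : d < 2 * N)
    (h7 : σ.reg 7 = g) (h8 : σ.reg 8 = d) (hgd : ListRel Q g d) :
    process.Runs w σ fun t τ => t ≤ processCost N m g d ∧
      Extends N m R 10 σ Q (fun Q' => Processed N m (ListRel Q) (ListRel Q') g d) τ := by
  rw [process, runs_seq]
  refine (runs_replaceRule hw hR hσ hg h7 h8 hgd).mono ?_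
  rintro t₁ τ₁ ⟨ht₁, Q₁, hQ₁, hQQ₁, hf₁, hP₁⟩
  rw [runs_seq]
  refine (runs_contextRule hw hm hR hQ₁ hg hd ((hf₁ 7 (by norm_num) (by norm_num)).trans h7)
    ((hf₁ 8 (by norm_num) (by norm_num)).trans h8) (hgd.mono hQQ₁)).mono ?_
  rintro t₂ τ₂ ⟨ht₂, h₂⟩
  obtain ⟨Q₂, hQ₂, hQQ₂, hf₂, hP₂⟩ := h₂.trans le_rfl hQQ₁ hf₁ fun _ _ h => h
  rw [runs_seq]
  refine (runs_cutRule hw hm hR hQ₂ hg hd ((hf₂ 7 (by norm_num) (by norm_num)).trans h7)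
    ((hf₂ 8 (by norm_num) (by norm_num)).trans h8) (hgd.mono hQQ₂)).mono ?_
  rintro t₃ τ₃ ⟨ht₃, h₃⟩
  obtain ⟨Q₃, hQ₃, hQQ₃, hf₃, hP₃⟩ := h₃
  have hf₃' : ∀ r < 10, r ≠ 4 → τ₃.reg r = σ.reg r :=
    fun r hr hr4 => (hf₃ r hr hr4).trans (hf₂ r hr hr4)
  refine (runs_congruenceRule hw hm hR hQ₃ hg hd
    ((hf₃' 7 (by norm_num) (by norm_num)).trans h7)
    ((hf₃' 8 (by norm_num) (by norm_num)).trans h8)).mono ?_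
  rintro t₄ τ₄ ⟨ht₄, Q₄, hQ₄, hQQ₄, hf₄, hP₄⟩
  have h24 : Q₂ <+: Q₄ := hQQ₃.trans hQQ₄
  have hQ₁₄ : ∀ a b, ListRel Q₁ a b → ListRel Q₄ a b := by
    obtain ⟨Q₂', hQ₂', hQQ₂', -⟩ := h₂
    -- The state determines the list it represents, so the two witnesses obtained from the same
    -- final state agree.
    have : Q₂' = Q₂ := by
      refine List.ext_getElem ?_ fun i hi hi' => ?_
      · rw [← hQ₂'.reg_length, ← hQ₂.reg_length]
      · exact Prod.ext ((hQ₂'.left i hi).symm.trans (hQ₂.left i hi'))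
          ((hQ₂'.right i hi).symm.trans (hQ₂.right i hi'))
    intro a b h
    exact (h.mono (this ▸ hQQ₂')).mono h24
  refine ⟨?_, Q₄, hQ₄, hQQ₂.trans h24, fun r hr hr4 => (hf₄ r hr hr4).trans (hf₃' r hr hr4),
    fun h e he => hQ₁₄ _ _ (hP₁ h e he), fun h => (hP₂ (h.mono hQQ₁)).mono h24,
    fun c hc e he h => (hP₃ c hc e he (h.mono hQQ₂)).mono hQQ₄,
    fun h1 h2 h3 h4 => hP₄ h1 h2 h3 fun c hc => (h4 c hc).mono fun a b h =>
      h.mono (hQQ₂.trans hQQ₃)⟩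
  rw [processCost]
  omega

/-- A bound for the number of steps of one round of `saturate`. -/
noncomputable def roundCost (N : ℕ) (m : ℕ → ℕ → ℕ) (x : ℕ × ℕ) : ℕ :=
  processCost N m x.1 x.2 + processCost N m x.2 x.1 + 8

/-- The potential is the total cost of all pairs not yet processed. It pays for every round because
a fact never enters the list twice, however much the list grows. -/
theorem runs_saturate (hw : 64 * (2 * N * (2 * N)) ≤ 2 ^ w) (hm : ForestTable N m)
    (hR : StepClosed N m R) (hσ : Worklist N m R σ Q) (h5 : σ.reg 5 = 0)
    (hc : RuleClosed N m (ListRel []) (ListRel Q)) :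
    saturate.Runs w σ fun t τ =>
      t ≤ (∑ x ∈ Finset.range (2 * N) ×ˢ Finset.range (2 * N), roundCost N m x) + 1 ∧
      ∃ Q', Worklist N m R τ Q' ∧ RuleClosed N m (ListRel Q') (ListRel Q') ∧
        τ.reg 6 = σ.reg 6 := by
  set F := Finset.range (2 * N) ×ˢ Finset.range (2 * N) with hF
  refine (runs_loop (fun B τ => ∃ Q' i, Worklist N m R τ Q' ∧ i ≤ Q'.length ∧ τ.reg 5 = i ∧
    RuleClosed N m (ListRel (Q'.take i)) (ListRel Q') ∧ τ.reg 6 = σ.reg 6 ∧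
    B = ∑ x ∈ F \ (Q'.take i).toFinset, roundCost N m x) ?_ (B := ∑ x ∈ F, roundCost N m x)
    ⟨Q, 0, hσ, Nat.zero_le _, h5, by simpa using hc, rfl, by simp⟩).mono ?_
  · rintro B τ ⟨Q₁, i, hQ₁, hi, hi5, hcl, h6, rfl⟩ hlt
    simp only [Holds, hi5, hQ₁.reg_length] at hlt
    obtain ⟨g, d, hgd⟩ : ∃ g d, Q₁[i] = (g, d) := ⟨_, _, rfl⟩
    have hmem : (g, d) ∈ Q₁ := hgd ▸ List.getElem_mem hlt
    obtain ⟨hg, hd⟩ := hQ₁.lt _ hmem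
    have hl := hQ₁.left i hlt
    have hr := hQ₁.right i hlt
    rw [hgd] at hl hr
    have hlen := hQ₁.length_le
    simp only [runs_block_cons, runs_block_nil, apply, NoOverflow, true_and, runs_seq,
      Function.update_apply, Nat.reduceEqDiff, reduceIte, hi5, hl, hr, hQ₁.reg_one,
      OfNat.one_ne_ofNat]
    refine ⟨by omega, (runs_process (Q := Q₁) (g := g) (d := d) hw hm hR ?_ hg hd ?_ ?_
      (Or.inl hmem)).mono ?_⟩
    · refine hQ₁.of_eq rfl fun r hr _ => ?_
      simp only [Function.update_apply]
      repeat rw [if_neg (by omega)]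
    · simp
    · simp
    rintro t₂ τ₂ ⟨ht₂, Q₂, hQ₂, hQQ₂, hf₂, hP₂⟩
    have h7 : τ₂.reg 7 = g := by
      rw [hf₂ 7 (by norm_num) (by norm_num)]
      simp
    have h8 : τ₂.reg 8 = d := by
      rw [hf₂ 8 (by norm_num) (by norm_num)]
      simp
    simp only [h7, h8]
    refine (runs_process (Q := Q₂) (g := d) (d := g) hw hm hR ?_ hd hg ?_ ?_
      (Or.inr (hQQ₂.subset hmem))).mono ?_
    · refine hQ₂.of_eq rfl fun r hr _ => ?_
      simp only [Function.update_apply]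
      repeat rw [if_neg (by omega)]
    · simp
    · simp
    rintro t₃ τ₃ ⟨ht₃, Q₃, hQ₃, hQQ₃, hf₃, hP₃⟩
    have hpre : Q₁ <+: Q₃ := hQQ₂.trans hQQ₃
    have htake : Q₃.take (i + 1) = Q₁.take i ++ [(g, d)] := by
      obtain ⟨T, rfl⟩ := hpre
      rw [List.take_append_of_le_length (by omega), List.take_add_one, List.getElem?_eq_getElem hlt,
        hgd]
      rfl
    have hfin : ∀ r < 10, r ≠ 4 → r ≠ 5 → r < 7 → τ₃.reg r = τ.reg r := by
      intro r hr hr4 hr5 hr7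
      rw [hf₃ r hr hr4]
      simp only [Function.update_apply]
      rw [if_neg (by omega), if_neg (by omega), if_neg (by omega), hf₂ r hr hr4]
      simp only [Function.update_apply]
      rw [if_neg (by omega), if_neg (by omega), if_neg (by omega)]
    refine ⟨_, ⟨Q₃, i + 1, hQ₃, ?_, ?_, ?_, ?_, rfl⟩, ?_⟩
    · have := hpre.length_le
      omega
    · rw [hf₃ 5 (by norm_num) (by norm_num)]
      simp only [Function.update_apply, Nat.reduceEqDiff, reduceIte]
      rw [hf₂ 5 (by norm_num) (by norm_num)]
      simp
    · rw [htake]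
      refine hcl.insert hm ?_ hpre (hP₂.mono (fun _ _ h => h) fun _ _ h => h.mono hQQ₃)
        (hP₃.mono (fun _ _ h => h.mono hQQ₂) fun _ _ h => h)
      intro x hx
      rcases List.mem_append.1 hx with hx | hx
      · exact List.mem_of_mem_take hx
      · rw [List.mem_singleton.1 hx]
        exact hmem
    · rw [hfin 6 (by norm_num) (by norm_num) (by norm_num) (by norm_num), h6]
    · have hnot : (g, d) ∉ (Q₁.take i).toFinset := by
        have h1 := hQ₃.nodup.sublist (List.take_sublist (i + 1) Q₃)
        rw [htake, List.nodup_append] at h1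
        intro hx
        exact h1.2.2 _ (List.mem_toFinset.1 hx) _ (List.mem_singleton.2 rfl) rfl
      have hmemF : (g, d) ∈ F \ (Q₁.take i).toFinset := by
        simp only [Finset.mem_sdiff, hF, Finset.mem_product, Finset.mem_range]
        exact ⟨⟨hg, hd⟩, hnot⟩
      -- Exactly one summand leaves the potential, and it bounds the cost of this round.
      have hset : F \ (Q₃.take (i + 1)).toFinset = (F \ (Q₁.take i).toFinset).erase (g, d) := by
        rw [htake]
        ext x
        simp only [Finset.mem_sdiff, Finset.mem_erase, List.toFinset_append, Finset.mem_union,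
          List.mem_toFinset, List.mem_singleton]
        tauto
      rw [hset, ← Finset.sum_erase_add _ _ hmemF]
      simp only [roundCost]
      omega
  · rintro t τ ⟨ht, hn, B', Q', i, hQ', hi, hi5, hcl, h6, -⟩
    simp only [Holds, hi5, hQ'.reg_length] at hn
    have : Q'.take i = Q' := List.take_of_length_le (by omega)
    rw [this] at hcl
    exact ⟨ht, Q', hQ', hcl, h6⟩

end RamProg

/-! ### Amortized cost of the saturation -/

namespace RamProg

variable {N : ℕ} {m : ℕ → ℕ → ℕ}

/-- Children at different positions are different nodes with parent `p`. Written as a count of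
nodes, the arity can be summed over all parents by exchanging sums. -/
theorem arity_le_card (hm : ForestTable N m) {p : ℕ} (hp : p < N) :
    m 6 p ≤ ((Finset.range N).filter fun h => m 8 h = p).card := by
  have : Set.InjOn (childAt m p) (Finset.range (m 6 p)) := by
    intro a ha b hb hab
    have h1 := (hm.parent_child p hp a (by simpa using ha)).2
    have h2 := (hm.parent_child p hp b (by simpa using hb)).2
    rw [hab] at h1
    omega
  rw [← Finset.card_range (m 6 p), ← Finset.card_image_of_injOn this]
  refine Finset.card_le_card fun x hx => ?_
  obtain ⟨c, hc, rfl⟩ := Finset.mem_image.1 hx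
  rw [Finset.mem_range] at hc
  exact Finset.mem_filter.2 ⟨Finset.mem_range.2 (hm.child_lt p hp c hc),
    (hm.parent_child p hp c hc).1⟩

/-- Parent and position determine the node, which has two annotations. -/
theorem card_annotated_le_two (hm : ForestTable N m) (i p : ℕ) (hi : i ≠ 0) :
    ((Finset.range (2 * N)).filter fun d => m 9 (d / 2) = i ∧ m 8 (d / 2) = p).card ≤ 2 := by
  refine (Finset.card_le_card (t := {2 * childAt m p (i - 1), 2 * childAt m p (i - 1) + 1})
    fun d hd => ?_).trans Finset.card_le_two
  obtain ⟨hd, h1, h2⟩ := Finset.mem_filter.1 hd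
  rw [Finset.mem_range] at hd
  have := (hm.child_parent (d / 2) (by omega) (by omega)).2.2
  rw [h1, h2] at this
  rw [Finset.mem_insert, Finset.mem_singleton, this]
  omega

theorem congruenceRuleCost_le (hm : ForestTable N m) {g d : ℕ} (hg : g < 2 * N) (hd : d < 2 * N) :
    congruenceRuleCost m g d ≤ 40 + 24 * ∑ h ∈ Finset.range N,
      if m 9 (d / 2) = m 9 (g / 2) ∧ m 8 (d / 2) = m 8 h ∧ m 9 (g / 2) ≠ 0 then 1 else 0 := by
  rw [congruenceRuleCost]
  split_ifs with h
  · rw [congruenceCost]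
    split_ifs with hl
    · have hp := (hm.child_parent (g / 2) (by omega) h.1).1
      have hq := (hm.child_parent (d / 2) (by omega) (h.2 ▸ h.1)).1
      -- The arity is transferred to the parent of `d`, because `g` is held fixed while `d` varies.
      rw [hl.arity_eq hm hp hq]
      have := arity_le_card hm hq
      rw [Finset.card_filter] at this
      simp only [h.2.symm, ne_eq, h.1, not_false_eq_true, and_true, true_and]
      simp only [eq_comm (a := m 8 (d / 2))]
      omega
    · omega
  · omega

/-- For fixed `g`, exchange the sums: a node `h` is charged for those `d` that share its parent and
have the position of `g`, and there are at most two of these. This gives `80 * N + 48 * N` for each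
of the `2 * N` values of `g`. -/
theorem sum_congruenceRuleCost_le (hm : ForestTable N m) :
    ∑ g ∈ Finset.range (2 * N), ∑ d ∈ Finset.range (2 * N), congruenceRuleCost m g d ≤
      256 * N ^ 2 := by
  have key : ∀ g ∈ Finset.range (2 * N),
      ∑ d ∈ Finset.range (2 * N), congruenceRuleCost m g d ≤ 128 * N := by
    intro g hg
    rw [Finset.mem_range] at hg
    calc ∑ d ∈ Finset.range (2 * N), congruenceRuleCost m g d
        ≤ ∑ d ∈ Finset.range (2 * N), (40 + 24 * ∑ h ∈ Finset.range N,
            if m 9 (d / 2) = m 9 (g / 2) ∧ m 8 (d / 2) = m 8 h ∧ m 9 (g / 2) ≠ 0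
              then 1 else 0) :=
          Finset.sum_le_sum fun d hd => congruenceRuleCost_le hm hg (Finset.mem_range.1 hd)
      _ = 80 * N + 24 * ∑ h ∈ Finset.range N, ∑ d ∈ Finset.range (2 * N),
            if m 9 (d / 2) = m 9 (g / 2) ∧ m 8 (d / 2) = m 8 h ∧ m 9 (g / 2) ≠ 0
              then 1 else 0 := by
          rw [Finset.sum_add_distrib, ← Finset.mul_sum, Finset.sum_comm, Finset.sum_const,
            Finset.card_range, smul_eq_mul]
          ring
      _ ≤ 80 * N + 24 * ∑ h ∈ Finset.range N, 2 := by
          gcongr with h hh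
          by_cases h0 : m 9 (g / 2) = 0
          · simp [h0]
          · simp only [ne_eq, h0, not_false_eq_true, and_true]
            rw [← Finset.card_filter]
            exact card_annotated_le_two hm _ _ h0
      _ = 128 * N := by
          rw [Finset.sum_const, Finset.card_range, smul_eq_mul]
          ring
  calc _ ≤ ∑ g ∈ Finset.range (2 * N), 128 * N := Finset.sum_le_sum key
    _ = 256 * N ^ 2 := by
      rw [Finset.sum_const, Finset.card_range, smul_eq_mul]
      ring

/-- The coefficient `540` is `216` from the constant part, `68` from the diagonal and `256` from
function symbols; the axioms contribute `2 * N` rows with at most `2 * a` entries of cost `42 * N`.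
-/
theorem sum_processCost_le (hm : ForestTable N m) {a : ℕ}
    (ha : ((Finset.range (2 * N)).filter fun d => m 13 d ≠ 0).card ≤ 2 * a) :
    ∑ g ∈ Finset.range (2 * N), ∑ d ∈ Finset.range (2 * N), processCost N m g d ≤
      540 * N ^ 2 + 168 * a * N ^ 2 := by
  have h1 : ∑ g ∈ Finset.range (2 * N), ∑ d ∈ Finset.range (2 * N),
      (if g = d then 2 * N * 17 else 0) = 68 * N ^ 2 := by
    have : ∀ g ∈ Finset.range (2 * N), ∑ d ∈ Finset.range (2 * N),
        (if g = d then 2 * N * 17 else 0) = 2 * N * 17 := by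
      intro g hg
      rw [Finset.sum_ite_eq, if_pos hg]
    rw [Finset.sum_congr rfl this, Finset.sum_const, Finset.card_range, smul_eq_mul]
    ring
  have h2 : ∑ d ∈ Finset.range (2 * N), (if m 13 d ≠ 0 then 2 * N * 21 else 0) ≤
      2 * a * (2 * N * 21) := by
    rw [← Finset.sum_filter, Finset.sum_const, smul_eq_mul]
    gcongr
  have h3 := sum_congruenceRuleCost_le hm
  simp only [processCost, Finset.sum_add_distrib, h1, Finset.sum_const, Finset.card_range,
    smul_eq_mul]
  calc _ ≤ 2 * N * (2 * N * 54) + 68 * N ^ 2 + 2 * N * (2 * a * (2 * N * 21)) + 256 * N ^ 2 := by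
        gcongr
    _ = _ := by ring

theorem sum_roundCost_le (hm : ForestTable N m) {a : ℕ}
    (ha : ((Finset.range (2 * N)).filter fun d => m 13 d ≠ 0).card ≤ 2 * a) :
    ∑ x ∈ Finset.range (2 * N) ×ˢ Finset.range (2 * N), roundCost N m x ≤
      1112 * (N ^ 2 * (1 + a)) := by
  have h := sum_processCost_le hm ha
  simp only [roundCost, Finset.sum_add_distrib, Finset.sum_product]
  rw [Finset.sum_comm (f := fun g d => processCost N m d g)]
  simp only [Finset.sum_const, Finset.card_range, smul_eq_mul]
  nlinarith [Nat.zero_le (a * N ^ 2)]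

end RamProg

/-! ### Conclusions of rules without premises -/

namespace RamProg

open RamInstr RamTest

/-- Record the fact `⊥ᴸ, ⊥ᴸ` if the tag in register `11` is that of `⊥`. -/
def initBot : RamProg := ite (eq 11 1) (block [add 60 10 10, add 61 10 10] push) skip

/-- Record the fact `⊤ᴿ, ⊤ᴿ` if the tag in register `11` is that of `⊤`. -/
def initTop : RamProg :=
  ite (eq 11 12) (block [add 60 10 10, add 60 60 1, copy 61 60] push) skip

/-- Compare the node in register `10` with all nodes if its arity in register `13` is `0`. -/
def initLeaf : RamProg :=
  ite (eq 13 2)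
    (block [copy 14 2]
      (loop (lt 14 6) (block [copy 20 10, copy 21 14] (seq congruence (block [add 14 14 1] skip)))))
    skip

/-- Record the conclusions of the rules without premises. -/
def initFacts : RamProg :=
  block [copy 10 2]
    (loop (lt 10 6)
      (block [load 11 1 10, const 12 2, load 13 6 10]
        (seq initBot (seq initTop (seq initLeaf (block [add 10 10 1] skip))))))

variable {w N : ℕ} {m : ℕ → ℕ → ℕ} {R : ℕ → ℕ → Prop} {σ τ : RamState} {Q : List (ℕ × ℕ)}
  {p : ℕ}

theorem runs_initBot (hw : 64 * (2 * N * (2 * N)) ≤ 2 ^ w) (hR : StepClosed N m R)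
    (hσ : Worklist N m R σ Q) (hp : p < N) (h10 : σ.reg 10 = p) (h11 : σ.reg 11 = m 1 p) :
    initBot.Runs w σ fun t τ => t ≤ 15 ∧
      Extends N m R 20 σ Q (fun Q' => m 1 p = 1 → ListRel Q' (2 * p) (2 * p)) τ := by
  have hN : 2 * N ≤ 2 * N * (2 * N) := Nat.le_mul_of_pos_right _ (by omega)
  simp only [initBot, runs_ite, runs_skip, Holds, h11, hσ.reg_one]
  refine ⟨fun h => ?_, fun h => ⟨by omega, hσ.extends_self (by norm_num) rfl (fun _ _ => rfl)
    fun h' => absurd h' h⟩⟩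
  simp only [runs_block_cons, runs_block_nil, apply, NoOverflow, Function.update_apply,
    Nat.reduceEqDiff, reduceIte, h10]
  refine ⟨by omega, by omega, (runs_push (Q := Q) (m := m) (R := R) (g := 2 * p) (d := 2 * p) hw
    ?_ (by omega) (by omega) ?_ ?_ (hR.bot p hp h)).mono ?_⟩
  · refine hσ.of_eq rfl fun r hr _ => ?_
    simp only [Function.update_apply]
    repeat rw [if_neg (by omega)]
  · simp; omega
  · simp; omega
  rintro t υ ⟨ht, hυ⟩
  refine ⟨by omega, hυ.trans (by norm_num) (List.prefix_refl _) (fun r hr _ => ?_)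
    fun _ _ h _ => h⟩
  simp only [Function.update_apply]
  repeat rw [if_neg (by omega)]

theorem runs_initTop (hw : 64 * (2 * N * (2 * N)) ≤ 2 ^ w) (hR : StepClosed N m R)
    (hσ : Worklist N m R σ Q) (hp : p < N) (h10 : σ.reg 10 = p) (h11 : σ.reg 11 = m 1 p)
    (h12 : σ.reg 12 = 2) :
    initTop.Runs w σ fun t τ => t ≤ 16 ∧
      Extends N m R 20 σ Q (fun Q' => m 1 p = 2 → ListRel Q' (2 * p + 1) (2 * p + 1)) τ := by
  have hN : 2 * N ≤ 2 * N * (2 * N) := Nat.le_mul_of_pos_right _ (by omega)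
  simp only [initTop, runs_ite, runs_skip, Holds, h11, h12]
  refine ⟨fun h => ?_, fun h => ⟨by omega, hσ.extends_self (by norm_num) rfl (fun _ _ => rfl)
    fun h' => absurd h' h⟩⟩
  simp only [runs_block_cons, runs_block_nil, apply, NoOverflow, Function.update_apply,
    reduceIte, h10, OfNat.one_ne_ofNat, hσ.reg_one, true_and]
  refine ⟨by omega, by omega, (runs_push (Q := Q) (m := m) (R := R) (g := 2 * p + 1)
    (d := 2 * p + 1) hw ?_ (by omega) (by omega) ?_ ?_ (hR.top p hp h)).mono ?_⟩
  · refine hσ.of_eq rfl fun r hr _ => ?_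
    simp only [Function.update_apply]
    repeat rw [if_neg (by omega)]
  · simp; omega
  · simp; omega
  rintro t υ ⟨ht, hυ⟩
  refine ⟨by omega, hυ.trans (by norm_num) (List.prefix_refl _) (fun r hr _ => ?_)
    fun _ _ h _ => h⟩
  simp only [Function.update_apply]
  repeat rw [if_neg (by omega)]

/-- At arity `0` no fact could ever trigger the rule, so such nodes are compared with all nodes
beforehand. For variables this yields the hypothesis rule. -/
theorem runs_initLeaf (hw : 64 * (2 * N * (2 * N)) ≤ 2 ^ w) (hm : ForestTable N m)
    (hR : StepClosed N m R) (hσ : Worklist N m R σ Q) (hp : p < N) (h6 : σ.reg 6 = N)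
    (h10 : σ.reg 10 = p) (h13 : σ.reg 13 = m 6 p) :
    initLeaf.Runs w σ fun t τ => t ≤ 3 + N * 62 ∧
      Extends N m R 14 σ Q (fun Q' => m 6 p = 0 → ∀ q < N, SameLabel m p q →
        ListRel Q' (2 * p) (2 * q + 1)) τ := by
  have hN : 2 * N ≤ 2 * N * (2 * N) := Nat.le_mul_of_pos_right _ (by omega)
  simp only [initLeaf, runs_ite, runs_skip, Holds, h13, hσ.reg_zero]
  refine ⟨fun h => ?_, fun h => ⟨by omega, hσ.extends_self (by norm_num) rfl (fun _ _ => rfl)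
    fun h' => absurd h' h⟩⟩
  rw [runs_block_cons, runs_block_nil]
  refine ⟨trivial, (runs_loop_count N 61 (fun e τ => τ.reg 14 = e ∧
      Extends N m R 14 σ Q (fun Q' => ∀ q < e, SameLabel m p q →
        ListRel Q' (2 * p) (2 * q + 1)) τ) ?_ ?_ ?_).mono ?_⟩
  · rintro e τ - ⟨he, Q', hQ', -, hf, -⟩
    simp only [Holds, he, hf 6 (by norm_num) (by norm_num), h6]
  · rintro q τ hq ⟨h14, Q₁, hQ₁, hQQ₁, hf, hP⟩
    simp only [runs_block_cons, runs_block_nil, runs_seq, runs_skip, apply, NoOverflow, true_and,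
      Function.update_apply, Nat.reduceEqDiff, reduceIte, h14,
      hf 10 (by norm_num) (by norm_num), h10]
    refine (runs_congruence (Q := Q₁) hw hm hR ?_ hp hq ?_ ?_).mono ?_
    · refine hQ₁.of_eq rfl fun r hr _ => ?_
      simp only [Function.update_apply]
      repeat rw [if_neg (by omega)]
    · simp
    · simp
    rintro t υ ⟨ht, Q₂, hQ₂, hQQ₂, hf₂, hP₂⟩
    have e14 : υ.reg 14 = q := by
      rw [hf₂ 14 (by norm_num) (by norm_num)]
      simpa using h14
    have hcost : congruenceCost m p q ≤ 40 := by
      rw [congruenceCost, h]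
      split_ifs <;> omega
    simp only [e14, hQ₂.reg_one]
    refine ⟨by omega, by omega, trivial, Q₂, ?_, hQQ₁.trans hQQ₂, ?_, ?_⟩
    · refine hQ₂.of_eq rfl fun r hr _ => ?_
      simp only [Function.update_apply]
      repeat rw [if_neg (by omega)]
    · intro r hr hr4
      simp only [Function.update_apply]
      rw [if_neg (by omega), hf₂ r (by omega) hr4]
      simp only [Function.update_apply]
      rw [if_neg (by omega), if_neg (by omega), hf r hr hr4]
    · intro q' hq' hl
      rcases Nat.lt_succ_iff_lt_or_eq.1 hq' with h' | rfl
      · exact (hP q' h' hl).mono hQQ₂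
      · exact hP₂ hl fun c hc => absurd hc (by omega)
  · refine ⟨by simp [apply, hσ.reg_zero], hσ.extends_self (by norm_num) rfl (fun r hr => ?_)
      (fun _ h => absurd h (by omega))⟩
    simp only [apply, Function.update_apply]
    rw [if_neg (by omega)]
  · rintro t υ ⟨ht, -, hυ⟩
    exact ⟨by omega, hυ.trans le_rfl (List.prefix_refl _) (fun _ _ _ => rfl) fun _ _ h _ => h⟩

theorem runs_initFacts (hw : 64 * (2 * N * (2 * N)) ≤ 2 ^ w) (hm : ForestTable N m)
    (hR : StepClosed N m R) (hσ : Worklist N m R σ []) (h6 : σ.reg 6 = N) :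
    initFacts.Runs w σ fun t τ => t ≤ 2 + N * (40 + N * 62) ∧
      Extends N m R 10 σ [] (fun Q' => RuleClosed N m (ListRel []) (ListRel Q')) τ := by
  rw [initFacts, runs_block_cons, runs_block_nil]
  refine ⟨trivial, (runs_loop_count N (39 + N * 62) (fun e τ => τ.reg 10 = e ∧
      Extends N m R 10 σ [] (fun Q' => ∀ p < e, (m 1 p = 1 → ListRel Q' (2 * p) (2 * p)) ∧
        (m 1 p = 2 → ListRel Q' (2 * p + 1) (2 * p + 1)) ∧
        (m 6 p = 0 → ∀ q < N, SameLabel m p q → ListRel Q' (2 * p) (2 * q + 1))) τ)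
      ?_ ?_ ?_).mono ?_⟩
  · rintro e τ - ⟨he, Q', hQ', -, hf, -⟩
    simp only [Holds, he, hf 6 (by norm_num) (by norm_num), h6]
  · rintro p τ hp ⟨h10, Q₁, hQ₁, hQQ₁, hf, hP⟩
    have hN : 2 * N ≤ 2 * N * (2 * N) := Nat.le_mul_of_pos_right _ (by omega)
    simp only [runs_block_cons, runs_block_nil, runs_seq, runs_skip, apply, NoOverflow, true_and,
      Function.update_apply, Nat.reduceEqDiff, reduceIte, h10, hQ₁.table 1 (by norm_num),
      hQ₁.table 6 (by norm_num)]
    refine ⟨by omega, (runs_initBot (Q := Q₁) (m := m) (R := R) (p := p) hw hR ?_ hp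
      ?_ ?_).mono ?_⟩
    · refine hQ₁.of_eq rfl fun r hr _ => ?_
      simp only [Function.update_apply]
      repeat rw [if_neg (by omega)]
    · simpa using h10
    · simp
    rintro t₂ τ₂ ⟨ht₂, Q₂, hQ₂, hQQ₂, hf₂, hP₂⟩
    have e10 : τ₂.reg 10 = p := by
      rw [hf₂ 10 (by norm_num) (by norm_num)]
      simpa using h10
    refine (runs_initTop (Q := Q₂) (m := m) (R := R) (p := p) hw hR hQ₂ hp e10 ?_ ?_).mono ?_
    · rw [hf₂ 11 (by norm_num) (by norm_num)]
      simp
    · rw [hf₂ 12 (by norm_num) (by norm_num)]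
      simp
    rintro t₃ τ₃ ⟨ht₃, Q₃, hQ₃, hQQ₃, hf₃, hP₃⟩
    have e10' : τ₃.reg 10 = p := (hf₃ 10 (by norm_num) (by norm_num)).trans e10
    refine (runs_initLeaf (Q := Q₃) (m := m) (R := R) (p := p) hw hm hR hQ₃ hp ?_ e10' ?_).mono ?_
    · rw [hf₃ 6 (by norm_num) (by norm_num), hf₂ 6 (by norm_num) (by norm_num)]
      simp [hf 6 (by norm_num) (by norm_num), h6]
    · rw [hf₃ 13 (by norm_num) (by norm_num), hf₂ 13 (by norm_num) (by norm_num)]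
      simp
    rintro t₄ τ₄ ⟨ht₄, Q₄, hQ₄, hQQ₄, hf₄, hP₄⟩
    have e10'' : τ₄.reg 10 = p := (hf₄ 10 (by norm_num) (by norm_num)).trans e10'
    simp only [e10'', hQ₄.reg_one]
    have h24 := hQQ₃.trans hQQ₄
    refine ⟨by omega, by omega, trivial, Q₄, ?_, hQQ₁.trans (hQQ₂.trans h24), ?_, ?_⟩
    · refine hQ₄.of_eq rfl fun r hr _ => ?_
      simp only [Function.update_apply]
      repeat rw [if_neg (by omega)]
    · intro r hr hr4
      simp only [Function.update_apply]
      rw [if_neg (by omega), hf₄ r (by omega) hr4, hf₃ r (by omega) hr4, hf₂ r (by omega) hr4]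
      simp only [Function.update_apply]
      rw [if_neg (by omega), if_neg (by omega), if_neg (by omega), hf r hr hr4]
    · intro p' hp'
      rcases Nat.lt_succ_iff_lt_or_eq.1 hp' with h' | rfl
      · have h0 := hQQ₂.trans h24
        obtain ⟨a1, a2, a3⟩ := hP p' h'
        exact ⟨fun h => (a1 h).mono h0, fun h => (a2 h).mono h0,
          fun h q hq hl => (a3 h q hq hl).mono h0⟩
      · exact ⟨fun h => (hP₂ h).mono h24, fun h => (hP₃ h).mono hQQ₄, hP₄⟩
  · refine ⟨by simp [apply, hσ.reg_zero], hσ.extends_self (by norm_num) rfl (fun r hr => ?_)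
      (fun _ h => absurd h (by omega))⟩
    simp only [apply, Function.update_apply]
    rw [if_neg (by omega)]
  · rintro t υ ⟨ht, -, hυ⟩
    have hnil : ∀ a b, ¬ ListRel [] a b := by simp [ListRel]
    refine ⟨by rw [show 40 + N * 62 = 39 + N * 62 + 1 by ring]; omega,
      hυ.trans le_rfl (List.prefix_refl _) (fun _ _ _ => rfl) fun Q' _ h => ?_⟩
    refine ⟨fun p hp => (h p hp).1, fun p hp => (h p hp).2.1, fun g _ hg => absurd hg (hnil _ _),
      fun g _ d _ _ _ hg => absurd hg (hnil _ _),
      fun g _ d _ c _ e _ _ _ hg => absurd hg (hnil _ _), fun p hp q hq hl hall => ?_⟩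
    refine (h p hp).2.2 ?_ q hq hl
    by_contra hne
    -- With positive arity the argument number `0` has at least one premise, of whatever kind it is,
    -- and the empty list provides none.
    have h0 := hall 0 (by omega)
    by_cases hlt : 0 < m 3 p + m 4 p
    · exact hnil _ _ (h0.1 hlt)
    · exact hnil _ _ (h0.2 (Or.inr (by omega)))

end RamProg

/-! ## Preorder lists of subterms -/

namespace OLTerm

/-- The first word of the record of a term. -/
def tag : OLTerm → ℕ
  | var _ => 0
  | bot => 1
  | top => 2
  | neg _ => 3
  | meet _ _ => 4
  | join _ _ => 5
  | func _ _ _ _ _ _ _ => 6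

/-- The name of the variable or of the function letter at the root. -/
def letter : OLTerm → ℕ
  | var x => x
  | func f _ _ _ _ _ _ => f
  | _ => 0

/-- The number of invariant arguments of the symbol at the root. -/
def argI : OLTerm → ℕ
  | func _ i _ _ _ _ _ => i
  | _ => 0

/-- The number of covariant arguments of the symbol at the root. -/
def argJ : OLTerm → ℕ
  | meet _ _ => 2
  | join _ _ => 2
  | func _ _ j _ _ _ _ => j
  | _ => 0

/-- The number of contravariant arguments of the symbol at the root. -/
def argK : OLTerm → ℕ
  | neg _ => 1
  | func _ _ _ k _ _ _ => k
  | _ => 0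

/-- The record of the root in the encoding. -/
def record : OLTerm → List ℕ
  | var x => [0, x, 0, 0, 0]
  | bot => [1, 0, 0, 0, 0]
  | top => [2, 0, 0, 0, 0]
  | neg _ => [3, 0, 0, 0, 0]
  | meet _ _ => [4, 0, 0, 0, 0]
  | join _ _ => [5, 0, 0, 0, 0]
  | func f i j k _ _ _ => [6, f, i, j, k]

/-- The immediate subterms. -/
def children : OLTerm → List OLTerm
  | neg s => [s]
  | meet s t => [s, t]
  | join s t => [s, t]
  | func _ _ _ _ x y z => List.ofFn x ++ List.ofFn y ++ List.ofFn z
  | _ => []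

/-- The subterms at all nodes in preorder. -/
def nodes : OLTerm → List OLTerm
  | var x => [var x]
  | bot => [bot]
  | top => [top]
  | neg s => neg s :: s.nodes
  | meet s t => meet s t :: (s.nodes ++ t.nodes)
  | join s t => join s t :: (s.nodes ++ t.nodes)
  | func f i j k x y z => func f i j k x y z ::
      ((List.ofFn fun a => (x a).nodes).flatten ++ (List.ofFn fun b => (y b).nodes).flatten ++
        (List.ofFn fun c => (z c).nodes).flatten)

/-- Treating every term as a root with a list of children avoids a case distinction over the
constructors in the proofs about preorder lists. -/
theorem child_induction {P : OLTerm → Prop} (h : ∀ t, (∀ c ∈ t.children, P c) → P t)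
    (t : OLTerm) : P t := by
  induction t with
  | var x => exact h _ (by simp [children])
  | bot => exact h _ (by simp [children])
  | top => exact h _ (by simp [children])
  | neg s hs => exact h _ (by simpa [children] using hs)
  | meet s t hs ht => exact h _ (by simpa [children] using ⟨hs, ht⟩)
  | join s t hs ht => exact h _ (by simpa [children] using ⟨hs, ht⟩)
  | func f i j k x y z hx hy hz =>
    refine h _ fun c hc => ?_
    simp only [children, List.mem_append, List.mem_ofFn] at hc
    rcases hc with (⟨a, rfl⟩ | ⟨a, rfl⟩) | ⟨a, rfl⟩
    exacts [hx a, hy a, hz a]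

theorem flatten_ofFn_comp {β γ : Type} {n : ℕ} (f : Fin n → β) (g : β → List γ) :
    (List.ofFn fun a => g (f a)).flatten = (List.ofFn f).flatMap g := by
  rw [List.flatMap_def, List.map_ofFn]
  rfl

theorem nodes_eq (t : OLTerm) : t.nodes = t :: t.children.flatMap nodes := by
  cases t <;> simp [nodes, children, flatten_ofFn_comp]

theorem encode_eq (t : OLTerm) : t.encode = t.record ++ t.children.flatMap encode := by
  cases t <;> simp [encode, record, children, flatten_ofFn_comp]

theorem size_eq (t : OLTerm) : t.size = (t.children.map size).sum + 1 := by
  cases t <;> simp [size, children, List.sum_ofFn, List.map_ofFn, Function.comp_def, add_assoc]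

theorem length_children (t : OLTerm) : t.children.length = t.argI + t.argJ + t.argK := by
  cases t <;> simp [children, argI, argJ, argK, add_assoc]

theorem length_nodes (t : OLTerm) : t.nodes.length = t.size := by
  induction t using child_induction with
  | h t ih =>
    rw [nodes_eq, size_eq, List.length_cons, List.length_flatMap,
      List.map_congr_left ih]

/-- Prefix notation is the list of records in preorder. As all records have five words, the number
of a node gives the address of its record. -/
theorem encode_eq_flatMap (t : OLTerm) : t.encode = t.nodes.flatMap record := by
  induction t using child_induction with
  | h t ih =>
    rw [nodes_eq, encode_eq, List.flatMap_cons, List.flatMap_assoc, List.flatMap_def,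
      List.flatMap_def (l := t.children), List.map_congr_left ih]

theorem size_pos (t : OLTerm) : 0 < t.size := by
  rw [size_eq]
  omega

theorem record_length (t : OLTerm) : t.record.length = 5 := by
  cases t <;> rfl

theorem children_length_lt_size (t : OLTerm) : t.children.length < t.size := by
  rw [size_eq, Nat.lt_succ_iff]
  calc t.children.length = (t.children.map fun _ => 1).sum := by simp
    _ ≤ _ := List.sum_le_sum fun c _ => c.size_pos

end OLTerm

/-- Every member of the list is followed by the other nodes of its subterm. -/
def WellNested (L : List OLTerm) : Prop :=
  ∀ (p : ℕ) (t : OLTerm), L[p]? = some t → t.nodes <+: L.drop p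

theorem WellNested.append {L L' : List OLTerm} (h : WellNested L) (h' : WellNested L') :
    WellNested (L ++ L') := by
  intro p t ht
  rcases lt_or_ge p L.length with hp | hp
  · rw [List.getElem?_append_left hp] at ht
    rw [List.drop_append_of_le_length hp.le]
    exact (h p t ht).trans (List.prefix_append _ _)
  · rw [List.getElem?_append_right hp] at ht
    have := h' _ t ht
    rwa [List.drop_append, List.drop_eq_nil_of_le hp, List.nil_append]

theorem WellNested.flatMap {β : Type} {l : List β} {f : β → List OLTerm}
    (h : ∀ b ∈ l, WellNested (f b)) : WellNested (l.flatMap f) := by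
  induction l with
  | nil => intro p t ht; simp at ht
  | cons b l ih =>
    rw [List.flatMap_cons]
    exact (h b List.mem_cons_self).append (ih fun c hc => h c (List.mem_cons_of_mem _ hc))

theorem OLTerm.wellNested_nodes (t : OLTerm) : WellNested t.nodes := by
  induction t using OLTerm.child_induction with
  | h t ih =>
    have h := WellNested.flatMap ih
    intro p s hs
    rcases p with _ | p
    · rw [nodes_eq, List.getElem?_cons_zero, Option.some.injEq] at hs
      rw [hs, List.drop_zero]
    · rw [nodes_eq t] at hs ⊢
      rw [List.getElem?_cons_succ] at hs
      rw [List.drop_succ_cons]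
      exact h p s hs

/-- The subterm at a node. -/
def subtermAt (L : List OLTerm) (p : ℕ) : OLTerm := L.getD p .bot

/-- The end of the subterm at a node. -/
def endAt (L : List OLTerm) (p : ℕ) : ℕ := p + (subtermAt L p).size

/-- The child number `c` of a node; the end of the subterm if there are `c` children. -/
def childPos (L : List OLTerm) (p c : ℕ) : ℕ := (endAt L)^[c] (p + 1)

section Nested

variable {L : List OLTerm} {p q c c' : ℕ}

theorem childPos_zero : childPos L p 0 = p + 1 := rfl

theorem childPos_succ : childPos L p (c + 1) = endAt L (childPos L p c) :=
  Function.iterate_succ_apply' _ _ _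

theorem lt_endAt : p < endAt L p := Nat.lt_add_of_pos_right (OLTerm.size_pos _)

theorem childPos_strictMono : StrictMono (childPos L p) :=
  strictMono_nat_of_lt_succ fun c => by rw [childPos_succ]; exact lt_endAt

theorem lt_childPos : p < childPos L p c :=
  (Nat.lt_succ_self p).trans_le (childPos_strictMono.monotone (Nat.zero_le c))

theorem getElem?_eq_subtermAt (hp : p < L.length) : L[p]? = some (subtermAt L p) := by
  rw [subtermAt, List.getD_eq_getElem?_getD, List.getElem?_eq_getElem hp]
  rfl

theorem subtermAt_eq {t : OLTerm} (h : L[p]? = some t) : subtermAt L p = t := by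
  rw [subtermAt, List.getD_eq_getElem?_getD, h]
  rfl

theorem WellNested.endAt_le (h : WellNested L) (hp : p < L.length) : endAt L p ≤ L.length := by
  have := (h p _ (getElem?_eq_subtermAt hp)).length_le
  rw [OLTerm.length_nodes, List.length_drop] at this
  rw [endAt]
  omega

/-- Jumping over the subterm of one child leads to the next child, so what follows in the list are
the remaining children; after the last one the end of the subterm is reached. -/
theorem childPos_spec {rest : List OLTerm}
    (hrest : L.drop p = (subtermAt L p).nodes ++ rest) :
    ∀ c ≤ (subtermAt L p).children.length,
      L.drop (childPos L p c) = ((subtermAt L p).children.drop c).flatMap OLTerm.nodes ++ rest ∧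
      childPos L p c + (((subtermAt L p).children.drop c).map OLTerm.size).sum = endAt L p := by
  intro c
  induction c with
  | zero =>
    intro _
    constructor
    · rw [childPos_zero, ← List.drop_drop, hrest, OLTerm.nodes_eq]
      rfl
    · rw [childPos_zero, endAt, OLTerm.size_eq (subtermAt L p), List.drop_zero]
      omega
  | succ c ih =>
    intro hc
    obtain ⟨ih1, ih2⟩ := ih (by omega)
    have hc' : c < (subtermAt L p).children.length := by omega
    rw [List.drop_eq_getElem_cons hc'] at ih1 ih2
    have hsub : subtermAt L (childPos L p c) = (subtermAt L p).children[c] := by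
      apply subtermAt_eq
      have := congrArg (fun l => l[0]?) ih1
      rw [List.flatMap_cons, OLTerm.nodes_eq] at this
      simpa using this
    rw [childPos_succ, endAt, hsub]
    constructor
    · rw [← List.drop_drop, ih1, List.flatMap_cons, List.append_assoc,
        ← OLTerm.length_nodes, List.drop_left]
    · rw [List.map_cons, List.sum_cons] at ih2
      omega

theorem WellNested.exists_rest (h : WellNested L) (hp : p < L.length) :
    ∃ rest, L.drop p = (subtermAt L p).nodes ++ rest := by
  obtain ⟨rest, hr⟩ := h p _ (getElem?_eq_subtermAt hp)
  exact ⟨rest, hr.symm⟩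

theorem WellNested.childPos_length (h : WellNested L) (hp : p < L.length) :
    childPos L p (subtermAt L p).children.length = endAt L p := by
  obtain ⟨rest, hr⟩ := h.exists_rest hp
  simpa using (childPos_spec hr _ le_rfl).2

theorem WellNested.childPos_lt_endAt (h : WellNested L) (hp : p < L.length)
    (hc : c < (subtermAt L p).children.length) : childPos L p c < endAt L p := by
  rw [← h.childPos_length hp]
  exact childPos_strictMono hc

theorem WellNested.childPos_lt (h : WellNested L) (hp : p < L.length)
    (hc : c < (subtermAt L p).children.length) : childPos L p c < L.length :=
  (h.childPos_lt_endAt hp hc).trans_le (h.endAt_le hp)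

theorem WellNested.subtermAt_childPos (h : WellNested L) (hp : p < L.length)
    (hc : c < (subtermAt L p).children.length) :
    subtermAt L (childPos L p c) = (subtermAt L p).children[c] := by
  obtain ⟨rest, hr⟩ := h.exists_rest hp
  have ih1 := (childPos_spec hr c hc.le).1
  rw [List.drop_eq_getElem_cons hc] at ih1
  apply subtermAt_eq
  have := congrArg (fun l => l[0]?) ih1
  rw [List.flatMap_cons, OLTerm.nodes_eq] at this
  simpa using this

theorem WellNested.endAt_le_endAt (h : WellNested L) (hp : p < L.length) (hpq : p ≤ q)
    (hq : q < endAt L p) : endAt L q ≤ endAt L p := by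
  obtain ⟨rest, hr⟩ := h.exists_rest hp
  rw [endAt] at hq
  have hlen := OLTerm.length_nodes (subtermAt L p)
  have h1 : L[q]? = (subtermAt L p).nodes[q - p]? := by
    have := congrArg (fun l => l[q - p]?) hr
    rw [List.getElem?_drop, List.getElem?_append_left (by omega)] at this
    rw [← this]
    congr 1
    omega
  have hqL : q < L.length := by
    have := h.endAt_le hp
    rw [endAt] at this
    omega
  rw [getElem?_eq_subtermAt hqL] at h1
  have h2 := ((subtermAt L p).wellNested_nodes (q - p) _ h1.symm).length_le
  rw [OLTerm.length_nodes, List.length_drop, hlen] at h2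
  rw [endAt, endAt]
  omega

/-- The positions of consecutive children cut the range after `p` into intervals. -/
theorem exists_child_interval {x : ℕ} (hp : p < x) (hx : x < childPos L p c) :
    ∃ c₀ < c, childPos L p c₀ ≤ x ∧ x < childPos L p (c₀ + 1) := by
  induction c with
  | zero => rw [childPos_zero] at hx; omega
  | succ c ih =>
    rcases lt_or_ge x (childPos L p c) with h | h
    · obtain ⟨c₀, h1, h2⟩ := ih h
      exact ⟨c₀, by omega, h2⟩
    · exact ⟨c, by omega, h, hx⟩

/-- If `q` came after `p` but before a common child, it would lie in the subterm of an earlier child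
of `p`. Subterms are nested, so the children of `q` would end there as well, before the supposed
common child. -/
theorem WellNested.childPos_ne (h : WellNested L) (hpq : p < q) (hp : p < L.length)
    (hq : q < L.length) (hc : c < (subtermAt L p).children.length)
    (hc' : c' < (subtermAt L q).children.length) : childPos L p c ≠ childPos L q c' := by
  intro heq
  have h1 : q < childPos L p c := heq ▸ lt_childPos
  obtain ⟨c₀, hc₀, h2, h3⟩ := exists_child_interval hpq h1
  have hlt : childPos L p c₀ < L.length := h.childPos_lt hp (hc₀.trans hc)
  have h4 := h.endAt_le_endAt hlt h2 (by rwa [← childPos_succ])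
  have h5 := h.childPos_lt_endAt hq hc'
  rw [← childPos_succ] at h4
  have h6 : childPos L p (c₀ + 1) ≤ childPos L p c := childPos_strictMono.monotone hc₀
  omega

theorem WellNested.childPos_inj (h : WellNested L) (hp : p < L.length)
    (hq : q < L.length) (hc : c < (subtermAt L p).children.length)
    (hc' : c' < (subtermAt L q).children.length) (heq : childPos L p c = childPos L q c') :
    p = q ∧ c = c' := by
  rcases lt_trichotomy p q with hpq | rfl | hpq
  · exact absurd heq (h.childPos_ne hpq hp hq hc hc')
  · exact ⟨rfl, childPos_strictMono.injective heq⟩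
  · exact absurd heq.symm (h.childPos_ne hpq hq hp hc' hc)

end Nested

/-! ## Tables for a list of subterms -/

/-- The annotated term for the number of an annotated node. -/
def annAt (L : List OLTerm) (g : ℕ) : AnnTerm :=
  if g % 2 = 0 then AnnTerm.L (subtermAt L (g / 2)) else AnnTerm.R (subtermAt L (g / 2))

/-- The entries of the tables for logical rules: the annotated node `d` has the conclusion `u` and
the second premise `s`. -/
inductive ContextEntry (L : List OLTerm) : ℕ → ℕ → ℕ → Prop
  | default (d : ℕ) : d < 2 * L.length → ContextEntry L d d d
  | negL (p : ℕ) : p < L.length → (subtermAt L p).tag = 3 →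
      ContextEntry L (2 * childPos L p 0) (2 * p + 1) (2 * childPos L p 0)
  | negR (p : ℕ) : p < L.length → (subtermAt L p).tag = 3 →
      ContextEntry L (2 * childPos L p 0 + 1) (2 * p) (2 * childPos L p 0 + 1)
  | meetL (p c : ℕ) : p < L.length → (subtermAt L p).tag = 4 → c < 2 →
      ContextEntry L (2 * childPos L p c) (2 * p) (2 * childPos L p c)
  | meetR (p c : ℕ) : p < L.length → (subtermAt L p).tag = 4 → c < 2 →
      ContextEntry L (2 * childPos L p c + 1) (2 * p + 1) (2 * childPos L p (1 - c) + 1)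
  | joinL (p c : ℕ) : p < L.length → (subtermAt L p).tag = 5 → c < 2 →
      ContextEntry L (2 * childPos L p c) (2 * p) (2 * childPos L p (1 - c))
  | joinR (p c : ℕ) : p < L.length → (subtermAt L p).tag = 5 → c < 2 →
      ContextEntry L (2 * childPos L p c + 1) (2 * p + 1) (2 * childPos L p c + 1)

/-- The entries of the tables `u` and `s` for the children of the node `p`. -/
structure ContextTable (L : List OLTerm) (p : ℕ) (u s : ℕ → ℕ) : Prop where
  neg : (subtermAt L p).tag = 3 →
    u (2 * childPos L p 0) = 2 * p + 1 ∧ s (2 * childPos L p 0) = 2 * childPos L p 0 ∧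
    u (2 * childPos L p 0 + 1) = 2 * p ∧ s (2 * childPos L p 0 + 1) = 2 * childPos L p 0 + 1
  meet : (subtermAt L p).tag = 4 → ∀ c < 2,
    u (2 * childPos L p c) = 2 * p ∧ s (2 * childPos L p c) = 2 * childPos L p c ∧
    u (2 * childPos L p c + 1) = 2 * p + 1 ∧
      s (2 * childPos L p c + 1) = 2 * childPos L p (1 - c) + 1
  join : (subtermAt L p).tag = 5 → ∀ c < 2,
    u (2 * childPos L p c) = 2 * p ∧ s (2 * childPos L p c) = 2 * childPos L p (1 - c) ∧
    u (2 * childPos L p c + 1) = 2 * p + 1 ∧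
      s (2 * childPos L p c + 1) = 2 * childPos L p c + 1

/-- The table `m` describes the nodes from `k` on of the list `L`. -/
structure NodeTable (L : List OLTerm) (k : ℕ) (m : ℕ → ℕ → ℕ) : Prop where
  label : ∀ p < L.length, k ≤ p → m 1 p = (subtermAt L p).tag ∧ m 2 p = (subtermAt L p).letter ∧
    m 3 p = (subtermAt L p).argI ∧ m 4 p = (subtermAt L p).argJ ∧ m 5 p = (subtermAt L p).argK
  arity : ∀ p < L.length, k ≤ p → m 6 p = (subtermAt L p).children.length
  fin : ∀ p < L.length, k ≤ p → m 7 p = endAt L p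
  parent_child : ∀ p < L.length, k ≤ p → ∀ c < (subtermAt L p).children.length,
    m 8 (childPos L p c) = p ∧ m 9 (childPos L p c) = c + 1
  child_parent : ∀ x < L.length, k ≤ x → m 9 x ≠ 0 → m 8 x < L.length ∧
    m 9 x ≤ (subtermAt L (m 8 x)).children.length ∧ childPos L (m 8 x) (m 9 x - 1) = x
  node : ∀ g < 2 * L.length, k ≤ g / 2 → m 12 g = g / 2
  entry : ∀ d < 2 * L.length, k ≤ d / 2 → ContextEntry L d (m 10 d) (m 11 d)
  context : ∀ p < L.length, k ≤ p → ContextTable L p (m 10) (m 11)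

/-- The table `m` describes the axioms in the list `A`. -/
structure AxiomTable (A : List (OLTerm × OLTerm)) (L : List OLTerm) (m : ℕ → ℕ → ℕ) : Prop where
  sound : ∀ d, m 13 d ≠ 0 → ∃ s < L.length, ∃ t < L.length,
    (subtermAt L s, subtermAt L t) ∈ A ∧
      (d = 2 * s + 1 ∧ m 13 d = 2 * t + 1 ∨ d = 2 * t ∧ m 13 d = 2 * s + 2)
  complete : ∀ a ∈ A, ∃ s < L.length, ∃ t < L.length, subtermAt L s = a.1 ∧ subtermAt L t = a.2 ∧
    m 13 (2 * s + 1) = 2 * t + 1 ∧ m 13 (2 * t) = 2 * s + 2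

theorem annAt_even (L : List OLTerm) (p : ℕ) : annAt L (2 * p) = AnnTerm.L (subtermAt L p) := by
  simp [annAt]

theorem annAt_odd (L : List OLTerm) (p : ℕ) :
    annAt L (2 * p + 1) = AnnTerm.R (subtermAt L p) := by
  rw [annAt, if_neg (by omega)]
  congr 2
  omega

theorem annAt_eq_L {L : List OLTerm} {g : ℕ} {s : OLTerm} (h : annAt L g = AnnTerm.L s) :
    ∃ p, g = 2 * p ∧ subtermAt L p = s := by
  rw [annAt] at h
  split_ifs at h with h'
  exact ⟨g / 2, by omega, AnnTerm.L.inj h⟩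

theorem annAt_eq_R {L : List OLTerm} {g : ℕ} {s : OLTerm} (h : annAt L g = AnnTerm.R s) :
    ∃ p, g = 2 * p + 1 ∧ subtermAt L p = s := by
  rw [annAt] at h
  split_ifs at h with h'
  exact ⟨g / 2, by omega, AnnTerm.R.inj h⟩

theorem OLTerm.tag_eq_three {t : OLTerm} (h : t.tag = 3) : ∃ s, t = neg s := by
  cases t <;> simp [tag] at h ⊢

theorem OLTerm.tag_eq_four {t : OLTerm} (h : t.tag = 4) : ∃ s s', t = meet s s' := by
  cases t <;> simp [tag] at h ⊢

theorem OLTerm.tag_eq_five {t : OLTerm} (h : t.tag = 5) : ∃ s s', t = join s s' := by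
  cases t <;> simp [tag] at h ⊢

theorem WellNested.subtermAt_child {L : List OLTerm} (h : WellNested L) {p c : ℕ} {s : OLTerm}
    (hp : p < L.length) (hc : (subtermAt L p).children[c]? = some s) :
    subtermAt L (childPos L p c) = s ∧ childPos L p c < L.length := by
  obtain ⟨hlt, rfl⟩ := List.getElem?_eq_some_iff.1 hc
  exact ⟨h.subtermAt_childPos hp hlt, h.childPos_lt hp hlt⟩

section Children

variable {f i j k : ℕ} {x : Fin i → OLTerm} {y : Fin j → OLTerm} {z : Fin k → OLTerm}

theorem OLTerm.children_func_inv (a : Fin i) :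
    (func f i j k x y z).children[(a : ℕ)]? = some (x a) := by
  simp [children, List.getElem?_append]

theorem OLTerm.children_func_cov (b : Fin j) :
    (func f i j k x y z).children[i + (b : ℕ)]? = some (y b) := by
  simp [children, List.getElem?_append]

theorem OLTerm.children_func_contra (c : Fin k) :
    (func f i j k x y z).children[i + j + (c : ℕ)]? = some (z c) := by
  simp only [children, List.getElem?_append, List.length_append, List.length_ofFn,
    List.getElem?_ofFn]
  rw [if_neg (by omega), dif_pos (by omega)]
  congr 3
  omega

end Children

/-- The rule for function symbols, with the connectives regarded as monotone functions. -/
theorem CFPlus.congruence {A : List (OLTerm × OLTerm)} {s t : OLTerm} (h1 : s.tag = t.tag)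
    (h2 : s.letter = t.letter) (h3 : s.argI = t.argI) (h4 : s.argJ = t.argJ)
    (h5 : s.argK = t.argK)
    (hL : ∀ (c : ℕ) (s' t' : OLTerm), s.children[c]? = some s' → t.children[c]? = some t' →
      c < s.argI + s.argJ → CFPlus A (AnnTerm.L s') (AnnTerm.R t'))
    (hR : ∀ (c : ℕ) (s' t' : OLTerm), s.children[c]? = some s' → t.children[c]? = some t' →
      (c < s.argI ∨ s.argI + s.argJ ≤ c) → CFPlus A (AnnTerm.R s') (AnnTerm.L t')) :
    CFPlus A (AnnTerm.L s) (AnnTerm.R t) := by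
  cases s <;> cases t <;> simp only [OLTerm.tag, OLTerm.letter, OLTerm.argI, OLTerm.argJ,
    OLTerm.argK, OfNat.ofNat_ne_zero, OfNat.zero_ne_ofNat, OfNat.ofNat_ne_one, OfNat.one_ne_ofNat,
    zero_ne_one, one_ne_zero, Nat.reduceEqDiff] at h1 h2 h3 h4 h5 hL hR
  case var.var => subst h2; exact .hyp _
  case bot.bot => exact .hyp _
  case top.top => exact .hyp _
  case neg.neg s t =>
    have := hR 0 s t rfl rfl (by omega)
    exact this.rightNot.swap.leftNot.swap
  case meet.meet s s' t t' =>
    have e1 := hL 0 s t rfl rfl (by omega)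
    have e2 := hL 1 s' t' rfl rfl (by omega)
    exact .rightAnd (e1.swap.leftAnd₁.swap) (e2.swap.leftAnd₂.swap)
  case join.join s s' t t' =>
    have e1 := hL 0 s t rfl rfl (by omega)
    have e2 := hL 1 s' t' rfl rfl (by omega)
    exact (CFPlus.leftOr e1.rightOr₁.swap e2.rightOr₂.swap).swap
  case func.func f i j k x y z f' i' j' k' x' y' z' =>
    subst h2 h3 h4 h5
    refine .funcRule f i j k (fun a => ?_) (fun a => ?_) (fun b => ?_) (fun c => ?_)
    · exact hL a _ _ (OLTerm.children_func_inv a) (OLTerm.children_func_inv a) (by omega)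
    · exact (hR a _ _ (OLTerm.children_func_inv a) (OLTerm.children_func_inv a) (by omega)).swap
    · exact hL _ _ _ (OLTerm.children_func_cov b) (OLTerm.children_func_cov b) (by omega)
    · exact (hR _ _ _ (OLTerm.children_func_contra c) (OLTerm.children_func_contra c)
        (by omega)).swap

/-! ### Saturation on nodes captures provability -/

section Tables

variable {A : List (OLTerm × OLTerm)} {L : List OLTerm} {m : ℕ → ℕ → ℕ}

/-- Each entry is an instance of a logical rule with arbitrary context, except the default one,
which concludes its own premise. -/
theorem ContextEntry.sound (hL : WellNested L) {d u s : ℕ} (h : ContextEntry L d u s) :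
    (u < 2 * L.length ∧ s < 2 * L.length) ∧ ∀ Γ, CFPlus A Γ (annAt L d) → CFPlus A Γ (annAt L s) →
      CFPlus A Γ (annAt L u) := by
  have two : ∀ c < 2, c = 0 ∨ c = 1 := by omega
  cases h with
  | default d hd => exact ⟨⟨hd, hd⟩, fun Γ h _ => h⟩
  | negL p hp ht =>
    obtain ⟨s, hs⟩ := OLTerm.tag_eq_three ht
    obtain ⟨e0, l0⟩ := hL.subtermAt_child hp (c := 0) (by rw [hs]; rfl)
    refine ⟨by omega, fun Γ h _ => ?_⟩
    rw [annAt_even, e0] at h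
    rw [annAt_odd, hs]
    exact h.rightNot
  | negR p hp ht =>
    obtain ⟨s, hs⟩ := OLTerm.tag_eq_three ht
    obtain ⟨e0, l0⟩ := hL.subtermAt_child hp (c := 0) (by rw [hs]; rfl)
    refine ⟨by omega, fun Γ h _ => ?_⟩
    rw [annAt_odd, e0] at h
    rw [annAt_even, hs]
    exact h.leftNot
  | meetL p c hp ht hc =>
    obtain ⟨s, s', hs⟩ := OLTerm.tag_eq_four ht
    obtain ⟨e0, l0⟩ := hL.subtermAt_child hp (c := 0) (by rw [hs]; rfl)
    obtain ⟨e1, l1⟩ := hL.subtermAt_child hp (c := 1) (by rw [hs]; rfl)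
    rcases two c hc with rfl | rfl
    · refine ⟨by omega, fun Γ h _ => ?_⟩
      rw [annAt_even, e0] at h
      rw [annAt_even, hs]
      exact h.leftAnd₁
    · refine ⟨by omega, fun Γ h _ => ?_⟩
      rw [annAt_even, e1] at h
      rw [annAt_even, hs]
      exact h.leftAnd₂
  | meetR p c hp ht hc =>
    obtain ⟨s, s', hs⟩ := OLTerm.tag_eq_four ht
    obtain ⟨e0, l0⟩ := hL.subtermAt_child hp (c := 0) (by rw [hs]; rfl)
    obtain ⟨e1, l1⟩ := hL.subtermAt_child hp (c := 1) (by rw [hs]; rfl)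
    rcases two c hc with rfl | rfl
    · refine ⟨⟨by omega, by simpa using by omega⟩, fun Γ h h' => ?_⟩
      rw [annAt_odd, e0] at h
      rw [annAt_odd, e1] at h'
      rw [annAt_odd, hs]
      exact h.rightAnd h'
    · refine ⟨⟨by omega, by simpa using by omega⟩, fun Γ h h' => ?_⟩
      rw [annAt_odd, e1] at h
      rw [annAt_odd, e0] at h'
      rw [annAt_odd, hs]
      exact h'.rightAnd h
  | joinL p c hp ht hc =>
    obtain ⟨s, s', hs⟩ := OLTerm.tag_eq_five ht
    obtain ⟨e0, l0⟩ := hL.subtermAt_child hp (c := 0) (by rw [hs]; rfl)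
    obtain ⟨e1, l1⟩ := hL.subtermAt_child hp (c := 1) (by rw [hs]; rfl)
    rcases two c hc with rfl | rfl
    · refine ⟨⟨by omega, by simpa using by omega⟩, fun Γ h h' => ?_⟩
      rw [annAt_even, e0] at h
      rw [annAt_even, e1] at h'
      rw [annAt_even, hs]
      exact h.leftOr h'
    · refine ⟨⟨by omega, by simpa using by omega⟩, fun Γ h h' => ?_⟩
      rw [annAt_even, e1] at h
      rw [annAt_even, e0] at h'
      rw [annAt_even, hs]
      exact h'.leftOr h
  | joinR p c hp ht hc =>
    obtain ⟨s, s', hs⟩ := OLTerm.tag_eq_five ht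
    obtain ⟨e0, l0⟩ := hL.subtermAt_child hp (c := 0) (by rw [hs]; rfl)
    obtain ⟨e1, l1⟩ := hL.subtermAt_child hp (c := 1) (by rw [hs]; rfl)
    rcases two c hc with rfl | rfl
    · refine ⟨by omega, fun Γ h _ => ?_⟩
      rw [annAt_odd, e0] at h
      rw [annAt_odd, hs]
      exact h.rightOr₁
    · refine ⟨by omega, fun Γ h _ => ?_⟩
      rw [annAt_odd, e1] at h
      rw [annAt_odd, hs]
      exact h.rightOr₂

theorem NodeTable.childAt_eq (hL : WellNested L) (h : NodeTable L 0 m) {p : ℕ}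
    (hp : p < L.length) {c : ℕ} (hc : c ≤ (subtermAt L p).children.length) :
    childAt m p c = childPos L p c := by
  induction c with
  | zero => rfl
  | succ c ih =>
    rw [childAt_succ, childPos_succ, ih (by omega),
      h.fin _ (hL.childPos_lt hp (by omega)) (Nat.zero_le _)]

theorem OLTerm.children_length_le {L : List OLTerm} (hL : WellNested L) {p : ℕ}
    (hp : p < L.length) : (subtermAt L p).children.length ≤ L.length := by
  have h1 := hL.endAt_le hp
  have h2 := (subtermAt L p).children_length_lt_size
  rw [endAt] at h1
  omega

theorem NodeTable.forestTable (hL : WellNested L) (h : NodeTable L 0 m) (hA : AxiomTable A L m) :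
    ForestTable L.length m where
  arity p hp := by
    obtain ⟨-, -, h3, h4, h5⟩ := h.label p hp (Nat.zero_le _)
    rw [h.arity p hp (Nat.zero_le _), h3, h4, h5, OLTerm.length_children]
  arity_le p hp := by
    rw [h.arity p hp (Nat.zero_le _)]
    exact OLTerm.children_length_le hL hp
  child_lt p hp c hc := by
    rw [h.arity p hp (Nat.zero_le _)] at hc
    rw [h.childAt_eq hL hp hc.le]
    exact hL.childPos_lt hp hc
  parent_child p hp c hc := by
    rw [h.arity p hp (Nat.zero_le _)] at hc
    rw [h.childAt_eq hL hp hc.le]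
    exact h.parent_child p hp (Nat.zero_le _) c hc
  child_parent x hx hx0 := by
    obtain ⟨h1, h2, h3⟩ := h.child_parent x hx (Nat.zero_le _) hx0
    refine ⟨h1, ?_, ?_⟩
    · rwa [h.arity _ h1 (Nat.zero_le _)]
    · rwa [h.childAt_eq hL h1 (by omega)]
  node g hg := h.node g hg (Nat.zero_le _)
  up_lt g hg := ((h.entry g hg (Nat.zero_le _)).sound (A := []) hL).1.1
  sib_lt g hg := ((h.entry g hg (Nat.zero_le _)).sound (A := []) hL).1.2
  partner_lt g hg := by
    by_cases h0 : m 13 g = 0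
    · omega
    · obtain ⟨s, hs, t, ht, -, h1⟩ := hA.sound g h0
      omega

/-- This is the soundness of the algorithm: its steps are derivable, those for equally labelled
connectives by `CFPlus.congruence`. -/
theorem NodeTable.stepClosed (hL : WellNested L) (h : NodeTable L 0 m) (hA : AxiomTable A L m) :
    StepClosed L.length m fun g d => CFPlus A (annAt L g) (annAt L d) where
  symm g d := CFPlus.swap
  bot p hp ht := by
    rw [(h.label p hp (Nat.zero_le _)).1] at ht
    have : subtermAt L p = .bot := by
      cases hs : subtermAt L p <;> simp [hs, OLTerm.tag] at ht ⊢
    rw [annAt_even, this]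
    exact .leftBot _
  top p hp ht := by
    rw [(h.label p hp (Nat.zero_le _)).1] at ht
    have : subtermAt L p = .top := by
      cases hs : subtermAt L p <;> simp [hs, OLTerm.tag] at ht ⊢
    rw [annAt_odd, this]
    exact .rightTop _
  replace g hg hgg e he := .replace _ hgg
  context g hg d hd h1 h2 := ((h.entry d hd (Nat.zero_le _)).sound hL).2 _ h1 h2
  cut g hg d hd c hc e he hdc h1 h2 := by
    obtain ⟨s, hs, t, ht, hm, ⟨rfl, h4⟩ | ⟨rfl, h4⟩⟩ := hA.sound d (by omega)
    · obtain rfl : c = 2 * t := by omega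
      rw [annAt_odd] at h1
      rw [annAt_even] at h2
      exact .axiomCut hm h1 h2
    -- The fact ends in the right side of the axiom, so the two premises of the axiom rule occur in
    -- the opposite order.
    · obtain rfl : c = 2 * s + 1 := by omega
      rw [annAt_even] at h1
      rw [annAt_odd] at h2
      exact (CFPlus.axiomCut hm h2.swap h1.swap).swap
  cong p hp q hq hl hc := by
    obtain ⟨a1, a2, a3, a4, a5⟩ := h.label p hp (Nat.zero_le _)
    obtain ⟨b1, b2, b3, b4, b5⟩ := h.label q hq (Nat.zero_le _)
    obtain ⟨l1, l2, l3, l4, l5⟩ := hl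
    rw [h.arity p hp (Nat.zero_le _)] at hc
    rw [annAt_even, annAt_odd]
    have key : ∀ (c : ℕ) (s t : OLTerm), (subtermAt L p).children[c]? = some s →
        (subtermAt L q).children[c]? = some t → (c < m 3 p + m 4 p →
          CFPlus A (AnnTerm.L s) (AnnTerm.R t)) ∧ (c < m 3 p ∨ m 3 p + m 4 p ≤ c →
          CFPlus A (AnnTerm.R s) (AnnTerm.L t)) := by
      intro c s t hs ht
      have hcp := (List.getElem?_eq_some_iff.1 hs).1
      have hcq := (List.getElem?_eq_some_iff.1 ht).1
      have := hc c hcp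
      rwa [ArgPremises, h.childAt_eq hL hp hcp.le, h.childAt_eq hL hq hcq.le, annAt_even, annAt_odd,
        annAt_even, annAt_odd, (hL.subtermAt_child hp hs).1, (hL.subtermAt_child hq ht).1] at this
    refine CFPlus.congruence (by omega) (by omega) (by omega) (by omega) (by omega) ?_ ?_
    · intro c s t hs ht hlt
      exact (key c s t hs ht).1 (by omega)
    · intro c s t hs ht hlt
      exact (key c s t hs ht).2 (by omega)

section Complete

variable {X : ℕ → ℕ → Prop}

/-- Equal terms have equal labels and equal children, so congruence applies inductively. Symmetry of
`X` supplies the premises with annotations `R`, `L`. -/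
theorem NodeTable.rel_of_eq (hL : WellNested L) (h : NodeTable L 0 m)
    (hX : RuleClosed L.length m X X) (hs : ∀ g d, X g d → X d g) (S : OLTerm) :
    ∀ p < L.length, ∀ q < L.length, subtermAt L p = S → subtermAt L q = S →
      X (2 * p) (2 * q + 1) := by
  induction S using OLTerm.child_induction with
  | h S ih =>
    intro p hp q hq ep eq
    obtain ⟨a1, a2, a3, a4, a5⟩ := h.label p hp (Nat.zero_le _)
    obtain ⟨b1, b2, b3, b4, b5⟩ := h.label q hq (Nat.zero_le _)
    rw [ep] at a1 a2 a3 a4 a5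
    rw [eq] at b1 b2 b3 b4 b5
    refine hX.cong p hp q hq ⟨by omega, by omega, by omega, by omega, by omega⟩ fun c hc => ?_
    rw [h.arity p hp (Nat.zero_le _), ep] at hc
    have e := List.getElem?_eq_getElem hc
    rw [ArgPremises, h.childAt_eq hL hp (by rw [ep]; exact hc.le),
      h.childAt_eq hL hq (by rw [eq]; exact hc.le)]
    obtain ⟨s1, l1⟩ := hL.subtermAt_child hp (by rw [ep]; exact e)
    obtain ⟨s2, l2⟩ := hL.subtermAt_child hq (by rw [eq]; exact e)
    have hmem := List.getElem_mem hc
    exact ⟨fun _ => ih _ hmem _ l1 _ l2 s1 s2, fun _ => hs _ _ (ih _ hmem _ l2 _ l1 s2 s1)⟩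

/-- The claim is made for all nodes that carry the two terms. In the induction the premises can then
be placed at the children of the given nodes, or at the nodes of an axiom, so the derivation never
leaves the table. -/
theorem NodeTable.complete (hL : WellNested L) (h : NodeTable L 0 m) (hA : AxiomTable A L m)
    (hX : RuleClosed L.length m X X) (hs : ∀ g d, X g d → X d g) {Γ Δ : AnnTerm}
    (hd : CFPlus A Γ Δ) : ∀ g < 2 * L.length, ∀ d < 2 * L.length, annAt L g = Γ →
      annAt L d = Δ → X g d := by
  induction hd with
  | swap _ ih => exact fun g hg d hd h1 h2 => hs _ _ (ih d hd g hg h2 h1)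
  | hyp S =>
    intro g hg d hd h1 h2
    obtain ⟨p, rfl, e1⟩ := annAt_eq_L h1
    obtain ⟨q, rfl, e2⟩ := annAt_eq_R h2
    exact h.rel_of_eq hL hX hs S p (by omega) q (by omega) e1 e2
  | replace Δ _ ih =>
    intro g hg d hd h1 _
    exact hX.replace g hg (ih g hg g hg h1 h1) d hd
  | leftBot Δ =>
    intro g hg d hd h1 _
    obtain ⟨p, rfl, e1⟩ := annAt_eq_L h1
    have := (h.label p (by omega) (Nat.zero_le _)).1
    rw [e1] at this
    exact hX.replace _ hg (hX.bot p (by omega) this) d hd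
  | rightTop Γ =>
    intro g hg d hd _ h2
    obtain ⟨q, rfl, e2⟩ := annAt_eq_R h2
    have := (h.label q (by omega) (Nat.zero_le _)).1
    rw [e2] at this
    exact hs _ _ (hX.replace _ hd (hX.top q (by omega) this) g hg)
  | leftAnd₁ _ ih =>
    intro g hg d hd h1 h2
    obtain ⟨p, rfl, e⟩ := annAt_eq_L h2
    obtain ⟨e0, l0⟩ := hL.subtermAt_child (p := p) (c := 0) (by omega) (by rw [e]; rfl)
    have hc := (h.context p (by omega) (Nat.zero_le _)).meet (by rw [e]; rfl) 0 (by norm_num)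
    have := ih g hg (2 * childPos L p 0) (by omega) h1 (by rw [annAt_even, e0])
    have key := hX.context g hg (2 * childPos L p 0) (by omega)
    rw [hc.2.1, hc.1] at key
    -- A rule with one premise: the second premise is the same fact.
    exact key (by simp [hc]) rfl this this
  | leftAnd₂ _ ih =>
    intro g hg d hd h1 h2
    obtain ⟨p, rfl, e⟩ := annAt_eq_L h2
    obtain ⟨e0, l0⟩ := hL.subtermAt_child (p := p) (c := 1) (by omega) (by rw [e]; rfl)
    have hc := (h.context p (by omega) (Nat.zero_le _)).meet (by rw [e]; rfl) 1 (by norm_num)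
    have := ih g hg (2 * childPos L p 1) (by omega) h1 (by rw [annAt_even, e0])
    have key := hX.context g hg (2 * childPos L p 1) (by omega)
    rw [hc.2.1, hc.1] at key
    exact key (by simp [hc]) rfl this this
  | rightAnd _ _ ih₁ ih₂ =>
    intro g hg d hd h1 h2
    obtain ⟨p, rfl, e⟩ := annAt_eq_R h2
    obtain ⟨e0, l0⟩ := hL.subtermAt_child (p := p) (c := 0) (by omega) (by rw [e]; rfl)
    obtain ⟨e1, l1⟩ := hL.subtermAt_child (p := p) (c := 1) (by omega) (by rw [e]; rfl)
    have hc := (h.context p (by omega) (Nat.zero_le _)).meet (by rw [e]; rfl)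
    have hc0 := hc 0 (by norm_num)
    have hc1 := hc 1 (by norm_num)
    have t0 := ih₁ g hg (2 * childPos L p 0 + 1) (by omega) h1 (by rw [annAt_odd, e0])
    have t1 := ih₂ g hg (2 * childPos L p 1 + 1) (by omega) h1 (by rw [annAt_odd, e1])
    have key := hX.context g hg (2 * childPos L p 0 + 1) (by omega)
    rw [hc0.2.2.2, hc0.2.2.1, hc1.2.2.2, hc1.2.2.1] at key
    exact key rfl rfl t0 t1
  | leftOr _ _ ih₁ ih₂ =>
    intro g hg d hd h1 h2
    obtain ⟨p, rfl, e⟩ := annAt_eq_L h2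
    obtain ⟨e0, l0⟩ := hL.subtermAt_child (p := p) (c := 0) (by omega) (by rw [e]; rfl)
    obtain ⟨e1, l1⟩ := hL.subtermAt_child (p := p) (c := 1) (by omega) (by rw [e]; rfl)
    have hc := (h.context p (by omega) (Nat.zero_le _)).join (by rw [e]; rfl)
    have hc0 := hc 0 (by norm_num)
    have hc1 := hc 1 (by norm_num)
    have t0 := ih₁ g hg (2 * childPos L p 0) (by omega) h1 (by rw [annAt_even, e0])
    have t1 := ih₂ g hg (2 * childPos L p 1) (by omega) h1 (by rw [annAt_even, e1])
    have key := hX.context g hg (2 * childPos L p 0) (by omega)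
    rw [hc0.2.1, hc0.1, hc1.2.1, hc1.1] at key
    exact key rfl rfl t0 t1
  | rightOr₁ _ ih =>
    intro g hg d hd h1 h2
    obtain ⟨p, rfl, e⟩ := annAt_eq_R h2
    obtain ⟨e0, l0⟩ := hL.subtermAt_child (p := p) (c := 0) (by omega) (by rw [e]; rfl)
    have hc := (h.context p (by omega) (Nat.zero_le _)).join (by rw [e]; rfl) 0 (by norm_num)
    have := ih g hg (2 * childPos L p 0 + 1) (by omega) h1 (by rw [annAt_odd, e0])
    have key := hX.context g hg (2 * childPos L p 0 + 1) (by omega)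
    rw [hc.2.2.2, hc.2.2.1] at key
    exact key (by simp [hc]) rfl this this
  | rightOr₂ _ ih =>
    intro g hg d hd h1 h2
    obtain ⟨p, rfl, e⟩ := annAt_eq_R h2
    obtain ⟨e0, l0⟩ := hL.subtermAt_child (p := p) (c := 1) (by omega) (by rw [e]; rfl)
    have hc := (h.context p (by omega) (Nat.zero_le _)).join (by rw [e]; rfl) 1 (by norm_num)
    have := ih g hg (2 * childPos L p 1 + 1) (by omega) h1 (by rw [annAt_odd, e0])
    have key := hX.context g hg (2 * childPos L p 1 + 1) (by omega)
    rw [hc.2.2.2, hc.2.2.1] at key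
    exact key (by simp [hc]) rfl this this
  | leftNot _ ih =>
    intro g hg d hd h1 h2
    obtain ⟨p, rfl, e⟩ := annAt_eq_L h2
    obtain ⟨e0, l0⟩ := hL.subtermAt_child (p := p) (c := 0) (by omega) (by rw [e]; rfl)
    have hc := (h.context p (by omega) (Nat.zero_le _)).neg (by rw [e]; rfl)
    have := ih g hg (2 * childPos L p 0 + 1) (by omega) h1 (by rw [annAt_odd, e0])
    have key := hX.context g hg (2 * childPos L p 0 + 1) (by omega)
    rw [hc.2.2.2, hc.2.2.1] at key
    exact key (by simp [hc]) rfl this this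
  | rightNot _ ih =>
    intro g hg d hd h1 h2
    obtain ⟨p, rfl, e⟩ := annAt_eq_R h2
    obtain ⟨e0, l0⟩ := hL.subtermAt_child (p := p) (c := 0) (by omega) (by rw [e]; rfl)
    have hc := (h.context p (by omega) (Nat.zero_le _)).neg (by rw [e]; rfl)
    have := ih g hg (2 * childPos L p 0) (by omega) h1 (by rw [annAt_even, e0])
    have key := hX.context g hg (2 * childPos L p 0) (by omega)
    rw [hc.2.1, hc.1] at key
    exact key (by simp [hc]) rfl this this
  | funcRule f i j k _ _ _ _ ih₁ ih₂ ih₃ ih₄ =>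
    intro g hg d hd h1 h2
    obtain ⟨p, rfl, e1⟩ := annAt_eq_L h1
    obtain ⟨q, rfl, e2⟩ := annAt_eq_R h2
    have hp : p < L.length := by omega
    have hq : q < L.length := by omega
    obtain ⟨a1, a2, a3, a4, a5⟩ := h.label p hp (Nat.zero_le _)
    obtain ⟨b1, b2, b3, b4, b5⟩ := h.label q hq (Nat.zero_le _)
    rw [e1] at a1 a2 a3 a4 a5
    rw [e2] at b1 b2 b3 b4 b5
    simp only [OLTerm.tag, OLTerm.letter, OLTerm.argI, OLTerm.argJ, OLTerm.argK] at *
    refine hX.cong p hp q hq ⟨by omega, by omega, by omega, by omega, by omega⟩ fun c hc => ?_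
    have har := h.arity p hp (Nat.zero_le _)
    have har' := h.arity q hq (Nat.zero_le _)
    have hlen : (subtermAt L p).children.length = i + j + k := by
      rw [e1, OLTerm.length_children]; rfl
    have hlen' : (subtermAt L q).children.length = i + j + k := by
      rw [e2, OLTerm.length_children]; rfl
    rw [ArgPremises, h.childAt_eq hL hp (by omega), h.childAt_eq hL hq (by omega), a3, a4]
    rcases lt_or_ge c i with hci | hci
    · obtain ⟨s1, l1⟩ := hL.subtermAt_child hp
        (by rw [e1]; exact OLTerm.children_func_inv ⟨c, hci⟩)
      obtain ⟨s2, l2⟩ := hL.subtermAt_child hq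
        (by rw [e2]; exact OLTerm.children_func_inv ⟨c, hci⟩)
      simp only at s1 l1 s2 l2
      exact ⟨fun _ => ih₁ ⟨c, hci⟩ _ (by omega) _ (by omega) (by rw [annAt_even, s1])
          (by rw [annAt_odd, s2]),
        fun _ => hs _ _ (ih₂ ⟨c, hci⟩ _ (by omega) _ (by omega) (by rw [annAt_even, s2])
          (by rw [annAt_odd, s1]))⟩
    rcases lt_or_ge c (i + j) with hcj | hcj
    · obtain ⟨b, rfl⟩ := Nat.exists_eq_add_of_le hci
      obtain ⟨s1, l1⟩ := hL.subtermAt_child hp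
        (by rw [e1]; exact OLTerm.children_func_cov ⟨b, by omega⟩)
      obtain ⟨s2, l2⟩ := hL.subtermAt_child hq
        (by rw [e2]; exact OLTerm.children_func_cov ⟨b, by omega⟩)
      simp only at s1 l1 s2 l2
      exact ⟨fun _ => ih₃ ⟨b, by omega⟩ _ (by omega) _ (by omega) (by rw [annAt_even, s1])
          (by rw [annAt_odd, s2]), fun _ => by omega⟩
    · obtain ⟨b, rfl⟩ := Nat.exists_eq_add_of_le hcj
      obtain ⟨s1, l1⟩ := hL.subtermAt_child hp
        (by rw [e1]; exact OLTerm.children_func_contra ⟨b, by omega⟩)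
      obtain ⟨s2, l2⟩ := hL.subtermAt_child hq
        (by rw [e2]; exact OLTerm.children_func_contra ⟨b, by omega⟩)
      simp only at s1 l1 s2 l2
      exact ⟨fun _ => by omega, fun _ => hs _ _ (ih₄ ⟨b, by omega⟩ _ (by omega) _ (by omega)
        (by rw [annAt_even, s2]) (by rw [annAt_odd, s1]))⟩
  | axiomCut hm _ _ ih₁ ih₂ =>
    intro g hg d hd h1 h2
    obtain ⟨s, hs', t, ht, e1, e2, c1, c2⟩ := hA.complete _ hm
    have x1 := ih₁ g hg (2 * s + 1) (by omega) h1 (by rw [annAt_odd, e1])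
    have x2 := ih₂ (2 * t) (by omega) d hd (by rw [annAt_even, e2]) h2
    exact hX.cut g hg (2 * s + 1) (by omega) (2 * t) (by omega) d hd c1 c2 x1 x2

end Complete

end Tables

/-! ## Computing the tables -/

theorem ContextEntry.of_table {L : List OLTerm} {p : ℕ} {u s : ℕ → ℕ} (hp : p < L.length)
    (h : ContextTable L p u s) {d : ℕ}
    (ht : (subtermAt L p).tag = 3 ∨ (subtermAt L p).tag = 4 ∨ (subtermAt L p).tag = 5)
    {c : ℕ} (hc : c < (subtermAt L p).children.length) (hd : d / 2 = childPos L p c) :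
    ContextEntry L d (u d) (s d) := by
  have hd' : d = 2 * childPos L p c ∨ d = 2 * childPos L p c + 1 := by omega
  rcases ht with ht | ht | ht
  · obtain ⟨a, ha⟩ := OLTerm.tag_eq_three ht
    rw [ha] at hc
    obtain rfl : c = 0 := Nat.lt_one_iff.1 hc
    obtain ⟨h1, h2, h3, h4⟩ := h.neg ht
    rcases hd' with rfl | rfl
    · rw [h1, h2]
      exact .negL p hp ht
    · rw [h3, h4]
      exact .negR p hp ht
  · obtain ⟨a, b, ha⟩ := OLTerm.tag_eq_four ht
    rw [ha] at hc
    obtain ⟨h1, h2, h3, h4⟩ := h.meet ht c hc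
    rcases hd' with rfl | rfl
    · rw [h1, h2]
      exact .meetL p c hp ht hc
    · rw [h3, h4]
      exact .meetR p c hp ht hc
  · obtain ⟨a, b, ha⟩ := OLTerm.tag_eq_five ht
    rw [ha] at hc
    obtain ⟨h1, h2, h3, h4⟩ := h.join ht c hc
    rcases hd' with rfl | rfl
    · rw [h1, h2]
      exact .joinL p c hp ht hc
    · rw [h3, h4]
      exact .joinR p c hp ht hc

/-- The tables `m'` arise from the tables `m` by entering the node `p`. -/
structure EntersNode (L : List OLTerm) (p : ℕ) (m m' : ℕ → ℕ → ℕ) : Prop where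
  tag : m' 1 = Function.update (m 1) p (subtermAt L p).tag
  letter : m' 2 = Function.update (m 2) p (subtermAt L p).letter
  argI : m' 3 = Function.update (m 3) p (subtermAt L p).argI
  argJ : m' 4 = Function.update (m 4) p (subtermAt L p).argJ
  argK : m' 5 = Function.update (m 5) p (subtermAt L p).argK
  arity : m' 6 = Function.update (m 6) p (subtermAt L p).children.length
  fin : m' 7 = Function.update (m 7) p (endAt L p)
  parent : ∀ c < (subtermAt L p).children.length,
    m' 8 (childPos L p c) = p ∧ m' 9 (childPos L p c) = c + 1
  root : m' 9 p = 0
  parent_frame : ∀ x ≠ p, (∀ c < (subtermAt L p).children.length, x ≠ childPos L p c) →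
    m' 8 x = m 8 x ∧ m' 9 x = m 9 x
  node : m' 12 = Function.update (Function.update (m 12) (2 * p) p) (2 * p + 1) p
  default : ∀ d, d / 2 = p → m' 10 d = d ∧ m' 11 d = d
  context : ContextTable L p (m' 10) (m' 11)
  context_frame : ∀ d, d / 2 ≠ p →
    ((subtermAt L p).tag = 3 ∨ (subtermAt L p).tag = 4 ∨ (subtermAt L p).tag = 5 →
      ∀ c < (subtermAt L p).children.length, d / 2 ≠ childPos L p c) →
    m' 10 d = m 10 d ∧ m' 11 d = m 11 d

/-- Entering `p` writes only to `p` and its children. Different nodes have no child in common and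
children come after their parents, so the entries made for later nodes survive. -/
theorem NodeTable.step {L : List OLTerm} (hL : WellNested L) {p : ℕ} (hp : p < L.length)
    {m m' : ℕ → ℕ → ℕ} (h : NodeTable L (p + 1) m) (hm : EntersNode L p m m') :
    NodeTable L p m' where
  label q hq hpq := by
    rw [hm.tag, hm.letter, hm.argI, hm.argJ, hm.argK]
    rcases eq_or_ne q p with rfl | hne
    · simp
    · simp only [Function.update_of_ne hne]
      exact h.label q hq (by omega)
  arity q hq hpq := by
    rw [hm.arity]
    rcases eq_or_ne q p with rfl | hne
    · simp
    · rw [Function.update_of_ne hne]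
      exact h.arity q hq (by omega)
  fin q hq hpq := by
    rw [hm.fin]
    rcases eq_or_ne q p with rfl | hne
    · simp
    · rw [Function.update_of_ne hne]
      exact h.fin q hq (by omega)
  parent_child q hq hpq c hc := by
    rcases eq_or_ne q p with rfl | hne
    · exact hm.parent c hc
    · have h1 := h.parent_child q hq (by omega) c hc
      have hlt : q < childPos L q c := lt_childPos
      obtain ⟨e1, e2⟩ := hm.parent_frame (childPos L q c) (by omega) fun c' hc' heq =>
        hne (hL.childPos_inj hq hp hc hc' heq).1
      rwa [e1, e2]
  child_parent x hx hpx h0 := by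
    by_cases hx' : ∃ c < (subtermAt L p).children.length, x = childPos L p c
    · obtain ⟨c, hc, rfl⟩ := hx'
      obtain ⟨e1, e2⟩ := hm.parent c hc
      rw [e1, e2]
      exact ⟨hp, hc, rfl⟩
    · push Not at hx'
      rcases eq_or_ne x p with rfl | hne
      -- The parent of `p`, if there is one, comes earlier and is not yet entered, so `p` counts as
      -- a root for the moment.
      · exact absurd hm.root h0
      · obtain ⟨e1, e2⟩ := hm.parent_frame x hne hx'
        rw [e2] at h0
        rw [e1, e2]
        exact h.child_parent x hx (by omega) h0
  node g hg hpg := by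
    rw [hm.node]
    simp only [Function.update_apply]
    split_ifs
    · omega
    · omega
    · exact h.node g hg (by omega)
  entry d hd hpd := by
    by_cases hdp : d / 2 = p
    · obtain ⟨e1, e2⟩ := hm.default d hdp
      rw [e1, e2]
      exact .default d hd
    · by_cases hx : ((subtermAt L p).tag = 3 ∨ (subtermAt L p).tag = 4 ∨
          (subtermAt L p).tag = 5) ∧ ∃ c < (subtermAt L p).children.length, d / 2 = childPos L p c
      · obtain ⟨ht, c, hc, hdc⟩ := hx
        exact .of_table hp hm.context ht hc hdc
      · obtain ⟨e1, e2⟩ := hm.context_frame d hdp fun ht c hc hdc => hx ⟨ht, c, hc, hdc⟩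
        rw [e1, e2]
        exact h.entry d hd (by omega)
  context q hq hpq := by
    rcases eq_or_ne q p with rfl | hne
    · exact hm.context
    · have h1 := h.context q hq (by omega)
      have key : ∀ c < (subtermAt L q).children.length, ∀ d, d / 2 = childPos L q c →
          m' 10 d = m 10 d ∧ m' 11 d = m 11 d := by
        intro c hc d hd
        have hlt : q < childPos L q c := lt_childPos
        refine hm.context_frame d (by omega) fun _ c' hc' heq => ?_
        exact hne (hL.childPos_inj hq hp hc hc' (hd.symm.trans heq)).1
      refine ⟨fun ht => ?_, fun ht c hc => ?_, fun ht c hc => ?_⟩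
      · obtain ⟨a, ha⟩ := OLTerm.tag_eq_three ht
        have hc : 0 < (subtermAt L q).children.length := by rw [ha]; exact Nat.one_pos
        rw [(key 0 hc _ (by omega)).1, (key 0 hc _ (by omega)).2, (key 0 hc _ (by omega)).1,
          (key 0 hc _ (by omega)).2]
        exact h1.neg ht
      · obtain ⟨a, b, ha⟩ := OLTerm.tag_eq_four ht
        have hc' : c < (subtermAt L q).children.length := by rw [ha]; exact hc
        rw [(key c hc' _ (by omega)).1, (key c hc' _ (by omega)).2, (key c hc' _ (by omega)).1,
          (key c hc' _ (by omega)).2]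
        exact h1.meet ht c hc
      · obtain ⟨a, b, ha⟩ := OLTerm.tag_eq_five ht
        have hc' : c < (subtermAt L q).children.length := by rw [ha]; exact hc
        rw [(key c hc' _ (by omega)).1, (key c hc' _ (by omega)).2, (key c hc' _ (by omega)).1,
          (key c hc' _ (by omega)).2]
        exact h1.join ht c hc

theorem NodeTable.congr {L : List OLTerm} {k : ℕ} {m m' : ℕ → ℕ → ℕ} (h : NodeTable L k m)
    (hm : ∀ b, 1 ≤ b → b ≤ 12 → m' b = m b) : NodeTable L k m' := by
  have e : ∀ b, 1 ≤ b → b ≤ 12 → m' b = m b := hm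
  constructor
  · simpa only [e 1 (by norm_num) (by norm_num), e 2 (by norm_num) (by norm_num),
      e 3 (by norm_num) (by norm_num), e 4 (by norm_num) (by norm_num),
      e 5 (by norm_num) (by norm_num)] using h.label
  · simpa only [e 6 (by norm_num) (by norm_num)] using h.arity
  · simpa only [e 7 (by norm_num) (by norm_num)] using h.fin
  · simpa only [e 8 (by norm_num) (by norm_num), e 9 (by norm_num) (by norm_num)]
      using h.parent_child
  · simpa only [e 8 (by norm_num) (by norm_num), e 9 (by norm_num) (by norm_num)]
      using h.child_parent
  · simpa only [e 12 (by norm_num) (by norm_num)] using h.node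
  · simpa only [e 10 (by norm_num) (by norm_num), e 11 (by norm_num) (by norm_num)] using h.entry
  · simpa only [e 10 (by norm_num) (by norm_num), e 11 (by norm_num) (by norm_num)] using h.context

/-- The constants in the registers during the computation of the tables for `N` nodes. -/
structure SetupRegs (N : ℕ) (σ : RamState) : Prop where
  one : σ.reg 1 = 1
  zero : σ.reg 2 = 0
  size : σ.reg 3 = 2 * N
  length : σ.reg 4 = 0
  position : σ.reg 5 = 0
  count : σ.reg 6 = N
  five : σ.reg 11 = 5
  three : σ.reg 40 = 3
  four : σ.reg 41 = 4
  two : σ.reg 43 = 2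

theorem SetupRegs.of_eq {N : ℕ} {σ τ : RamState} (h : SetupRegs N σ)
    (hr : ∀ r, r < 12 ∨ 40 ≤ r → τ.reg r = σ.reg r) : SetupRegs N τ where
  one := (hr 1 (by norm_num)).trans h.one
  zero := (hr 2 (by norm_num)).trans h.zero
  size := (hr 3 (by norm_num)).trans h.size
  length := (hr 4 (by norm_num)).trans h.length
  position := (hr 5 (by norm_num)).trans h.position
  count := (hr 6 (by norm_num)).trans h.count
  five := (hr 11 (by norm_num)).trans h.five
  three := (hr 40 (by norm_num)).trans h.three
  four := (hr 41 (by norm_num)).trans h.four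
  two := (hr 43 (by norm_num)).trans h.two

/-! ### Programs that enter one node into the tables -/

namespace RamProg

open RamInstr RamTest

/-- Go to the previous node, in register `12`, and load its record. -/
def readWords : RamProg :=
  block [sub 12 12 1, sub 13 13 11, load 14 0 13, add 20 13 1, load 15 0 20, add 20 20 1,
    load 16 0 20, add 20 20 1, load 17 0 20, add 20 20 1, load 18 0 20] skip

/-- Replace the numbers of arguments in the record of a connective. -/
def fixArity : RamProg :=
  seq (ite (eq 14 40) (instr (copy 18 1)) skip)
    (seq (ite (eq 14 41) (instr (copy 17 43)) skip) (ite (eq 14 11) (instr (copy 17 43)) skip))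

/-- Enter the label and the default values for the node in register `12`. -/
def storeNode : RamProg :=
  block [add 19 16 17, add 19 19 18, store 1 12 14, store 2 12 15, store 3 12 16, store 4 12 17,
    store 5 12 18, store 6 12 19, store 9 12 2, add 21 12 12, add 22 21 1, store 12 21 12,
    store 12 22 12, store 10 21 21, store 10 22 22, store 11 21 21, store 11 22 22] skip

/-- Enter the parent for the children of the node in register `12`, and the end of this node. -/
def walkChildren : RamProg :=
  block [add 23 12 1, copy 24 2]
    (seq (loop (lt 24 19)
        (block [store 8 23 12, add 24 24 1, store 9 23 24, load 23 7 23] skip))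
      (block [store 7 12 23] skip))

/-- Enter the logical rules for the children of the node in register `12`. -/
def fillContext : RamProg :=
  ite (eq 14 40)
    (block [add 23 12 1, add 25 23 23, add 26 25 1, store 10 25 22, store 10 26 21, store 11 25 25,
      store 11 26 26] skip)
    (ite (eq 14 41)
      (block [add 23 12 1, load 24 7 23, add 25 23 23, add 26 25 1, add 27 24 24, add 28 27 1,
        store 10 25 21, store 10 26 22, store 10 27 21, store 10 28 22,
        store 11 25 25, store 11 26 28, store 11 27 27, store 11 28 26] skip)
      (ite (eq 14 11)
        (block [add 23 12 1, load 24 7 23, add 25 23 23, add 26 25 1, add 27 24 24, add 28 27 1,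
          store 10 25 21, store 10 26 22, store 10 27 21, store 10 28 22,
          store 11 25 27, store 11 26 26, store 11 27 25, store 11 28 28] skip)
        skip))

/-- Enter the previous node. -/
def enterNode : RamProg :=
  seq readWords (seq fixArity (seq storeNode (seq walkChildren fillContext)))

/-- The word registers hold the label of the term `t`, and the registers `12` and `13` the number
`p` of the node and the address of its record. -/
structure NodeRegs (σ : RamState) (p : ℕ) (t : OLTerm) : Prop where
  node : σ.reg 12 = p
  address : σ.reg 13 = 3 + 5 * p
  tag : σ.reg 14 = t.tag
  letter : σ.reg 15 = t.letter
  argI : σ.reg 16 = t.argI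
  argJ : σ.reg 17 = t.argJ
  argK : σ.reg 18 = t.argK

variable {w N : ℕ} {L : List OLTerm} {σ τ : RamState} {p : ℕ} {t : OLTerm}

theorem runs_readWords (hw : 64 * (2 * N * (2 * N)) ≤ 2 ^ w) (hs : SetupRegs N σ) (hp : p < N)
    (h12 : σ.reg 12 = p + 1) (h13 : σ.reg 13 = 3 + 5 * (p + 1))
    (hin : ∀ o < 5, σ.mem 0 (3 + 5 * p + o) = t.record.getD o 0) :
    readWords.Runs w σ fun s τ => s = 12 ∧ τ.mem = σ.mem ∧ τ.reg 12 = p ∧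
      τ.reg 13 = 3 + 5 * p ∧ τ.reg 14 = t.record.getD 0 0 ∧ τ.reg 15 = t.record.getD 1 0 ∧
      τ.reg 16 = t.record.getD 2 0 ∧ τ.reg 17 = t.record.getD 3 0 ∧
      τ.reg 18 = t.record.getD 4 0 ∧ ∀ r, r < 12 ∨ 40 ≤ r → τ.reg r = σ.reg r := by
  have hN : 2 * N ≤ 2 * N * (2 * N) := Nat.le_mul_of_pos_right _ (by omega)
  have e13 : 3 + 5 * (p + 1) - 5 = 3 + 5 * p := by omega
  simp only [readWords, runs_block_cons, runs_block_nil, runs_skip, apply, NoOverflow,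
    Function.update_apply, Nat.reduceEqDiff, reduceIte, true_and, OfNat.one_ne_ofNat, h12, h13,
    hs.one, hs.five, e13, add_assoc, Nat.reduceAdd, Nat.add_sub_cancel]
  have h0 := hin 0 (by norm_num)
  have h1 := hin 1 (by norm_num)
  have h2 := hin 2 (by norm_num)
  have h3 := hin 3 (by norm_num)
  have h4 := hin 4 (by norm_num)
  simp only [add_assoc, add_zero] at h0 h1 h2 h3 h4
  refine ⟨by omega, by omega, by omega, by omega, h0, h1, h2, h3, h4, fun r hr => ?_⟩
  repeat rw [if_neg (by omega)]

/-- The records of connectives contain zero arities. They are corrected so that negation has one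
contravariant argument and meet and join have two covariant ones. -/
theorem runs_fixArity (hs : SetupRegs N σ)
    (h12 : σ.reg 12 = p) (h13 : σ.reg 13 = 3 + 5 * p) (h14 : σ.reg 14 = t.record.getD 0 0)
    (h15 : σ.reg 15 = t.record.getD 1 0) (h16 : σ.reg 16 = t.record.getD 2 0)
    (h17 : σ.reg 17 = t.record.getD 3 0) (h18 : σ.reg 18 = t.record.getD 4 0) :
    fixArity.Runs w σ fun s τ => s ≤ 6 ∧ τ.mem = σ.mem ∧ NodeRegs τ p t ∧
      ∀ r, r < 12 ∨ 40 ≤ r → τ.reg r = σ.reg r := by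
  simp only [fixArity, runs_seq, runs_ite, runs_instr, runs_skip, Holds, apply, NoOverflow,
    Function.update_apply, Nat.reduceEqDiff, reduceIte, true_and, h14, hs.three, hs.four, hs.five]
  cases t <;> simp [OLTerm.record] at * <;>
    first
    | exact ⟨h12, h13, h14, h15, h16, h17, h18⟩
    | refine ⟨⟨?_, ?_, ?_, ?_, ?_, ?_, ?_⟩, ?_⟩ <;>
      first
      | exact fun r hr hr' => by omega
      | simp [OLTerm.tag, OLTerm.letter, OLTerm.argI, OLTerm.argJ, OLTerm.argK, hs.one, hs.two, *]

theorem runs_storeNode (hw : 64 * (2 * N * (2 * N)) ≤ 2 ^ w) (hs : SetupRegs N σ) (hp : p < N)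
    (ht : t.children.length ≤ N) (h : NodeRegs σ p t) :
    storeNode.Runs w σ fun s τ => s = 18 ∧ NodeRegs τ p t ∧
      (∀ r, r < 12 ∨ 40 ≤ r → τ.reg r = σ.reg r) ∧ τ.reg 19 = t.children.length ∧
      τ.reg 21 = 2 * p ∧ τ.reg 22 = 2 * p + 1 ∧
      τ.mem 1 = Function.update (σ.mem 1) p t.tag ∧
      τ.mem 2 = Function.update (σ.mem 2) p t.letter ∧
      τ.mem 3 = Function.update (σ.mem 3) p t.argI ∧
      τ.mem 4 = Function.update (σ.mem 4) p t.argJ ∧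
      τ.mem 5 = Function.update (σ.mem 5) p t.argK ∧
      τ.mem 6 = Function.update (σ.mem 6) p t.children.length ∧
      τ.mem 9 = Function.update (σ.mem 9) p 0 ∧
      τ.mem 12 = Function.update (Function.update (σ.mem 12) (2 * p) p) (2 * p + 1) p ∧
      τ.mem 10 = Function.update (Function.update (σ.mem 10) (2 * p) (2 * p)) (2 * p + 1)
        (2 * p + 1) ∧
      τ.mem 11 = Function.update (Function.update (σ.mem 11) (2 * p) (2 * p)) (2 * p + 1)
        (2 * p + 1) ∧
      τ.mem 7 = σ.mem 7 ∧ τ.mem 8 = σ.mem 8 ∧ ∀ b, b = 0 ∨ 13 ≤ b → τ.mem b = σ.mem b := by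
  have hN : 2 * N ≤ 2 * N * (2 * N) := Nat.le_mul_of_pos_right _ (by omega)
  have hlen := t.length_children
  simp only [storeNode, runs_block_cons, runs_block_nil, runs_skip, apply, NoOverflow,
    Function.update_apply, Nat.reduceEqDiff, reduceIte, true_and, OfNat.one_ne_ofNat,
    h.node, h.tag, h.letter, h.argI, h.argJ, h.argK, hs.one, hs.zero, ← two_mul]
  refine ⟨by omega, by omega, by omega, by omega, rfl, ⟨?_, ?_, ?_, ?_, ?_, ?_, ?_⟩, ?_,
    hlen.symm, by rw [hlen], ?_⟩
  · simpa using h.node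
  · simpa using h.address
  · simpa using h.tag
  · simpa using h.letter
  · simpa using h.argI
  · simpa using h.argJ
  · simpa using h.argK
  · intro r hr
    repeat rw [if_neg (by omega)]
  · intro b hb
    repeat rw [if_neg (by omega)]

end RamProg

namespace RamProg

open RamInstr RamTest

variable {w : ℕ} {L : List OLTerm} {σ τ : RamState} {p : ℕ}

theorem NodeRegs.of_eq {t : OLTerm} (h : NodeRegs σ p t)
    (hr : ∀ r, 12 ≤ r → r < 19 → τ.reg r = σ.reg r) : NodeRegs τ p t where
  node := (hr 12 (by norm_num) (by norm_num)).trans h.node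
  address := (hr 13 (by norm_num) (by norm_num)).trans h.address
  tag := (hr 14 (by norm_num) (by norm_num)).trans h.tag
  letter := (hr 15 (by norm_num) (by norm_num)).trans h.letter
  argI := (hr 16 (by norm_num) (by norm_num)).trans h.argI
  argJ := (hr 17 (by norm_num) (by norm_num)).trans h.argJ
  argK := (hr 18 (by norm_num) (by norm_num)).trans h.argK

/-- The state in the loop of `walkChildren` after `c` children of the node `p`. -/
structure WalkState (L : List OLTerm) (p : ℕ) (σ : RamState) (c : ℕ) (τ : RamState) : Prop where
  child : τ.reg 23 = childPos L p c
  count : τ.reg 24 = c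
  reg_frame : ∀ r, r ≠ 23 → r ≠ 24 → τ.reg r = σ.reg r
  mem_frame : ∀ b, b ≠ 8 → b ≠ 9 → τ.mem b = σ.mem b
  parent : ∀ c' < c, τ.mem 8 (childPos L p c') = p ∧ τ.mem 9 (childPos L p c') = c' + 1
  parent_frame : ∀ x, (∀ c' < c, x ≠ childPos L p c') →
    τ.mem 8 x = σ.mem 8 x ∧ τ.mem 9 x = σ.mem 9 x

/-- The children come after `p`, so their ends are already known; the walk from child to child stops
at the end of `p`, which is thereby computed. -/
theorem runs_walkChildren (hw : 64 * (2 * L.length * (2 * L.length)) ≤ 2 ^ w)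
    (hL : WellNested L) (hs : SetupRegs L.length σ) (hp : p < L.length)
    (h : NodeRegs σ p (subtermAt L p)) (h19 : σ.reg 19 = (subtermAt L p).children.length)
    (hfin : ∀ q, p < q → q < L.length → σ.mem 7 q = endAt L q) :
    walkChildren.Runs w σ fun s τ => s ≤ 6 * L.length + 5 ∧
      (∀ r, r ≠ 23 → r ≠ 24 → τ.reg r = σ.reg r) ∧
      τ.mem 7 = Function.update (σ.mem 7) p (endAt L p) ∧
      (∀ c' < (subtermAt L p).children.length,
        τ.mem 8 (childPos L p c') = p ∧ τ.mem 9 (childPos L p c') = c' + 1) ∧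
      (∀ x, (∀ c' < (subtermAt L p).children.length, x ≠ childPos L p c') →
        τ.mem 8 x = σ.mem 8 x ∧ τ.mem 9 x = σ.mem 9 x) ∧
      ∀ b, b ≠ 7 → b ≠ 8 → b ≠ 9 → τ.mem b = σ.mem b := by
  have hN : 2 * L.length ≤ 2 * L.length * (2 * L.length) :=
    Nat.le_mul_of_pos_right _ (by omega)
  have har := OLTerm.children_length_le hL hp
  simp only [walkChildren, runs_block_cons, runs_block_nil, runs_seq, runs_skip, apply, NoOverflow,
    true_and]
  refine ⟨by rw [h.node, hs.one]; omega, (runs_loop_count (subtermAt L p).children.length 5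
    (WalkState L p σ) ?_ ?_ ?_).mono ?_⟩
  · intro c τ _ hτ
    simp only [Holds, hτ.count, hτ.reg_frame 19 (by norm_num) (by norm_num), h19]
  · intro c τ hc hτ
    have h12 : τ.reg 12 = p := (hτ.reg_frame 12 (by norm_num) (by norm_num)).trans h.node
    have h1 : τ.reg 1 = 1 := (hτ.reg_frame 1 (by norm_num) (by norm_num)).trans hs.one
    have h7 := (congrFun (hτ.mem_frame 7 (by norm_num) (by norm_num)) _).trans
      (hfin (childPos L p c) lt_childPos (hL.childPos_lt hp hc))
    simp only [runs_block_cons, runs_block_nil, runs_skip, apply, NoOverflow, true_and,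
      Function.update_apply, Nat.reduceEqDiff, reduceIte, h12, h1, hτ.child, hτ.count, h7]
    refine ⟨by omega, by omega, ?_, ?_, ?_, ?_, ?_, ?_⟩
    · simp [childPos_succ]
    · simp
    · intro r hr hr'
      simp only [Function.update_apply]
      repeat rw [if_neg (by omega)]
      exact hτ.reg_frame r hr hr'
    · intro b hb hb'
      simp only [Function.update_apply]
      rw [if_neg (by omega), if_neg (by omega)]
      exact hτ.mem_frame b hb hb'
    · intro c' hc'
      simp only [Function.update_apply, Nat.reduceEqDiff, reduceIte]
      rcases Nat.lt_succ_iff_lt_or_eq.1 hc' with hlt | rfl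
      · have : childPos L p c' ≠ childPos L p c := (childPos_strictMono hlt).ne
        rw [if_neg this, if_neg this]
        exact hτ.parent c' hlt
      · simp
    · intro x hx
      simp only [Function.update_apply, Nat.reduceEqDiff, reduceIte]
      rw [if_neg (hx c (Nat.lt_succ_self c)), if_neg (hx c (Nat.lt_succ_self c))]
      exact hτ.parent_frame x fun c' hc' => hx c' (hc'.trans (Nat.lt_succ_self c))
  · refine ⟨?_, ?_, ?_, fun _ _ _ => rfl, fun _ hc => absurd hc (by omega), fun _ _ => ⟨rfl, rfl⟩⟩
    · simp [h.node, hs.one, childPos_zero]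
    · simp [hs.zero]
    · intro r hr hr'
      simp only [Function.update_apply]
      rw [if_neg hr', if_neg hr]
  · rintro t τ ⟨ht, hτ⟩
    have h12 : τ.reg 12 = p := (hτ.reg_frame 12 (by norm_num) (by norm_num)).trans h.node
    rw [h12, hτ.child, hL.childPos_length hp]
    refine ⟨?_, hτ.reg_frame, ?_, ?_, ?_, ?_⟩
    · have : (subtermAt L p).children.length * (5 + 1) ≤ 6 * L.length := by omega
      omega
    · simp [hτ.mem_frame 7]
    · simpa using hτ.parent
    · simpa using hτ.parent_frame
    · intro b h7 h8 h9
      simp only [Function.update_apply]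
      rw [if_neg h7]
      exact hτ.mem_frame b h8 h9

theorem runs_fillContext (hw : 64 * (2 * L.length * (2 * L.length)) ≤ 2 ^ w)
    (hL : WellNested L) (hs : SetupRegs L.length σ) (hp : p < L.length)
    (h : NodeRegs σ p (subtermAt L p)) (h21 : σ.reg 21 = 2 * p) (h22 : σ.reg 22 = 2 * p + 1)
    (hfin : ∀ q, p < q → q < L.length → σ.mem 7 q = endAt L q) :
    fillContext.Runs w σ fun s τ => s ≤ 18 ∧
      (∀ r, r < 12 ∨ 40 ≤ r → τ.reg r = σ.reg r) ∧ NodeRegs τ p (subtermAt L p) ∧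
      ContextTable L p (τ.mem 10) (τ.mem 11) ∧
      (∀ d, ((subtermAt L p).tag = 3 ∨ (subtermAt L p).tag = 4 ∨ (subtermAt L p).tag = 5 →
        ∀ c < (subtermAt L p).children.length, d / 2 ≠ childPos L p c) →
        τ.mem 10 d = σ.mem 10 d ∧ τ.mem 11 d = σ.mem 11 d) ∧
      ∀ b, b ≠ 10 → b ≠ 11 → τ.mem b = σ.mem b := by
  have hN : 2 * L.length ≤ 2 * L.length * (2 * L.length) :=
    Nat.le_mul_of_pos_right _ (by omega)
  have two : ∀ c < 2, c = 0 ∨ c = 1 := by omega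
  have c01 : childPos L p 0 < childPos L p 1 := childPos_strictMono Nat.one_pos
  have e0 : p + 1 = childPos L p 0 := rfl
  simp only [fillContext, runs_ite, runs_skip, Holds, h.tag, hs.three, hs.four, hs.five]
  refine ⟨fun ht => ?_, fun h3 => ⟨fun ht => ?_, fun h4 => ⟨fun ht => ?_, fun h5 => ?_⟩⟩⟩
  · obtain ⟨a, ha⟩ := OLTerm.tag_eq_three ht
    have l0 := hL.childPos_lt hp (c := 0) (by rw [ha]; exact Nat.one_pos)
    simp only [runs_block_cons, runs_block_nil, runs_skip, apply, NoOverflow, true_and,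
      Function.update_apply, Nat.reduceEqDiff, reduceIte, OfNat.one_ne_ofNat, h.node, hs.one, h21,
      h22, ← two_mul, e0]
    refine ⟨by omega, by omega, by omega, by omega, fun r hr => ?_, h.of_eq fun r hr hr' => ?_,
      ⟨fun _ => ?_, fun h' => by omega, fun h' => by omega⟩, fun d hd => ?_, fun b hb hb' => ?_⟩
    · repeat rw [if_neg (by omega)]
    · simp only [Function.update_apply]
      repeat rw [if_neg (by omega)]
    · simp
    · have := hd (Or.inl ht) 0 (by rw [ha]; exact Nat.one_pos)
      constructor <;> repeat rw [if_neg (by omega)]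
    · repeat rw [if_neg (by omega)]
  · obtain ⟨a, b, ha⟩ := OLTerm.tag_eq_four ht
    have l0 := hL.childPos_lt hp (c := 0) (by rw [ha]; exact Nat.two_pos)
    have l1 := hL.childPos_lt hp (c := 1) (by rw [ha]; exact Nat.one_lt_two)
    have hf := hfin _ lt_childPos l0
    rw [← childPos_succ] at hf
    simp only [runs_block_cons, runs_block_nil, runs_skip, apply, NoOverflow, true_and,
      Function.update_apply, Nat.reduceEqDiff, reduceIte, OfNat.one_ne_ofNat, h.node, hs.one, h21,
      h22, ← two_mul, e0, hf, zero_add]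
    refine ⟨by omega, by omega, by omega, by omega, by omega, by omega, fun r hr => ?_,
      h.of_eq fun r hr hr' => ?_, ⟨fun h' => by omega, fun _ c hc => ?_, fun h' => by omega⟩,
      fun d hd => ?_, fun b hb hb' => ?_⟩
    · repeat rw [if_neg (by omega)]
    · simp only [Function.update_apply]
      repeat rw [if_neg (by omega)]
    · rcases two c hc with rfl | rfl
      · refine ⟨?_, ?_, ?_, ?_⟩ <;> simp only [Function.update_apply, Nat.sub_zero] <;>
          split_ifs <;> omega
      · refine ⟨?_, ?_, ?_, ?_⟩ <;> simp only [Function.update_apply, Nat.sub_self] <;>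
          split_ifs <;> omega
    · have d0 := hd (Or.inr (Or.inl ht)) 0 (by rw [ha]; exact Nat.two_pos)
      have d1 := hd (Or.inr (Or.inl ht)) 1 (by rw [ha]; exact Nat.one_lt_two)
      constructor <;> repeat rw [if_neg (by omega)]
    · repeat rw [if_neg (by omega)]
  · obtain ⟨a, b, ha⟩ := OLTerm.tag_eq_five ht
    have l0 := hL.childPos_lt hp (c := 0) (by rw [ha]; exact Nat.two_pos)
    have l1 := hL.childPos_lt hp (c := 1) (by rw [ha]; exact Nat.one_lt_two)
    have hf := hfin _ lt_childPos l0
    rw [← childPos_succ] at hf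
    simp only [runs_block_cons, runs_block_nil, runs_skip, apply, NoOverflow, true_and,
      Function.update_apply, Nat.reduceEqDiff, reduceIte, OfNat.one_ne_ofNat, h.node, hs.one, h21,
      h22, ← two_mul, e0, hf, zero_add]
    refine ⟨by omega, by omega, by omega, by omega, by omega, by omega, fun r hr => ?_,
      h.of_eq fun r hr hr' => ?_, ⟨fun h' => by omega, fun h' => by omega, fun _ c hc => ?_⟩,
      fun d hd => ?_, fun b hb hb' => ?_⟩
    · repeat rw [if_neg (by omega)]
    · simp only [Function.update_apply]
      repeat rw [if_neg (by omega)]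
    · rcases two c hc with rfl | rfl
      · refine ⟨?_, ?_, ?_, ?_⟩ <;> simp only [Function.update_apply, Nat.sub_zero] <;>
          split_ifs <;> omega
      · refine ⟨?_, ?_, ?_, ?_⟩ <;> simp only [Function.update_apply, Nat.sub_self] <;>
          split_ifs <;> omega
    · have d0 := hd (Or.inr (Or.inr ht)) 0 (by rw [ha]; exact Nat.two_pos)
      have d1 := hd (Or.inr (Or.inr ht)) 1 (by rw [ha]; exact Nat.one_lt_two)
      constructor <;> repeat rw [if_neg (by omega)]
    · repeat rw [if_neg (by omega)]
  · exact ⟨by omega, fun _ _ => trivial, h, ⟨fun h' => absurd h' h3, fun h' => absurd h' h4,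
      fun h' => absurd h' h5⟩, fun _ _ => ⟨trivial, trivial⟩, fun _ _ _ => trivial⟩

/-- The default entries are written at `p` and the entries for parents and rules at its children, so
the later writes do not spoil the earlier ones. -/
theorem runs_enterNode (hw : 64 * (2 * L.length * (2 * L.length)) ≤ 2 ^ w)
    (hL : WellNested L) (hs : SetupRegs L.length σ) (hp : p < L.length)
    (h12 : σ.reg 12 = p + 1) (h13 : σ.reg 13 = 3 + 5 * (p + 1))
    (hin : ∀ o < 5, σ.mem 0 (3 + 5 * p + o) = (subtermAt L p).record.getD o 0)
    (h : NodeTable L (p + 1) σ.mem) :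
    enterNode.Runs w σ fun s τ => s ≤ 6 * L.length + 60 ∧
      (∀ r, r < 12 ∨ 40 ≤ r → τ.reg r = σ.reg r) ∧ τ.reg 12 = p ∧ τ.reg 13 = 3 + 5 * p ∧
      (∀ b, b = 0 ∨ 13 ≤ b → τ.mem b = σ.mem b) ∧ NodeTable L p τ.mem := by
  rw [enterNode, runs_seq]
  refine (runs_readWords hw hs hp h12 h13 hin).mono ?_
  rintro t₁ τ₁ ⟨rfl, m₁, r12, r13, r14, r15, r16, r17, r18, f₁⟩
  have hs₁ := hs.of_eq f₁
  rw [runs_seq]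
  refine (runs_fixArity hs₁ r12 r13 r14 r15 r16 r17 r18).mono ?_
  rintro t₂ τ₂ ⟨ht₂, m₂, hr₂, f₂⟩
  have hs₂ := hs₁.of_eq f₂
  rw [runs_seq]
  refine (runs_storeNode hw hs₂ hp (OLTerm.children_length_le hL hp) hr₂).mono ?_
  rintro t₃ τ₃ ⟨rfl, hr₃, f₃, r19, r21, r22, a1, a2, a3, a4, a5, a6, a9, a12, a10, a11, a7, a8, a0⟩
  have hs₃ := hs₂.of_eq f₃
  rw [m₂, m₁] at a1 a2 a3 a4 a5 a6 a9 a12 a10 a11 a7 a8 a0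
  have hfin : ∀ q, p < q → q < L.length → τ₃.mem 7 q = endAt L q := fun q hq hq' => by
    rw [a7]
    exact h.fin q hq' hq
  rw [runs_seq]
  refine (runs_walkChildren hw hL hs₃ hp hr₃ r19 hfin).mono ?_
  rintro t₄ τ₄ ⟨ht₄, f₄, b7, b89, bf, b0⟩
  have hs₄ := hs₃.of_eq fun r hr => f₄ r (by omega) (by omega)
  refine (runs_fillContext hw hL hs₄ hp (hr₃.of_eq fun r _ _ => f₄ r (by omega) (by omega))
    ((f₄ 21 (by norm_num) (by norm_num)).trans r21)
    ((f₄ 22 (by norm_num) (by norm_num)).trans r22) fun q hq hq' => ?_).mono ?_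
  · rw [b7, Function.update_of_ne (by omega)]
    exact hfin q hq hq'
  rintro t₅ τ₅ ⟨ht₅, f₅, hr₅, hctx, cf, c0⟩
  have c01 : ∀ c, childPos L p c ≠ p := fun c => lt_childPos.ne'
  refine ⟨by omega, fun r hr => ?_, hr₅.node, hr₅.address, fun b hb => ?_, h.step hL hp ?_⟩
  · rw [f₅ r hr, f₄ r (by omega) (by omega), f₃ r hr, f₂ r hr, f₁ r hr]
  · rw [c0 b (by omega) (by omega), b0 b (by omega) (by omega) (by omega), a0 b hb]
  · have keep : ∀ b, b ≠ 7 → b ≠ 8 → b ≠ 9 → b ≠ 10 → b ≠ 11 → τ₅.mem b = τ₃.mem b :=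
      fun b h7 h8 h9 h10 h11 => (c0 b h10 h11).trans (b0 b h7 h8 h9)
    constructor
    · rw [keep 1 (by norm_num) (by norm_num) (by norm_num) (by norm_num) (by norm_num), a1]
    · rw [keep 2 (by norm_num) (by norm_num) (by norm_num) (by norm_num) (by norm_num), a2]
    · rw [keep 3 (by norm_num) (by norm_num) (by norm_num) (by norm_num) (by norm_num), a3]
    · rw [keep 4 (by norm_num) (by norm_num) (by norm_num) (by norm_num) (by norm_num), a4]
    · rw [keep 5 (by norm_num) (by norm_num) (by norm_num) (by norm_num) (by norm_num), a5]
    · rw [keep 6 (by norm_num) (by norm_num) (by norm_num) (by norm_num) (by norm_num), a6]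
    · rw [c0 7 (by norm_num) (by norm_num), b7, a7]
    · rw [c0 8 (by norm_num) (by norm_num), c0 9 (by norm_num) (by norm_num)]
      exact b89
    · rw [c0 9 (by norm_num) (by norm_num), (bf p fun c _ => (c01 c).symm).2, a9,
        Function.update_self]
    · intro x hx hx'
      rw [c0 8 (by norm_num) (by norm_num), c0 9 (by norm_num) (by norm_num), (bf x hx').1,
        (bf x hx').2, a8, a9, Function.update_of_ne hx]
      exact ⟨rfl, rfl⟩
    · rw [keep 12 (by norm_num) (by norm_num) (by norm_num) (by norm_num) (by norm_num), a12]
    · intro d hd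
      obtain ⟨e1, e2⟩ := cf d fun _ c _ => by rw [hd]; exact (c01 c).symm
      rw [e1, e2, b0 10 (by norm_num) (by norm_num) (by norm_num),
        b0 11 (by norm_num) (by norm_num) (by norm_num), a10, a11]
      simp only [Function.update_apply]
      constructor <;> split_ifs <;> omega
    · exact hctx
    · intro d hd hd'
      obtain ⟨e1, e2⟩ := cf d hd'
      rw [e1, e2, b0 10 (by norm_num) (by norm_num) (by norm_num),
        b0 11 (by norm_num) (by norm_num) (by norm_num), a10, a11]
      simp only [Function.update_apply]
      constructor <;> repeat rw [if_neg (by omega)]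

end RamProg

/-! ### Reading all nodes -/

namespace RamProg

open RamInstr RamTest

variable {w N : ℕ} {L : List OLTerm} {σ : RamState}

/-- Compute the number of nodes and the constants. -/
def prelude : RamProg :=
  block [const 1 1, const 10 3, const 11 5, const 40 3, const 41 4, const 43 2]
    (seq (loop (lt 10 0) (block [add 10 10 11, add 6 6 1] skip))
      (block [add 3 6 6, copy 12 6, copy 13 0] skip))

/-- The machine cannot divide, so `N` is found by counting up from `3` in steps of `5` to the length
of the input. -/
theorem runs_prelude (hw : 64 * (2 * N * (2 * N)) ≤ 2 ^ w) (hN : 0 < N)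
    (h0 : σ.reg 0 = 3 + 5 * N) (hr : ∀ r, r ≠ 0 → σ.reg r = 0) :
    prelude.Runs w σ fun t τ => t ≤ 4 * N + 11 ∧ τ.mem = σ.mem ∧ SetupRegs N τ ∧
      τ.reg 12 = N ∧ τ.reg 13 = 3 + 5 * N := by
  have hN2 : 2 * N ≤ 2 * N * (2 * N) := Nat.le_mul_of_pos_right _ (by omega)
  simp only [prelude, runs_block_cons, runs_block_nil, runs_seq, runs_skip, apply, NoOverflow]
  refine ⟨by omega, by omega, by omega, by omega, by omega, by omega,
    (runs_loop_count N 3 (fun i τ => τ.mem = σ.mem ∧ τ.reg 10 = 3 + 5 * i ∧ τ.reg 6 = i ∧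
      τ.reg 0 = 3 + 5 * N ∧ τ.reg 1 = 1 ∧ τ.reg 2 = 0 ∧ τ.reg 4 = 0 ∧ τ.reg 5 = 0 ∧
      τ.reg 11 = 5 ∧ τ.reg 40 = 3 ∧ τ.reg 41 = 4 ∧ τ.reg 43 = 2) ?_ ?_ ?_).mono ?_⟩
  · rintro i τ - ⟨-, h10, -, h0, -⟩
    simp only [Holds, h10, h0]
    omega
  · rintro i τ hi ⟨hm, h10, h6, h0, h1, h2, h4, h5, h11, h40, h41, h43⟩
    simp only [runs_block_cons, runs_block_nil, runs_skip, apply, NoOverflow,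
      Function.update_apply, Nat.reduceEqDiff, reduceIte, OfNat.zero_ne_ofNat, OfNat.one_ne_ofNat,
      hm, h10, h6, h0, h1, h2, h4, h5, h11, h40, h41, h43, true_and, and_true]
    omega
  · simp [h0, hr]
  · rintro t τ ⟨ht, hm, h10, h6, h0, h1, h2, h4, h5, h11, h40, h41, h43⟩
    simp only [Function.update_apply, Nat.reduceEqDiff, reduceIte, OfNat.zero_ne_ofNat, hm, h6, h0]
    refine ⟨by omega, trivial, trivial, by omega, trivial, ?_, trivial, trivial⟩
    constructor <;> simp [*, two_mul]

/-- Enter all nodes, the last one first. -/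
def readNodes : RamProg := loop (lt 2 12) enterNode

theorem runs_readNodes (hw : 64 * (2 * L.length * (2 * L.length)) ≤ 2 ^ w)
    (hL : WellNested L) (hs : SetupRegs L.length σ) (h12 : σ.reg 12 = L.length)
    (h13 : σ.reg 13 = 3 + 5 * L.length)
    (hin : ∀ p < L.length, ∀ o < 5, σ.mem 0 (3 + 5 * p + o) = (subtermAt L p).record.getD o 0) :
    readNodes.Runs w σ fun t τ => t ≤ L.length * (6 * L.length + 61) + 1 ∧
      (∀ r, r < 12 ∨ 40 ≤ r → τ.reg r = σ.reg r) ∧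
      (∀ b, b = 0 ∨ 13 ≤ b → τ.mem b = σ.mem b) ∧ NodeTable L 0 τ.mem := by
  refine (runs_loop_count L.length (6 * L.length + 60) (fun i τ =>
    (∀ r, r < 12 ∨ 40 ≤ r → τ.reg r = σ.reg r) ∧ τ.reg 12 = L.length - i ∧
      τ.reg 13 = 3 + 5 * (L.length - i) ∧ (∀ b, b = 0 ∨ 13 ≤ b → τ.mem b = σ.mem b) ∧
      NodeTable L (L.length - i) τ.mem) ?_ ?_ ?_).mono ?_
  · rintro i τ hi ⟨hr, h12, -⟩
    simp only [Holds, h12, hr 2 (by norm_num), hs.zero]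
    omega
  · rintro i τ hi ⟨hr, h12, h13, hm, h⟩
    obtain ⟨p, hp⟩ : ∃ p, L.length - i = p + 1 := ⟨L.length - i - 1, by omega⟩
    have hp' : L.length - (i + 1) = p := by omega
    rw [hp] at h12 h13 h
    rw [hp']
    refine (runs_enterNode hw hL (hs.of_eq hr) (by omega) h12 h13 (fun o ho => ?_) h).mono ?_
    · rw [hm 0 (Or.inl rfl)]
      exact hin p (by omega) o ho
    · rintro t υ ⟨ht, hr', e12, e13, hm', h'⟩
      exact ⟨ht, fun r h => (hr' r h).trans (hr r h), e12, e13,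
        fun b hb => (hm' b hb).trans (hm b hb), h'⟩
  · refine ⟨fun _ _ => rfl, h12, h13, fun _ _ => rfl, ?_⟩
    -- Before the first round no node is to be described yet, and all conditions are vacuous.
    constructor <;> intros <;> omega
  · rintro t τ ⟨ht, hr, -, -, hm, h⟩
    rw [Nat.sub_self] at h
    exact ⟨ht, hr, hm, h⟩

end RamProg

/-- This lets a program move from the root of one input term to the root of the next by looking up
an end. -/
theorem List.drop_eq_nodes_append {L rest : List OLTerm} {t : OLTerm} {r : ℕ}
    (h : L.drop r = t.nodes ++ rest) :
    r < L.length ∧ subtermAt L r = t ∧ L.drop (endAt L r) = rest := by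
  have h1 : L[r]? = some t := by
    have := congrArg (fun l => l[0]?) h
    rw [OLTerm.nodes_eq] at this
    simpa using this
  have h2 := subtermAt_eq h1
  refine ⟨(List.getElem?_eq_some_iff.1 h1).1, h2, ?_⟩
  rw [endAt, h2, ← List.drop_drop, h, ← OLTerm.length_nodes, List.drop_left]

/-! ### Entering the axioms -/

namespace RamProg

open RamInstr RamTest

variable {w : ℕ} {L : List OLTerm} {σ : RamState}

/-- Enter the axioms; leave the root of the next term in register `15`. -/
def readAxioms : RamProg :=
  block [load 16 0 2, copy 14 2, copy 15 2]
    (loop (lt 14 16)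
      (block [load 17 7 15, add 18 15 15, add 19 18 1, add 20 17 17, add 21 20 1, store 13 19 21,
        add 22 19 1, store 13 20 22, load 15 7 17, add 14 14 1] skip))

/-- The state in the loop of `readAxioms` after `l` axioms. -/
structure AxiomState (A : List (OLTerm × OLTerm)) (L rest : List OLTerm) (σ : RamState) (l : ℕ)
    (τ : RamState) : Prop where
  count : τ.reg 14 = l
  bound : τ.reg 16 = A.length
  reg_frame : ∀ r, r < 14 ∨ 40 ≤ r → τ.reg r = σ.reg r
  mem_frame : ∀ b, b ≠ 13 → τ.mem b = σ.mem b
  drop : L.drop (τ.reg 15) = (A.drop l).flatMap (fun p => p.1.nodes ++ p.2.nodes) ++ rest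
  zero : ∀ d, 2 * τ.reg 15 ≤ d → τ.mem 13 d = 0
  table : AxiomTable (A.take l) L τ.mem
  card : ((Finset.range (2 * L.length)).filter fun d => τ.mem 13 d ≠ 0).card ≤ 2 * l

/-- Every axiom has nodes of its own, even if terms are repeated, so one partner per annotated node
is enough, and each axiom fills two cells. -/
theorem runs_readAxioms {A : List (OLTerm × OLTerm)} {rest : List OLTerm}
    (hw : 64 * (2 * L.length * (2 * L.length)) ≤ 2 ^ w) (hs : SetupRegs L.length σ)
    (h : NodeTable L 0 σ.mem) (h0 : σ.mem 0 0 = A.length) (h13 : ∀ d, σ.mem 13 d = 0)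
    (hA : A.length ≤ L.length)
    (hd : L = A.flatMap (fun p => p.1.nodes ++ p.2.nodes) ++ rest) :
    readAxioms.Runs w σ fun t τ => t ≤ A.length * 12 + 4 ∧
      AxiomState A L rest σ A.length τ := by
  have hN : 2 * L.length ≤ 2 * L.length * (2 * L.length) := by
    rcases Nat.eq_zero_or_pos L.length with h | h
    · simp [h]
    · exact Nat.le_mul_of_pos_right _ (by omega)
  simp only [readAxioms, runs_block_cons, runs_block_nil, apply, NoOverflow, true_and]
  refine (runs_loop_count A.length 11 (AxiomState A L rest σ) ?_ ?_ ?_).mono ?_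
  · intro l τ _ hτ
    simp only [Holds, hτ.count, hτ.bound]
  · intro l τ hl hτ
    have hdrop := hτ.drop
    rw [List.drop_eq_getElem_cons hl, List.flatMap_cons, List.append_assoc,
      List.append_assoc] at hdrop
    obtain ⟨ls, es, hdrop'⟩ := List.drop_eq_nodes_append hdrop
    obtain ⟨lt, et, hdrop''⟩ := List.drop_eq_nodes_append hdrop'
    set s := τ.reg 15 with hs15
    set t := endAt L s with ht
    have h1 : τ.reg 1 = 1 := (hτ.reg_frame 1 (by norm_num)).trans hs.one
    have hst : s < t := lt_endAt
    have htu : t < endAt L t := lt_endAt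
    have f1 : τ.mem 7 s = t := by rw [hτ.mem_frame 7 (by norm_num), h.fin s ls (Nat.zero_le _)]
    have f2 : τ.mem 7 t = endAt L t := by
      rw [hτ.mem_frame 7 (by norm_num), h.fin t lt (Nat.zero_le _)]
    have hmem : (subtermAt L s, subtermAt L t) ∈ A.take (l + 1) := by
      rw [es, et, List.take_succ_eq_append_getElem hl]
      exact List.mem_append_right _ (List.mem_singleton.2 rfl)
    simp only [runs_block_cons, runs_block_nil, runs_skip, apply, NoOverflow,
      Function.update_apply, Nat.reduceEqDiff, reduceIte, OfNat.one_ne_ofNat, true_and,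
      hτ.count, h1, ← hs15, f1, f2, ← two_mul]
    refine ⟨by omega, by omega, by omega, by omega, by omega, by omega, by omega, ?_, ?_, ?_, ?_,
      ?_, ?_, ?_, ?_⟩
    · simp
    · simpa using hτ.bound
    · intro r hr
      simp only [Function.update_apply]
      repeat rw [if_neg (by omega)]
      exact hτ.reg_frame r hr
    · intro b hb
      simp only [Function.update_apply]
      rw [if_neg hb, if_neg hb]
      exact hτ.mem_frame b hb
    · simpa using hdrop''
    · intro d hd
      simp only [Function.update_apply, Nat.reduceEqDiff, reduceIte] at hd ⊢
      rw [if_neg (by omega), if_neg (by omega)]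
      exact hτ.zero d (by omega)
    · constructor
      · intro d hd
        simp only [Function.update_apply, reduceIte] at hd ⊢
        split_ifs at hd ⊢ with c1 c2
        · exact ⟨s, ls, t, lt, hmem, Or.inr ⟨c1, by omega⟩⟩
        · exact ⟨s, ls, t, lt, hmem, Or.inl ⟨c2, rfl⟩⟩
        · obtain ⟨s', ls', t', lt', hm, ho⟩ := hτ.table.sound d hd
          refine ⟨s', ls', t', lt', ?_, ho⟩
          rw [List.take_succ_eq_append_getElem hl]
          exact List.mem_append_left _ hm
      · intro a ha
        rw [List.take_succ_eq_append_getElem hl, List.mem_append, List.mem_singleton] at ha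
        simp only [Function.update_apply, reduceIte]
        rcases ha with ha | rfl
        · obtain ⟨s', ls', t', lt', e1, e2, m1, m2⟩ := hτ.table.complete a ha
          -- All cells from the current root on are still `0`, so the nonzero entries of earlier
          -- axioms lie before it and are not overwritten.
          have b1 : 2 * s' + 1 < 2 * s := by
            by_contra hc
            have := hτ.zero (2 * s' + 1) (by omega)
            omega
          have b2 : 2 * t' < 2 * s := by
            by_contra hc
            have := hτ.zero (2 * t') (by omega)
            omega
          refine ⟨s', ls', t', lt', e1, e2, ?_, ?_⟩
          · rw [if_neg (by omega), if_neg (by omega), m1]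
          · rw [if_neg (by omega), if_neg (by omega), m2]
        · refine ⟨s, ls, t, lt, es, et, ?_, ?_⟩
          · rw [if_neg (by omega), if_pos rfl]
          · rw [if_pos rfl]
    · calc _ ≤ (insert (2 * t) (insert (2 * s + 1)
            ((Finset.range (2 * L.length)).filter fun d => τ.mem 13 d ≠ 0))).card := by
            refine Finset.card_le_card fun d hd => ?_
            simp only [Finset.mem_filter, Function.update_apply, reduceIte] at hd
            simp only [Finset.mem_insert, Finset.mem_filter]
            by_cases c1 : d = 2 * t
            · exact Or.inl c1
            by_cases c2 : d = 2 * s + 1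
            · exact Or.inr (Or.inl c2)
            rw [if_neg c1, if_neg c2] at hd
            exact Or.inr (Or.inr hd)
        _ ≤ _ := by
            have := hτ.card
            refine (Finset.card_insert_le _ _).trans ?_
            have := Finset.card_insert_le (2 * s + 1)
              ((Finset.range (2 * L.length)).filter fun d => τ.mem 13 d ≠ 0)
            omega
  · constructor
    · simp [hs.zero]
    · simp [hs.zero, h0]
    · intro r hr
      simp only [Function.update_apply]
      repeat rw [if_neg (by omega)]
    · exact fun _ _ => rfl
    · simpa [hs.zero] using hd
    · exact fun d _ => h13 d
    · exact ⟨fun d hd => absurd (h13 d) hd, fun a ha => by simp at ha⟩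
    · simp [h13]
  · rintro t τ ⟨ht, hτ⟩
    exact ⟨by omega, hτ⟩

end RamProg

/-! ## The decision procedure -/

/-- The subterms at the nodes of an instance, in the order of the input. -/
def instanceNodes (A : List (OLTerm × OLTerm)) (Γ Δ : AnnTerm) : List OLTerm :=
  A.flatMap (fun p => p.1.nodes ++ p.2.nodes) ++ (Γ.term.nodes ++ Δ.term.nodes)

section Instance

variable {A : List (OLTerm × OLTerm)} {Γ Δ : AnnTerm}

theorem wellNested_instanceNodes : WellNested (instanceNodes A Γ Δ) :=
  (WellNested.flatMap fun p _ => p.1.wellNested_nodes.append p.2.wellNested_nodes).append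
    (Γ.term.wellNested_nodes.append Δ.term.wellNested_nodes)

theorem length_instanceNodes : (instanceNodes A Γ Δ).length = instanceSize A Γ Δ := by
  simp [instanceNodes, instanceSize, List.length_flatMap, OLTerm.length_nodes, add_assoc]

theorem two_le_instanceSize : 2 ≤ instanceSize A Γ Δ := by
  have h1 := Γ.term.size_pos
  have h2 := Δ.term.size_pos
  rw [instanceSize]
  omega

theorem length_le_instanceSize : A.length ≤ instanceSize A Γ Δ := by
  have h : (A.map fun _ => 1).sum ≤ (A.map fun p => p.1.size + p.2.size).sum :=
    List.sum_le_sum fun p _ => Nat.le_add_right_of_le p.1.size_pos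
  rw [List.map_const', List.sum_replicate, smul_eq_mul, mul_one] at h
  rw [instanceSize]
  omega

theorem instanceInput_eq : instanceInput A Γ Δ =
    [A.length, Γ.side, Δ.side] ++ (instanceNodes A Γ Δ).flatMap OLTerm.record := by
  simp [instanceInput, instanceNodes, OLTerm.encode_eq_flatMap, List.flatMap_assoc]

theorem length_instanceInput :
    (instanceInput A Γ Δ).length = 3 + 5 * (instanceNodes A Γ Δ).length := by
  simp [instanceInput_eq, List.length_flatMap, OLTerm.record_length]
  omega

theorem getD_flatMap_record {L : List OLTerm} {p o : ℕ} (hp : p < L.length) (ho : o < 5) :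
    (L.flatMap OLTerm.record).getD (5 * p + o) 0 = (subtermAt L p).record.getD o 0 := by
  induction L generalizing p with
  | nil => simp at hp
  | cons t L ih =>
    have ht := t.record_length
    rw [List.flatMap_cons]
    rcases p with _ | p
    · rw [Nat.mul_zero, Nat.zero_add, List.getD_append _ _ _ _ (by omega)]
      rfl
    · rw [List.getD_append_right _ _ _ _ (by omega), ht,
        show 5 * (p + 1) + o - 5 = 5 * p + o by omega]
      exact ih (by simpa using hp)

theorem getD_instanceInput {p o : ℕ} (hp : p < (instanceNodes A Γ Δ).length) (ho : o < 5) :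
    (instanceInput A Γ Δ).getD (3 + 5 * p + o) 0 =
      (subtermAt (instanceNodes A Γ Δ) p).record.getD o 0 := by
  rw [instanceInput_eq, List.getD_append_right _ _ _ _ (by simp; omega),
    ← getD_flatMap_record hp ho]
  congr 1
  simp
  omega

end Instance

theorem annAt_side {L : List OLTerm} {p : ℕ} {Γ : AnnTerm} (h : subtermAt L p = Γ.term) :
    annAt L (2 * p + Γ.side) = Γ := by
  cases Γ with
  | L s => exact (annAt_even L p).trans (congrArg AnnTerm.L h)
  | R s => exact (annAt_odd L p).trans (congrArg AnnTerm.R h)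

theorem AnnTerm.side_lt (Γ : AnnTerm) : Γ.side < 2 := by
  cases Γ <;> simp [side]

namespace RamProg

open RamInstr RamTest

variable {w : ℕ} {L : List OLTerm} {σ : RamState}

/-- Store the position of the mark for the sequent. -/
def locate : RamProg :=
  block [load 17 0 1, load 18 0 43, load 19 7 15, add 20 15 15, add 20 20 17, add 21 19 19,
    add 21 21 18, mul 20 20 3, add 20 20 21, store 0 2 20] skip

/-- The index of the sequent in the matrix is kept in the first cell of the input, since the
saturation leaves bank `0` unchanged but reuses the registers. -/
theorem runs_locate {Γ Δ : AnnTerm} (hw : 64 * (2 * L.length * (2 * L.length)) ≤ 2 ^ w)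
    (hs : SetupRegs L.length σ) (h : NodeTable L 0 σ.mem) (h1 : σ.mem 0 1 = Γ.side)
    (h2 : σ.mem 0 2 = Δ.side) (hd : L.drop (σ.reg 15) = Γ.term.nodes ++ Δ.term.nodes) :
    locate.Runs w σ fun t τ => t = 11 ∧ (∀ r, r < 12 ∨ 40 ≤ r → τ.reg r = σ.reg r) ∧
      (∀ b, b ≠ 0 → τ.mem b = σ.mem b) ∧ ∃ g < 2 * L.length, ∃ d < 2 * L.length,
        annAt L g = Γ ∧ annAt L d = Δ ∧ τ.mem 0 0 = g * (2 * L.length) + d := by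
  obtain ⟨lp, ep, hd'⟩ := List.drop_eq_nodes_append hd
  obtain ⟨lq, eq, -⟩ := List.drop_eq_nodes_append (hd'.trans (List.append_nil _).symm)
  set p := σ.reg 15 with hp
  set q := endAt L p
  have hN : 2 * L.length ≤ 2 * L.length * (2 * L.length) := Nat.le_mul_of_pos_right _ (by omega)
  have f : σ.mem 7 p = q := h.fin p lp (Nat.zero_le _)
  have sg := Γ.side_lt
  have sd := Δ.side_lt
  have hg : 2 * p + Γ.side < 2 * L.length := by omega
  have hm := pair_lt hg (show 2 * q + Δ.side < 2 * L.length by omega)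
  simp only [locate, runs_block_cons, runs_block_nil, runs_skip, apply, NoOverflow, true_and,
    Function.update_apply, Nat.reduceEqDiff, reduceIte, hs.one, hs.two, hs.zero,
    hs.size, h1, h2, ← hp, f, ← two_mul]
  refine ⟨by omega, by omega, by omega, by omega, by omega, by omega, rfl, fun r hr => ?_,
    fun b hb => ?_, 2 * p + Γ.side, hg, 2 * q + Δ.side, by omega, annAt_side ep, annAt_side eq,
    rfl⟩
  · repeat rw [if_neg (by omega)]
  · rw [if_neg hb]

/-- The decision procedure. -/
def decideSequent : RamProg :=
  seq prelude (seq readNodes (seq readAxioms (seq locate (seq initFacts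
    (seq saturate (block [load 10 0 2, load 0 14 10] skip))))))

theorem runs_decideSequent {A : List (OLTerm × OLTerm)} {Γ Δ : AnnTerm}
    (hw : instanceSize A Γ Δ ^ 10 ≤ 2 ^ w) :
    decideSequent.Runs w (RamState.init (instanceInput A Γ Δ)) fun t τ =>
      t ≤ 1400 * instanceSize A Γ Δ ^ 2 * (1 + A.length) ∧
        (CFPlus A Γ Δ → τ.reg 0 = 1) ∧ (¬ CFPlus A Γ Δ → τ.reg 0 = 0) := by
  have hL := wellNested_instanceNodes (A := A) (Γ := Γ) (Δ := Δ)
  have hin := fun p hp o ho => getD_instanceInput (A := A) (Γ := Γ) (Δ := Δ) (p := p) (o := o) hp ho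
  have hlen := length_instanceInput (A := A) (Γ := Γ) (Δ := Δ)
  have h2 := two_le_instanceSize (A := A) (Γ := Γ) (Δ := Δ)
  have hAN := length_le_instanceSize (A := A) (Γ := Γ) (Δ := Δ)
  have hA : A.length = (instanceInput A Γ Δ).getD 0 0 := by simp [instanceInput]
  have hΓ : Γ.side = (instanceInput A Γ Δ).getD 1 0 := by simp [instanceInput]
  have hΔ : Δ.side = (instanceInput A Γ Δ).getD 2 0 := by simp [instanceInput]
  have hdrop : instanceNodes A Γ Δ = A.flatMap (fun p => p.1.nodes ++ p.2.nodes) ++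
    (Γ.term.nodes ++ Δ.term.nodes) := rfl
  rw [← length_instanceNodes (A := A) (Γ := Γ) (Δ := Δ)] at hw h2 hAN ⊢
  generalize instanceNodes A Γ Δ = L at hL hin hlen h2 hAN hdrop hw ⊢
  generalize instanceInput A Γ Δ = inp at hin hlen hA hΓ hΔ ⊢
  -- There are at least two nodes, so the constant `256 = 2 ^ 8` is absorbed by eight further
  -- factors of the size; hence the exponent `10`.
  have hw : 64 * (2 * L.length * (2 * L.length)) ≤ 2 ^ w := by
    refine le_trans ?_ hw
    calc 64 * (2 * L.length * (2 * L.length)) = 2 ^ 8 * L.length ^ 2 := by ring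
      _ ≤ L.length ^ 8 * L.length ^ 2 := Nat.mul_le_mul_right _ (Nat.pow_le_pow_left h2 8)
      _ = L.length ^ 10 := by ring
  have minit : ∀ b, b ≠ 0 → ∀ a, (RamState.init inp).mem b a = 0 := fun b hb a => by
    simp [RamState.init, hb]
  have minp : ∀ a, (RamState.init inp).mem 0 a = inp.getD a 0 := fun a => by
    simp [RamState.init]
  rw [decideSequent, runs_seq]
  refine (runs_prelude hw (by omega) (by simpa [RamState.init] using hlen)
    (fun r hr => by simp [RamState.init, hr])).mono ?_
  rintro t₁ τ₁ ⟨ht₁, m₁, hs₁, h12, h13⟩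
  rw [runs_seq]
  refine (runs_readNodes hw hL hs₁ h12 h13 fun p hp o ho => ?_).mono ?_
  · rw [m₁, minp]
    exact hin p hp o ho
  rintro t₂ τ₂ ⟨ht₂, f₂, m₂, hT₂⟩
  have hs₂ := hs₁.of_eq f₂
  rw [runs_seq]
  refine (runs_readAxioms hw hs₂ hT₂ ?_ (fun d => ?_) hAN hdrop).mono ?_
  · rw [m₂ 0 (Or.inl rfl), m₁, minp, hA]
  · rw [m₂ 13 (by norm_num), m₁, minit 13 (by norm_num)]
  rintro t₃ τ₃ ⟨ht₃, h₃⟩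
  have hs₃ := hs₂.of_eq fun r hr => h₃.reg_frame r (by omega)
  have hT₃ := hT₂.congr (m' := τ₃.mem) fun b _ hb => h₃.mem_frame b (by omega)
  rw [runs_seq]
  refine (runs_locate (Γ := Γ) (Δ := Δ) hw hs₃ hT₃ ?_ ?_ ?_).mono ?_
  · rw [h₃.mem_frame 0 (by norm_num), m₂ 0 (Or.inl rfl), m₁, minp, hΓ]
  · rw [h₃.mem_frame 0 (by norm_num), m₂ 0 (Or.inl rfl), m₁, minp, hΔ]
  · simpa using h₃.drop
  rintro t₄ τ₄ ⟨ht₄, f₄, m₄, g, hg, d, hd, eg, ed, hgd⟩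
  have hs₄ := hs₃.of_eq f₄
  have hT₄ := hT₃.congr (m' := τ₄.mem) fun b hb _ => m₄ b (by omega)
  have hA₄ : AxiomTable A L τ₄.mem := by
    have := h₃.table
    rw [List.take_length] at this
    constructor
    · rw [m₄ 13 (by norm_num)]
      exact this.sound
    · rw [m₄ 13 (by norm_num)]
      exact this.complete
  have hm := hT₄.forestTable hL hA₄
  have hR := hT₄.stepClosed hL hA₄
  have hcard : ((Finset.range (2 * L.length)).filter fun d => τ₄.mem 13 d ≠ 0).card ≤
      2 * A.length := by
    rw [m₄ 13 (by norm_num)]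
    exact h₃.card
  -- The matrix needs no initialization: nothing has written to bank `14`, and its cells start at
  -- `0`.
  have hQ : Worklist L.length τ₄.mem (fun g d => CFPlus A (annAt L g) (annAt L d)) τ₄ [] := by
    refine ⟨hs₄.one, hs₄.zero, hs₄.size, hs₄.length, fun _ _ => rfl, fun g _ d _ => ?_,
      fun i hi => absurd hi (by simp), fun i hi => absurd hi (by simp), by simp, List.nodup_nil,
      by simp⟩
    rw [m₄ 14 (by norm_num), h₃.mem_frame 14 (by norm_num), m₂ 14 (by norm_num), m₁,
      minit 14 (by norm_num)]
    simp [ListRel]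
  rw [runs_seq]
  refine (runs_initFacts hw hm hR hQ hs₄.count).mono ?_
  rintro t₅ τ₅ ⟨ht₅, Q₅, hQ₅, -, f₅, hc₅⟩
  rw [runs_seq]
  refine (runs_saturate hw hm hR hQ₅ ((f₅ 5 (by norm_num) (by norm_num)).trans hs₄.position)
    hc₅).mono ?_
  rintro t₆ τ₆ ⟨ht₆, Q₆, hQ₆, hc₆, -⟩
  have hsum := sum_roundCost_le hm hcard
  simp only [runs_block_cons, runs_block_nil, runs_skip, apply, NoOverflow, true_and,
    Function.update_self, hQ₆.reg_zero, hQ₆.table 0 (by norm_num), hgd, hQ₆.mark g hg d hd]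
  refine ⟨?_, fun h => if_pos ?_, fun h => if_neg fun hr => h ?_⟩
  -- The quadratic terms have coefficients `1112` for saturation, `62` for the initial facts and `6`
  -- for the tables; the rest is linear in the number of nodes and fits into the remainder of
  -- `1400`.
  · have e1 : L.length ^ 2 = L.length * L.length := sq _
    have e2 : 1 * L.length ≤ L.length * L.length := Nat.mul_le_mul_right _ (by omega)
    have e3 : L.length ^ 2 * 1 ≤ L.length ^ 2 * (1 + A.length) := Nat.mul_le_mul_left _ (by omega)
    have e4 : 1400 * L.length ^ 2 * (1 + A.length) = 1400 * (L.length ^ 2 * (1 + A.length)) :=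
      mul_assoc _ _ _
    have e5 : L.length * (6 * L.length + 61) = 6 * L.length ^ 2 + 61 * L.length := by ring
    have e6 : L.length * (40 + L.length * 62) = 62 * L.length ^ 2 + 40 * L.length := by ring
    omega
  -- Provable sequents are marked since the final relation is closed under all rules; the next case
  -- uses that marked pairs are provable.
  · exact hT₄.complete hL hA₄ hc₆ (fun _ _ => ListRel.symm) h g hg d hd eg ed
  · have := hQ₆.rel hR g d hr
    rwa [eg, ed] at this

end RamProg

theorem mainTheorem2 :
    ∃ (p : RamProg) (C k : ℕ),
      (∀ (A : List (OLTerm × OLTerm)) (S T : OLTerm),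
        DecidesInTime p C k A (AnnTerm.L S) (AnnTerm.R T) (Entails.{u} A S T)) ∧
      (∀ (A : List (OLTerm × OLTerm)) (Γ Δ : AnnTerm),
        DecidesInTime p C k A Γ Δ (CFPlus A Γ Δ)) := by
  refine ⟨RamProg.decideSequent, 1400, 10, fun A S T => ?_, fun A Γ Δ w _ hw => ?_⟩
  · rw [entails_iff_cfPlus]
    intro w _ hw
    exact RamProg.runs_decideSequent hw
  · exact RamProg.runs_decideSequent hw
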